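/- Setting. Let $n\ge 1$, $s\in(0,1)$, $2s<n$, let $\Omega\subset\mathbb R^n$ be open, $\Omega_e=\mathbb R^n\setminus\overline\Omega$, $p=\max\{2,n/2s\}$. $W^{r,p}$ is the Bessel potential space, $H^r=W^{r,2}$, $H^s(\Omega_e)$ consists of the restrictions to $\Omega_e$ of functions in $H^s(\mathbb R^n)$, and $\tilde H^s(\Omega)$ is the closure of $C_c^\infty(\Omega)$ in $H^s(\mathbb R^n)$; functions are complex valued. For $a,b\in\mathbb C^n$, $a\cdot b=\sum_i a_ib_i$, and all products $\langle\cdot,\cdot\rangle$ are bilinear. Put $$\alpha(x,y)=\frac{\mathcal C_{n,s}^{1/2}}{\sqrt2}\frac{y-x}{|y-x|^{n/2+s+1}},\quad \nabla^su(x,y)=(u(x)-u(y))\,\alpha(x,y),\quad \nabla^s_Au(x,y)=\nabla^su(x,y)+A(x,y)u(x),$$ where $\mathcal C_{n,s}=\frac{4^s\Gamma(n/2+s)}{\pi^{n/2}|\Gamma(-s)|}$, and define the divergences by $\langle(\nabla\cdot)^sV,\varphi\rangle=\langle V,\nabla^s\varphi\rangle_{L^2(\mathbb R^{2n})}$, $\langle(\nabla\cdot)^s_AV,\varphi\rangle=\langle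 V,\nabla^s_A\varphi\rangle_{L^2(\mathbb R^{2n})}$. Set $(-\Delta)^s=(\nabla\cdot)^s\nabla^s$, $(-\Delta)^s_A=(\nabla\cdot)^s_A\nabla^s_A$, and $\mathrm C^s_{\gamma,A}u=(\nabla\cdot)^s_A(\Theta\nabla^s_Au)$ with $\Theta(x,y)=\sqrt{\gamma(x)\gamma(y)}$. Let $A:\mathbb R^{2n}\to\mathbb C^n$, $q\in L^p(\Omega)$ real valued (extended by $0$ in products). Write $A_s(x,y)=\frac{A(x,y)+A(y,x)}2$, $A_a=A-A_s$, and let $B_\parallel(x,y)=\frac{B(x,y)\cdot(x-y)}{|x-y|^2}(x-y)$ for $x\ne y$. Assume $(A,q)\in\mathcal P$, that is: $A\in L^2(\mathbb R^{2n})$ with $\mathrm{supp}(A)\subseteq\Omega^2$; the functions $\left(\int|A(y,x)|^2dy\right)^{1/2}$ and $\left(\int|A(x,y)|^2dy\right)^{1/2}$ of $x$ are in $L^{2p}(\mathbb R^n)$; $A_{s\parallel}\in H^{sp-s}(\mathbb R^{2n},\mathbb C^n)$; and $A_{a\parallel}(x,y)\cdot(y-x)\ge0$ for a.e. $x,y$.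 Let $\gamma$ be a conductivity: measurable, $0<\underline\gamma\le\gamma\le\overline\gamma<\infty$ a.e. for some constants, and $\gamma^{1/2}-1\in W^{2s,n/2s}(\mathbb R^n)$ with compact support contained in $\Omega$. Define the distribution $$q'=\frac q\gamma-(\nabla\cdot)^sA_{s\parallel}+\frac{(\nabla\cdot)^s(A\,\gamma^{1/2}(y))}{\gamma^{1/2}(x)}-\frac{(-\Delta)^s(\gamma^{1/2})}{\gamma^{1/2}(x)}+\int_{\mathbb R^n}\Big(-\frac{\nabla^s(\gamma^{1/2})\cdot A}{\gamma^{1/2}(x)}+A\cdot A\,\Big(\frac{\gamma^{1/2}(y)}{\gamma^{1/2}(x)}-1\Big)\Big)dy$$ ($A\cdot A=|A|^2$ if $A$ is real). Here products of a distribution with functions are defined by duality, e.g. $\langle q'u,v\rangle=\langle q',uv\rangle$ and $\langle (T/\gamma^{1/2}),\varphi\rangle=\langle T,\gamma^{-1/2}\varphi\rangle$. Say that $u\in H^s(\mathbb R^n)$ solves FMCE with potentials $(A,q)$, conductivity $\gamma$ and exterior value $g\in H^s(\Omega_e)$ if $u-G\in\tilde H^s(\Omega)$ for an extension $G\in H^s(\mathbb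 R^n)$ of $g$ and $\langle\mathrm C^s_{\gamma,A}u,v\rangle+\langle qu,v\rangle=0$ for all test functions $v$. Say that $w\in H^s(\mathbb R^n)$ solves FMSE with potentials $(A,Q)$ and exterior value $f\in H^s(\Omega_e)$ if $w-F\in\tilde H^s(\Omega)$ for an extension $F\in H^s(\mathbb R^n)$ of $f$ and $\langle(-\Delta)^s_Aw,v\rangle+\langle Qw,v\rangle=0$ for all test functions $v$. Lemma. Multiplication by $\gamma^{1/2}$ and by $\gamma^{-1/2}$ maps $H^s(\mathbb R^n)$ to itself, $\nabla^s_Au\in L^2(\mathbb R^{2n})$ for all $u\in H^s(\mathbb R^n)$, and for $u,v\in H^s(\mathbb R^n)$ all integrals that define $\langle qu,v\rangle$ and $\langle q'u,v\rangle$ converge absolutely. Let $u\in H^s(\mathbb R^n)$, $g\in H^s(\Omega_e)$, $w=\gamma^{1/2}u$, $f=\gamma^{1/2}g\in H^s(\Omega_e)$. Then $u$ solves FMCE with potentials $(A,q)$, conductivity $\gamma$ and exterior value $g$ if and only if $w$ solves FMSE with potentials $(A,q')$ and exterior value $f$; this holds both when the test functions are all $v\in\tilde H^s(\Omega)$ and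 when they are all $v\in H^s(\mathbb R^n)$. Also, $u-G\in\tilde H^s(\Omega)$ if and only if $w-\gamma^{1/2}G\in\tilde H^s(\Omega)$, for every $G\in H^s(\mathbb R^n)$. Moreover, for all $w\in H^s(\mathbb R^n)$, $$\mathrm C^s_{\gamma,A}(\gamma^{-1/2}w)+q\,\gamma^{-1/2}w=\gamma^{1/2}\big((-\Delta)^s_A+q'\big)w ,$$ that is, $\langle \mathrm C^s_{\gamma,A}(\gamma^{-1/2}w)+q\gamma^{-1/2}w,\,v\rangle=\langle((-\Delta)^s_A+q')w,\,\gamma^{1/2}v\rangle$ for all $v\in H^s(\mathbb R^n)$. -/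

import Mathlib

open MeasureTheory Filter Topology
open scoped ENNReal SchwartzMap ContDiff

noncomputable section

namespace FMCE

/-! ### Sobolev spaces -/

section Sobolev

variable {X F : Type*} [NormedAddCommGroup X] [InnerProductSpace ℝ X] [FiniteDimensional ℝ X]
  [MeasurableSpace X] [BorelSpace X] [NormedAddCommGroup F] [NormedSpace ℂ F]

/-- The tempered distribution `T` is given by integration against the function `f`. -/
def Represents (T : 𝓢'(X, F)) (f : X → F) : Prop :=
  ∀ φ : 𝓢(X, ℂ), Integrable (fun x => φ x • f x) ∧ T φ = ∫ x, φ x • f x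

variable [CompleteSpace F]

/-- The function `f` belongs to the Bessel potential space `W^{r,p}` (for `r ≥ 0`):
`𝓕⁻¹ (⟨ξ⟩^r 𝓕 f) ∈ L^p`. -/
def MemSob (r : ℝ) (p : ℝ≥0∞) (f : X → F) : Prop :=
  ∃ (_ : Fact (1 ≤ p)) (T : 𝓢'(X, F)), Represents T f ∧ TemperedDistribution.MemSobolev r p T

/-- The norm `‖𝓕⁻¹ (⟨ξ⟩^r 𝓕 f)‖_{L²}` of `H^r`, with value `∞` when `f` is not in `H^r`.
(There is at most one pair `T`, `h` as below.) -/
def hNorm (r : ℝ) (f : X → F) : ℝ≥0∞ :=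
  ⨅ (h : Lp F 2 (volume : Measure X))
    (_ : ∃ T : 𝓢'(X, F), Represents T f ∧ TemperedDistribution.besselPotential X F r T = h), ‖h‖ₑ

end Sobolev

/-- Points of `ℝⁿ`. -/
abbrev Pt (n : ℕ) := EuclideanSpace ℝ (Fin n)

/-- Vectors of `ℂⁿ`. -/
abbrev Vec (n : ℕ) := EuclideanSpace ℂ (Fin n)

variable {n : ℕ}

/-- `u ∈ H^s(ℝⁿ)`. -/
def MemH (s : ℝ) (u : Pt n → ℂ) : Prop := MemSob s 2 u

/-- `g ∈ H^s(U)`: on `U`, the function `g` is the restriction of an element of `H^s(ℝⁿ)`. -/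
def MemHOn (s : ℝ) (U : Set (Pt n)) (g : Pt n → ℂ) : Prop :=
  ∃ G : Pt n → ℂ, MemH s G ∧ G =ᵐ[volume.restrict U] g

/-- `φ ∈ C_c^∞(U)`. -/
def IsTest (U : Set (Pt n)) (φ : Pt n → ℂ) : Prop :=
  ContDiff ℝ ∞ φ ∧ HasCompactSupport φ ∧ tsupport φ ⊆ U

/-- `u ∈ H̃^s(U)`: the closure of `C_c^∞(U)` in `H^s(ℝⁿ)`. -/
def MemHTilde (s : ℝ) (U : Set (Pt n)) (u : Pt n → ℂ) : Prop :=
  MemH s u ∧ ∃ φ : ℕ → Pt n → ℂ, (∀ k, IsTest U (φ k)) ∧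
    Tendsto (fun k => hNorm s (fun x => u x - φ k x)) atTop (𝓝 0)

/-- The exterior domain. -/
def ext (Ω : Set (Pt n)) : Set (Pt n) := (closure Ω)ᶜ

/-! ### Bivariate vector functions -/

/-- The bilinear product `a · b = ∑ aᵢ bᵢ` on `ℂⁿ` (no conjugation). -/
def dot (a b : Vec n) : ℂ := ∑ i, a i * b i

/-- A real vector, seen in `ℂⁿ`. -/
def toVec (z : Pt n) : Vec n := WithLp.toLp 2 fun i => (z i : ℂ)

def symPart (A : Pt n → Pt n → Vec n) (x y : Pt n) : Vec n := (2 : ℂ)⁻¹ • (A x y + A y x)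

def antiPart (A : Pt n → Pt n → Vec n) (x y : Pt n) : Vec n := A x y - symPart A x y

open Classical in
def parPart (A : Pt n → Pt n → Vec n) (x y : Pt n) : Vec n :=
  if x = y then A x y
  else (dot (A x y) (toVec (x - y)) / ((‖x - y‖ ^ 2 : ℝ) : ℂ)) • toVec (x - y)

/-- The `L²` norm with respect to the first variable. -/
def J₁ (A : Pt n → Pt n → Vec n) (x : Pt n) : ℝ := Real.sqrt (∫ y, ‖A y x‖ ^ 2)

/-- The `L²` norm with respect to the second variable. -/
def J₂ (A : Pt n → Pt n → Vec n) (x : Pt n) : ℝ := Real.sqrt (∫ y, ‖A x y‖ ^ 2)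

/-- The exponent `p = max {2, n / 2s}`. -/
def expP (n : ℕ) (s : ℝ) : ℝ := max 2 (n / (2 * s))

/-- The class `𝒫` of pairs of potentials. -/
structure MemP (s : ℝ) (Ω : Set (Pt n)) (A : Pt n → Pt n → Vec n) (q : Pt n → ℝ) : Prop where
  p1_fst : MemLp (J₁ A) (ENNReal.ofReal (2 * expP n s)) volume
  p1_snd : MemLp (J₂ A) (ENNReal.ofReal (2 * expP n s)) volume
  p2 : MemSob (s * expP n s - s) 2
    (fun z : WithLp 2 (Pt n × Pt n) => parPart (symPart A) z.fst z.snd)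
  p3 : ∀ᵐ z : Pt n × Pt n,
    0 ≤ (dot (parPart (antiPart A) z.1 z.2) (toVec (z.2 - z.1))).re ∧
      (dot (parPart (antiPart A) z.1 z.2) (toVec (z.2 - z.1))).im = 0
  p4 : MemLp q (ENNReal.ofReal (expP n s)) (volume.restrict Ω)
  p5_memLp : MemLp (fun z : Pt n × Pt n => A z.1 z.2) 2 volume
  /-- The (essential) support of `A` is contained in `Ω × Ω`. -/
  p5_supp : ∀ z : Pt n × Pt n, z ∉ Ω ×ˢ Ω →
    ∃ U ∈ 𝓝 z, ∀ᵐ z' : Pt n × Pt n, z' ∈ U → A z'.1 z'.2 = 0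

/-- `γ` is a conductivity: it is bounded above and below by positive constants, and
`γ^{1/2} - 1` belongs to `W_c^{2s, n/2s}(Ω)`. -/
structure IsConductivity (s : ℝ) (Ω : Set (Pt n)) (γ : Pt n → ℝ) : Prop where
  aemeasurable : AEMeasurable γ volume
  bounds : ∃ a b : ℝ, 0 < a ∧ ∀ᵐ x, a ≤ γ x ∧ γ x ≤ b
  sobolev : MemSob (2 * s) (ENNReal.ofReal (n / (2 * s)))
    (fun x => ((Real.sqrt (γ x) - 1 : ℝ) : ℂ))
  support : ∃ K : Set (Pt n), IsCompact K ∧ K ⊆ Ω ∧ ∀ᵐ x, x ∉ K → Real.sqrt (γ x) - 1 = 0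

/-! ### Nonlocal operators

An element `T` of `H^{-s}` (more generally a distribution) is given by its action `v ↦ ⟨T, v⟩`
on functions; all duality products are bilinear. -/

/-- The constant `𝒞_{n,s}` for which the fractional Laplacian has the symbol `|ξ|^{2s}`. -/
def fracConst (n : ℕ) (s : ℝ) : ℝ :=
  4 ^ s * Real.Gamma (n / 2 + s) / (Real.pi ^ ((n : ℝ) / 2) * |Real.Gamma (-s)|)

def alpha (s : ℝ) (x y : Pt n) : Vec n :=
  ((Real.sqrt (fracConst n s) / Real.sqrt 2 / ‖y - x‖ ^ ((n : ℝ) / 2 + s + 1) : ℝ) : ℂ) •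
    toVec (y - x)

/-- The fractional gradient `∇^s u`. -/
def fracGrad (s : ℝ) (u : Pt n → ℂ) (x y : Pt n) : Vec n := (u x - u y) • alpha s x y

/-- The bilinear product `⟨V, W⟩ = ∫∫ V · W` of `L²(ℝ²ⁿ)`. -/
def pair (V W : Pt n → Pt n → Vec n) : ℂ := ∫ z : Pt n × Pt n, dot (V z.1 z.2) (W z.1 z.2)

/-- The integral defining `⟨V, W⟩` converges absolutely. -/
def PairConv (V W : Pt n → Pt n → Vec n) : Prop :=
  Integrable (fun z : Pt n × Pt n => dot (V z.1 z.2) (W z.1 z.2)) volume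

/-- The fractional divergence: `⟨(∇·)^s V, φ⟩ = ⟨V, ∇^s φ⟩`. -/
def fracDiv (s : ℝ) (V : Pt n → Pt n → Vec n) (φ : Pt n → ℂ) : ℂ := pair V (fracGrad s φ)

/-- The fractional Laplacian `(-Δ)^s u = (∇·)^s (∇^s u)`, in the weak sense. -/
def fracLap (s : ℝ) (u φ : Pt n → ℂ) : ℂ := fracDiv s (fracGrad s u) φ

/-- The magnetic fractional gradient `∇^s_A u = ∇^s u + A(x,y) u(x)`. -/
def magGrad (s : ℝ) (A : Pt n → Pt n → Vec n) (u : Pt n → ℂ) (x y : Pt n) : Vec n :=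
  fracGrad s u x y + u x • A x y

/-- The magnetic fractional divergence: `⟨(∇·)^s_A V, v⟩ = ⟨V, ∇^s_A v⟩`. -/
def magDiv (s : ℝ) (A V : Pt n → Pt n → Vec n) (v : Pt n → ℂ) : ℂ := pair V (magGrad s A v)

/-- The magnetic fractional Laplacian: `⟨(-Δ)^s_A u, v⟩ = ⟨(∇·)^s_A (∇^s_A u), v⟩`. -/
def magLap (s : ℝ) (A : Pt n → Pt n → Vec n) (u v : Pt n → ℂ) : ℂ :=
  magDiv s A (magGrad s A u) v

/-- The square root of the conductivity, as a complex valued function. -/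
def sqrtC (γ : Pt n → ℝ) (x : Pt n) : ℂ := (Real.sqrt (γ x) : ℂ)

/-- The fractional magnetic conductivity operator:
`⟨C^s_{γ,A} u, v⟩ = ⟨(∇·)^s_A (Θ ∇^s_A u), v⟩` with `Θ(x,y) = (γ(x) γ(y))^{1/2} Id`. -/
def condOp (s : ℝ) (γ : Pt n → ℝ) (A : Pt n → Pt n → Vec n) (u v : Pt n → ℂ) : ℂ :=
  magDiv s A (fun x y => (Real.sqrt (γ x * γ y) : ℂ) • magGrad s A u x y) v

/-- A function `q` on `Ω` (extended by zero), as a distribution. -/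
def funPot (Ω : Set (Pt n)) (q : Pt n → ℝ) (φ : Pt n → ℂ) : ℂ := ∫ x in Ω, (q x : ℂ) * φ x

/-! ### The potential `q'` -/

/-- The integrand (in `y`) of the integral term of `q'`. -/
def qInner (s : ℝ) (γ : Pt n → ℝ) (A : Pt n → Pt n → Vec n) (x y : Pt n) : ℂ :=
  - (dot (fracGrad s (sqrtC γ) x y) (A x y) / sqrtC γ x)
    + dot (A x y) (A x y) * (sqrtC γ y / sqrtC γ x - 1)

/-- The potential
`q' = q/γ - (∇·)^s A_{s∥} + (∇·)^s(A γ^{1/2}(y)) / γ^{1/2}(x) - (-Δ)^s(γ^{1/2}) / γ^{1/2}(x)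
  + ∫ (- ∇^s(γ^{1/2})·A / γ^{1/2}(x) + A·A (γ^{1/2}(y)/γ^{1/2}(x) - 1)) dy`,
as a distribution `φ ↦ ⟨q', φ⟩`. -/
def qPrime (s : ℝ) (Ω : Set (Pt n)) (γ : Pt n → ℝ) (A : Pt n → Pt n → Vec n) (q : Pt n → ℝ)
    (φ : Pt n → ℂ) : ℂ :=
  funPot Ω (fun x => q x / γ x) φ
    - fracDiv s (parPart (symPart A)) φ
    + fracDiv s (fun x y => sqrtC γ y • A x y) (fun x => φ x / sqrtC γ x)
    - fracLap s (sqrtC γ) (fun x => φ x / sqrtC γ x)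
    + ∫ x, (∫ y, qInner s γ A x y) * φ x

/-- All integrals defining `⟨q', φ⟩` converge absolutely. -/
structure QPrimeConv (s : ℝ) (Ω : Set (Pt n)) (γ : Pt n → ℝ) (A : Pt n → Pt n → Vec n)
    (q : Pt n → ℝ) (φ : Pt n → ℂ) : Prop where
  pot : IntegrableOn (fun x => ((q x / γ x : ℝ) : ℂ) * φ x) Ω volume
  divA : PairConv (parPart (symPart A)) (fracGrad s φ)
  divAγ : PairConv (fun x y => sqrtC γ y • A x y) (fracGrad s (fun x => φ x / sqrtC γ x))
  lap : PairConv (fracGrad s (sqrtC γ)) (fracGrad s (fun x => φ x / sqrtC γ x))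
  inner : ∀ᵐ x, Integrable (fun y => qInner s γ A x y) volume
  outer : Integrable (fun x => (∫ y, qInner s γ A x y) * φ x) volume

/-! ### The two equations

A potential `Q` is a distribution; its product with `u` is `⟨Q u, v⟩ = ⟨Q, u v⟩`. `V` is the class
of test functions. -/

/-- `u` has the exterior value `g ∈ H^s(Ω_e)`: `u - G ∈ H̃^s(Ω)` for an extension `G` of `g`. -/
def HasExteriorValue (s : ℝ) (Ω : Set (Pt n)) (u g : Pt n → ℂ) : Prop :=
  ∃ G : Pt n → ℂ, MemH s G ∧ G =ᵐ[volume.restrict (ext Ω)] g ∧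
    MemHTilde s Ω (fun x => u x - G x)

/-- `u` solves FMSE with potentials `(A, Q)` and exterior value `f`. -/
def SolvesFMSE (s : ℝ) (Ω : Set (Pt n)) (V : Set (Pt n → ℂ)) (A : Pt n → Pt n → Vec n)
    (Q : (Pt n → ℂ) → ℂ) (f u : Pt n → ℂ) : Prop :=
  MemH s u ∧ HasExteriorValue s Ω u f ∧
    ∀ v ∈ V, magLap s A u v + Q (fun x => u x * v x) = 0

/-- `u` solves FMCE with potentials `(A, Q)`, conductivity `γ` and exterior value `f`. -/
def SolvesFMCE (s : ℝ) (Ω : Set (Pt n)) (V : Set (Pt n → ℂ)) (γ : Pt n → ℝ)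
    (A : Pt n → Pt n → Vec n) (Q : (Pt n → ℂ) → ℂ) (f u : Pt n → ℂ) : Prop :=
  MemH s u ∧ HasExteriorValue s Ω u f ∧
    ∀ v ∈ V, condOp s γ A u v + Q (fun x => u x * v x) = 0

end FMCE

end

open MeasureTheory Filter Topology
open scoped ENNReal SchwartzMap ContDiff

noncomputable section

namespace FMCE

/-! ### A positive kernel for the symbol `(1 + |ξ|²)^s - 1`. -/

section

/-! Write `g = γ^{1/2}`, `w = g u`, `φ = g v`. Expanding `Θ ∇^s_A u · ∇^s_A v` in terms of `w`, `φ`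
gives, at almost every `(x, y)`, `∇^s_A w · ∇^s_A φ - A · ∇^s(wφ) + g(y) A · ∇^s(wφ/g) - ∇^s g ·
∇^s(wφ/g)` plus the integrand of the last term of `q'` times `(wφ)(x)`. This is pure algebra
(`condOp_add_eq`). Once each term is integrable, the identity of the operators follows by
integration. The field `A` may be replaced by `A_{s∥}` in the second term because `∇^s(wφ)` is
symmetric in `(x, y)` and parallel to `x - y`. The equivalence of the two equations follows because
`v ↦ g v` is, up to null sets, a bijection of the test functions.

The analytic content is that `g` and `1/g` are multipliers of `H^s` and that `u(x) ∇^s g` is in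
`L²`. Both reduce to the bound `∫∫ |m(x) - m(y)|² |u(x)|² k(x - y) ≤ D ‖u‖²_{H^s}` for `m = g - 1`,
which is bounded, compactly supported and in `W^{2s, n/2s}` (`exists_crossEnergy_le`). It is a
Caccioppoli inequality: the Bessel operator `J^{2s}` applied to `m` is tested against `m |u|²`. The
left side controls the weighted energy up to `‖m‖_∞² ‖u‖²_{H^s}`. On the right, `J^{2s} m` is in
`L^{n/2s}`, while the Sobolev inequality puts `|u|²` in the dual space `L^{n/(n-2s)}`.

To make this exact, `(1 + |ξ|²)^s - 1` is written by subordination to Gaussians as `∫ (1 - cos 2π⟨z,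
ξ⟩) k(z) dz` up to a constant, with `k ≥ 0`. By Plancherel the Bessel norm of `H^s` is then, up to a
constant, an energy with kernel `k` plus an `L²` norm (`sobSq_lp`). Near `0` the kernel `k`
dominates a multiple of `|z|^{-n-2s}`, and the rest of that kernel is integrable. The Sobolev
inequality is proved from ball averages, and smoothness is removed by mollification and Fatou.

The terms containing `A` are handled by Hölder: the marginals `J₁ A`, `J₂ A` are in `L^{2p}` and
`H^s` embeds in `L^{2p'}`, exactly because `p ≥ n/2s`. For `H̃^s(Ω)`, a multiplier preserves the
compact support of a test function, and mollification restores its smoothness. -/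

open Set Real in
theorem lintegral_rpow_mul_exp_neg {a r : ℝ} (ha : 0 < a) (hr : 0 < r) :
    ∫⁻ t in Ioi (0 : ℝ), ENNReal.ofReal (t ^ (a - 1) * exp (-(r * t)))
      = ENNReal.ofReal ((1 / r) ^ a * Gamma a) := by
  rw [← Real.integral_rpow_mul_exp_neg_mul_Ioi ha hr, ofReal_integral_eq_lintegral_ofReal]
  -- Integrability is free: otherwise the Bochner integral would be `0`, whereas the Gamma value is
  -- positive.
  · by_contra h
    have h1 := Real.integral_rpow_mul_exp_neg_mul_Ioi ha hr
    rw [integral_undef h] at h1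
    have := Gamma_pos_of_pos ha
    have : 0 < (1 / r) ^ a * Gamma a := by positivity
    linarith
  · filter_upwards [ae_restrict_mem measurableSet_Ioi] with t ht
    have : (0 : ℝ) < t := ht
    positivity

open Set Real in
theorem lintegral_Ioi_inv (F : ℝ → ℝ≥0∞) :
    ∫⁻ t in Ioi (0 : ℝ), F t = ∫⁻ t in Ioi (0 : ℝ), ENNReal.ofReal ((t ^ 2)⁻¹) * F t⁻¹ := by
  have him : (fun t : ℝ => t⁻¹) '' Ioi 0 = Ioi 0 := by
    ext x
    constructor
    · rintro ⟨y, hy, rfl⟩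
      exact inv_pos.2 (show (0 : ℝ) < y from hy)
    · intro hx
      exact ⟨x⁻¹, inv_pos.2 (show (0 : ℝ) < x from hx), inv_inv x⟩
  conv_lhs => rw [← him]
  rw [lintegral_image_eq_lintegral_abs_deriv_mul measurableSet_Ioi
    (f := fun t : ℝ => t⁻¹) (f' := fun t => -(t ^ 2)⁻¹)
    (fun x hx => (hasDerivAt_inv (ne_of_gt hx)).hasDerivWithinAt)
    (fun x _ y _ h => inv_injective h)]
  refine setLIntegral_congr_fun measurableSet_Ioi fun t ht => ?_
  have : (0 : ℝ) < t := ht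
  simp only [abs_neg]
  rw [abs_of_pos (by positivity)]

open Set Real in
/-- The subordination formula for `(1 + a)^s - 1`. -/
theorem lintegral_subordination {s a : ℝ} (hs0 : 0 < s) (hs1 : s < 1) (ha : 0 ≤ a) :
    ∫⁻ t in Ioi (0 : ℝ), ENNReal.ofReal (exp (-t⁻¹) * t ^ (s - 1) * (1 - exp (-(a / t))))
      = ENNReal.ofReal (Gamma (1 - s) / s * ((1 + a) ^ s - 1)) := by
  rw [lintegral_Ioi_inv]
  -- After `t ↦ 1/t` the integrand is `t^{-s-1} (e^{-t} - e^{-(1+a)t})`, and the difference of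
  -- exponentials is `t ∫_1^{1+a} e^{-bt} db`. By Tonelli, the integral in `t` is then a Gamma
  -- integral.
  have h1 : ∀ t ∈ Ioi (0 : ℝ), ENNReal.ofReal ((t ^ 2)⁻¹) *
      ENNReal.ofReal (exp (-(t⁻¹)⁻¹) * t⁻¹ ^ (s - 1) * (1 - exp (-(a / t⁻¹))))
      = ∫⁻ b in Ioc 1 (1 + a), ENNReal.ofReal (t ^ ((1 - s) - 1) * exp (-(b * t))) := by
    intro t ht
    have ht : (0 : ℝ) < t := ht
    have hd : ∀ b ∈ Set.uIcc 1 (1 + a),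
        HasDerivAt (fun b : ℝ => -(t ^ ((1 - s) - 1) * t⁻¹ * exp (-(b * t))))
          (t ^ ((1 - s) - 1) * exp (-(b * t))) b := by
      intro b _
      have h0 : HasDerivAt (fun b : ℝ => -(b * t)) (-t) b := by
        exact (hasDerivAt_mul_const t).fun_neg
      convert! (h0.exp.const_mul (t ^ ((1 - s) - 1) * t⁻¹)).neg using 1
      field_simp
    have hint := intervalIntegral.integral_eq_sub_of_hasDerivAt hd
      (Continuous.intervalIntegrable (by fun_prop) _ _)
    rw [intervalIntegral.integral_of_le (by linarith)] at hint
    rw [← ofReal_integral_eq_lintegral_ofReal, hint, ← ENNReal.ofReal_mul (by positivity)]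
    · congr 1
      have e1 : t⁻¹ ^ (s - 1) = t ^ (1 - s - 1) * t := by
        rw [inv_rpow ht.le, ← rpow_neg ht.le]
        nth_rewrite 3 [← rpow_one t]
        rw [← rpow_add ht]; congr 1; ring
      have e2 : exp (-((1 + a) * t)) = exp (-t) * exp (-(a * t)) := by
        rw [← exp_add]; congr 1; ring
      rw [e1, e2, inv_inv, div_inv_eq_mul, one_mul]
      field_simp
      ring
    · exact (Continuous.integrableOn_Icc (by fun_prop)).mono_set Ioc_subset_Icc_self
    · exact Eventually.of_forall fun b => by positivity
  rw [setLIntegral_congr_fun measurableSet_Ioi h1, lintegral_lintegral_swap (by fun_prop)]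
  have h2 : ∀ b ∈ Ioc (1 : ℝ) (1 + a),
      ∫⁻ t in Ioi (0 : ℝ), ENNReal.ofReal (t ^ ((1 - s) - 1) * exp (-(b * t)))
      = ENNReal.ofReal (b ^ (s - 1) * Gamma (1 - s)) := by
    intro b hb
    have hb0 : (0 : ℝ) < b := lt_trans one_pos hb.1
    rw [lintegral_rpow_mul_exp_neg (by linarith) hb0, one_div, inv_rpow hb0.le, ← rpow_neg hb0.le,
      neg_sub]
  have hG := Gamma_pos_of_pos (show 0 < 1 - s by linarith)
  rw [setLIntegral_congr_fun measurableSet_Ioc h2, ← ofReal_integral_eq_lintegral_ofReal]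
  · congr 1
    rw [← intervalIntegral.integral_of_le (by linarith), intervalIntegral.integral_mul_const,
      integral_rpow (Or.inl (by linarith))]
    simp
    ring
  · refine IntegrableOn.mono_set (t := Icc 1 (1 + a)) ?_ Ioc_subset_Icc_self
    refine ContinuousOn.integrableOn_Icc fun x hx => ?_
    exact ((continuousAt_rpow_const x _ (Or.inl (by linarith [hx.1]))).mul
      continuousAt_const).continuousWithinAt
  · filter_upwards [ae_restrict_mem measurableSet_Ioc] with b hb
    have : (0 : ℝ) < b := lt_trans one_pos hb.1
    positivity

open Real in
/-- The integral of `(1 - cos 2π⟨z, ξ⟩)` against a Gaussian. -/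
theorem lintegral_one_sub_cos_mul_gaussian {n : ℕ} {t : ℝ} (ht : 0 < t) (ξ : Pt n) :
    ∫⁻ z : Pt n, ENNReal.ofReal ((1 - cos (2 * π * inner ℝ z ξ)) * exp (-(π ^ 2 * t) * ‖z‖ ^ 2))
      = ENNReal.ofReal ((π * t) ^ (-((n : ℝ) / 2)) * (1 - exp (-(‖ξ‖ ^ 2 / t)))) := by
  have hb : 0 < π ^ 2 * t := by positivity
  have hbc : 0 < (((π ^ 2 * t : ℝ)) : ℂ).re := by
    rw [Complex.ofReal_re]; exact hb
  have hi := GaussianFourier.integrable_cexp_neg_mul_sq_norm_add hbc (2 * π * Complex.I) ξ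
  have h := GaussianFourier.integral_cexp_neg_mul_sq_norm_add hbc (2 * π * Complex.I) ξ
  have hi0 := GaussianFourier.integrable_cexp_neg_mul_sq_norm_add hbc 0 (0 : Pt n)
  -- The cosine integral is the real part of the Fourier transform of the Gaussian.
  have hpt : ∀ z : Pt n, Complex.exp (-((π ^ 2 * t : ℝ) : ℂ) * ‖z‖ ^ 2
      + 2 * π * Complex.I * (inner ℝ ξ z : ℝ))
      = (exp (-(π ^ 2 * t) * ‖z‖ ^ 2) : ℝ) * Complex.exp ((2 * π * inner ℝ z ξ : ℝ) * Complex.I) := by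
    intro z
    rw [Complex.exp_add, real_inner_comm]
    congr 1
    · push_cast; rfl
    · congr 1; push_cast; ring
  have hre : ∀ z : Pt n, (Complex.exp (-((π ^ 2 * t : ℝ) : ℂ) * ‖z‖ ^ 2
      + 2 * π * Complex.I * (inner ℝ ξ z : ℝ))).re
      = cos (2 * π * inner ℝ z ξ) * exp (-(π ^ 2 * t) * ‖z‖ ^ 2) := by
    intro z
    rw [hpt, Complex.re_ofReal_mul, Complex.exp_ofReal_mul_I_re, mul_comm]
  have hi0' : Integrable (fun z : Pt n => exp (-(π ^ 2 * t) * ‖z‖ ^ 2)) := by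
    refine (hi0.re).congr (Eventually.of_forall fun z => ?_)
    simp only [zero_mul, add_zero]
    have : Complex.exp (-((π ^ 2 * t : ℝ) : ℂ) * ‖z‖ ^ 2)
      = ((exp (-(π ^ 2 * t) * ‖z‖ ^ 2) : ℝ) : ℂ) := by push_cast; rfl
    rw [this]; exact Complex.ofReal_re _
  have hir : Integrable (fun z : Pt n => cos (2 * π * inner ℝ z ξ) * exp (-(π ^ 2 * t) * ‖z‖ ^ 2)) :=
    (hi.re).congr (Eventually.of_forall hre)
  have hval : ∫ z : Pt n, cos (2 * π * inner ℝ z ξ) * exp (-(π ^ 2 * t) * ‖z‖ ^ 2)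
      = (π / (π ^ 2 * t)) ^ ((n : ℝ) / 2) * exp (-(‖ξ‖ ^ 2 / t)) := by
    rw [← integral_congr_ae (Eventually.of_forall hre)]
    have h' := integral_re hi
    change ∫ z : Pt n, Complex.re _ = Complex.re _ at h'
    rw [h', h]
    have e1 : ((π : ℂ) / ((π ^ 2 * t : ℝ) : ℂ)) ^ ((Module.finrank ℝ (Pt n) : ℂ) / 2)
        = (((π / (π ^ 2 * t)) ^ ((n : ℝ) / 2) : ℝ) : ℂ) := by
      rw [Complex.ofReal_cpow (by positivity)]
      simp
    have e2 : Complex.exp ((2 * π * Complex.I) ^ 2 * ‖ξ‖ ^ 2 / (4 * ((π ^ 2 * t : ℝ) : ℂ)))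
        = ((exp (-(‖ξ‖ ^ 2 / t)) : ℝ) : ℂ) := by
      rw [Complex.ofReal_exp]
      congr 1
      push_cast
      have : (π : ℂ) ≠ 0 := by exact_mod_cast pi_ne_zero
      have : (t : ℂ) ≠ 0 := by exact_mod_cast ht.ne'
      rw [mul_pow, mul_pow, Complex.I_sq]
      field_simp
      ring
    rw [e1, e2, ← Complex.ofReal_mul]
    exact Complex.ofReal_re _
  rw [← ofReal_integral_eq_lintegral_ofReal]
  · congr 1
    have : ∀ z : Pt n, (1 - cos (2 * π * inner ℝ z ξ)) * exp (-(π ^ 2 * t) * ‖z‖ ^ 2)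
      = exp (-(π ^ 2 * t) * ‖z‖ ^ 2) - cos (2 * π * inner ℝ z ξ) * exp (-(π ^ 2 * t) * ‖z‖ ^ 2) :=
      fun z => by ring
    simp_rw [this]
    rw [integral_sub hi0' hir, hval, GaussianFourier.integral_rexp_neg_mul_sq_norm hb]
    have e3 : π / (π ^ 2 * t) = (π * t)⁻¹ := by field_simp
    rw [e3, finrank_euclideanSpace, Fintype.card_fin, inv_rpow (by positivity),
      ← rpow_neg (by positivity)]
    ring
  · refine (hi0'.sub hir).congr (Eventually.of_forall fun z => ?_)
    simp only [Pi.sub_apply]; ring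
  · exact Eventually.of_forall fun z => mul_nonneg (by linarith [cos_le_one (2 * π * inner ℝ z ξ)])
      (exp_pos _).le

/-- A multiple of the Lévy kernel of the Bessel operator `(1 + |ξ|²)^s`. -/
def besselKernel (n : ℕ) (s : ℝ) (z : Pt n) : ℝ≥0∞ :=
  ∫⁻ t in Set.Ioi (0 : ℝ), ENNReal.ofReal (Real.exp (-t⁻¹) * t ^ (s + n / 2 - 1)) *
    ENNReal.ofReal (Real.exp (-(Real.pi ^ 2 * t) * ‖z‖ ^ 2))

/-- The normalizing constant of `besselKernel`. -/
def besselConst (n : ℕ) (s : ℝ) : ℝ :=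
  Real.pi ^ (-((n : ℝ) / 2)) * (Real.Gamma (1 - s) / s)

theorem besselConst_pos (n : ℕ) {s : ℝ} (hs0 : 0 < s) (hs1 : s < 1) : 0 < besselConst n s := by
  have hG := Real.Gamma_pos_of_pos (show 0 < 1 - s by linarith)
  have := Real.pi_pos
  unfold besselConst
  positivity

theorem measurable_besselKernel (n : ℕ) (s : ℝ) : Measurable (besselKernel n s) := by
  unfold besselKernel
  exact Measurable.lintegral_prod_right' (f := fun p : Pt n × ℝ =>
    ENNReal.ofReal (Real.exp (-p.2⁻¹) * p.2 ^ (s + n / 2 - 1)) *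
    ENNReal.ofReal (Real.exp (-(Real.pi ^ 2 * p.2) * ‖p.1‖ ^ 2))) (by fun_prop)

-- Tonelli: the Gaussian of parameter `π² t` contributes `(πt)^{-n/2} (1 - e^{-|ξ|²/t})`, the factor
-- `t^{n/2}` of the kernel cancels the power of `t`, and the subordination formula with `a = |ξ|²`
-- finishes.
open Set Real in
theorem lintegral_one_sub_cos_mul_besselKernel (n : ℕ) {s : ℝ} (hs0 : 0 < s) (hs1 : s < 1)
    (ξ : Pt n) :
    ∫⁻ z : Pt n, ENNReal.ofReal (1 - cos (2 * π * inner ℝ z ξ)) * besselKernel n s z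
      = ENNReal.ofReal (besselConst n s * ((1 + ‖ξ‖ ^ 2) ^ s - 1)) := by
  have hc : ∀ z : Pt n, 0 ≤ 1 - cos (2 * π * inner ℝ z ξ) := fun z => by
    linarith [cos_le_one (2 * π * inner ℝ z ξ)]
  have h1 : ∀ z : Pt n, ENNReal.ofReal (1 - cos (2 * π * inner ℝ z ξ)) * besselKernel n s z
      = ∫⁻ t in Ioi (0 : ℝ), ENNReal.ofReal (exp (-t⁻¹) * t ^ (s + n / 2 - 1)) *
        ENNReal.ofReal ((1 - cos (2 * π * inner ℝ z ξ)) * exp (-(π ^ 2 * t) * ‖z‖ ^ 2)) := by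
    intro z
    rw [besselKernel, ← lintegral_const_mul' _ _ ENNReal.ofReal_ne_top]
    refine lintegral_congr fun t => ?_
    rw [ENNReal.ofReal_mul (hc z)]
    ring
  simp_rw [h1]
  rw [lintegral_lintegral_swap (by fun_prop)]
  have h2 : ∀ t ∈ Ioi (0 : ℝ),
      ∫⁻ z : Pt n, ENNReal.ofReal (exp (-t⁻¹) * t ^ (s + n / 2 - 1)) *
        ENNReal.ofReal ((1 - cos (2 * π * inner ℝ z ξ)) * exp (-(π ^ 2 * t) * ‖z‖ ^ 2))
      = ENNReal.ofReal (π ^ (-((n : ℝ) / 2))) *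
        ENNReal.ofReal (exp (-t⁻¹) * t ^ (s - 1) * (1 - exp (-(‖ξ‖ ^ 2 / t)))) := by
    intro t ht
    have ht : (0 : ℝ) < t := ht
    rw [lintegral_const_mul' _ _ ENNReal.ofReal_ne_top, lintegral_one_sub_cos_mul_gaussian ht,
      ← ENNReal.ofReal_mul (by positivity), ← ENNReal.ofReal_mul (by positivity),
      mul_rpow pi_pos.le ht.le]
    congr 1
    have : t ^ (s - 1) = t ^ (s + n / 2 - 1) * t ^ (-((n : ℝ) / 2)) := by
      rw [← rpow_add ht]; congr 1; ring
    rw [this]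
    ring
  rw [setLIntegral_congr_fun measurableSet_Ioi h2, lintegral_const_mul' _ _ ENNReal.ofReal_ne_top,
    lintegral_subordination hs0 hs1 (by positivity), ← ENNReal.ofReal_mul (by positivity),
    besselConst, mul_assoc]

/-- The kernel of the fractional Laplacian, up to a constant. -/
def homKernel (n : ℕ) (s : ℝ) (z : Pt n) : ℝ≥0∞ := ENNReal.ofReal (‖z‖ ^ (-((n : ℝ) + 2 * s)))

theorem measurable_homKernel (n : ℕ) (s : ℝ) : Measurable (homKernel n s) := by
  unfold homKernel; fun_prop

-- It suffices to keep the scales `t ∈ [|z|^{-2}, 2|z|^{-2}]`, where `1/t ≤ 1` and `t|z|² ≤ 2`, so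
-- that both exponentials are bounded below. The power of `t` and the length of the interval produce
-- `|z|^{-n-2s}`.
open Set Real in
theorem homKernel_le (n : ℕ) {s : ℝ} (hs0 : 0 < s) {z : Pt n} (hz : z ≠ 0) (hz1 : ‖z‖ ≤ 1) :
    homKernel n s z ≤ ENNReal.ofReal (2 * exp (1 + 2 * π ^ 2)) * besselKernel n s z := by
  have hr : 0 < ‖z‖ := norm_pos_iff.2 hz
  set r := ‖z‖ with hrdef
  have ha : 0 < s + (n : ℝ) / 2 := by positivity
  set c : ℝ := r ^ (-((n : ℝ) + 2 * s)) * r ^ 2 * (2 * exp (1 + 2 * π ^ 2))⁻¹ with hc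
  have key : ENNReal.ofReal (c * (r ^ 2)⁻¹) ≤ besselKernel n s z := by
    calc ENNReal.ofReal (c * (r ^ 2)⁻¹)
        = ∫⁻ _ in Icc ((r ^ 2)⁻¹) (2 * (r ^ 2)⁻¹), ENNReal.ofReal c := by
          rw [setLIntegral_const, Real.volume_Icc, ← ENNReal.ofReal_mul (by positivity)]
          congr 2; ring
      _ ≤ ∫⁻ t in Icc ((r ^ 2)⁻¹) (2 * (r ^ 2)⁻¹),
            ENNReal.ofReal (exp (-t⁻¹) * t ^ (s + n / 2 - 1)) *
              ENNReal.ofReal (exp (-(π ^ 2 * t) * r ^ 2)) := by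
          refine setLIntegral_mono' measurableSet_Icc fun t ht => ?_
          have hr2 : 0 < (r ^ 2)⁻¹ := by positivity
          have ht0 : 0 < t := lt_of_lt_of_le hr2 ht.1
          rw [← ENNReal.ofReal_mul (by positivity)]
          refine ENNReal.ofReal_le_ofReal ?_
          have h1 : exp (-1) ≤ exp (-t⁻¹) := by
            apply exp_le_exp.2
            have : t⁻¹ ≤ r ^ 2 := by
              rw [inv_le_comm₀ ht0 (by positivity)]; exact ht.1
            have : r ^ 2 ≤ 1 := pow_le_one₀ hr.le hz1
            linarith
          have h2 : exp (-(2 * π ^ 2)) ≤ exp (-(π ^ 2 * t) * r ^ 2) := by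
            apply exp_le_exp.2
            have : t * r ^ 2 ≤ 2 := by
              have := mul_le_mul_of_nonneg_right ht.2 (by positivity : 0 ≤ r ^ 2)
              rwa [mul_assoc, inv_mul_cancel₀ (by positivity), mul_one] at this
            nlinarith [sq_nonneg π]
          have h3 : r ^ (-((n : ℝ) + 2 * s)) * r ^ 2 / 2 ≤ t ^ (s + (n : ℝ) / 2 - 1) := by
            rw [rpow_sub ht0, rpow_one, le_div_iff₀ ht0]
            have e : ((r ^ 2)⁻¹) ^ (s + (n : ℝ) / 2) = r ^ (-((n : ℝ) + 2 * s)) := by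
              rw [inv_rpow (by positivity), ← rpow_natCast, ← rpow_mul (by positivity),
                rpow_neg (by positivity)]
              congr 2
              push_cast
              ring
            have h4 : r ^ (-((n : ℝ) + 2 * s)) ≤ t ^ (s + (n : ℝ) / 2) := by
              rw [← e]; exact rpow_le_rpow (by positivity) ht.1 ha.le
            refine le_trans ?_ h4
            have : t * r ^ 2 ≤ 2 := by
              have := mul_le_mul_of_nonneg_right ht.2 (by positivity : 0 ≤ r ^ 2)
              rwa [mul_assoc, inv_mul_cancel₀ (by positivity), mul_one] at this
            have hp : 0 ≤ r ^ (-((n : ℝ) + 2 * s)) := by positivity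
            nlinarith
          calc c = exp (-1) * (r ^ (-((n : ℝ) + 2 * s)) * r ^ 2 / 2) * exp (-(2 * π ^ 2)) := by
                rw [hc, mul_inv, ← exp_neg, show -(1 + 2 * π ^ 2) = -1 + -(2 * π ^ 2) by ring, exp_add]; ring
            _ ≤ _ := by gcongr
      _ ≤ _ := by
          refine lintegral_mono_set fun t ht => ?_
          exact lt_of_lt_of_le (by positivity) ht.1
  calc homKernel n s z
      = ENNReal.ofReal (2 * exp (1 + 2 * π ^ 2)) * ENNReal.ofReal (c * (r ^ 2)⁻¹) := by
        rw [← ENNReal.ofReal_mul (by positivity), homKernel]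
        congr 1
        rw [hc, ← hrdef]
        field_simp
    _ ≤ _ := by gcongr

end

/-! ### Energies, translations and Plancherel. -/

section

variable {n : ℕ}

theorem lintegral_enorm_sq_eq {α E : Type*} [MeasurableSpace α] {μ : Measure α}
    [NormedAddCommGroup E] (f : α → E) : ∫⁻ x, ‖f x‖ₑ ^ 2 ∂μ = eLpNorm f 2 μ ^ 2 := by
  have h := eLpNorm_nnreal_pow_eq_lintegral (f := f) (μ := μ) (p := 2) two_ne_zero
  simp only [NNReal.coe_ofNat, ENNReal.rpow_ofNat] at h
  exact h.symm

theorem memLp_two_iff {α E : Type*} [MeasurableSpace α] {μ : Measure α} [NormedAddCommGroup E]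
    {f : α → E} : MemLp f 2 μ ↔ AEStronglyMeasurable f μ ∧ ∫⁻ x, ‖f x‖ₑ ^ 2 ∂μ < ⊤ := by
  rw [lintegral_enorm_sq_eq, MemLp, ENNReal.pow_lt_top_iff]
  simp

/-! ### Quadratic forms of Gagliardo type -/

/-- The quadratic form `∫∫ |u(x) - u(y)|² k(x - y) dx dy`. -/
def energy (k : Pt n → ℝ≥0∞) (u : Pt n → ℂ) : ℝ≥0∞ :=
  ∫⁻ x, ∫⁻ y, ‖u x - u y‖ₑ ^ 2 * k (x - y)

theorem aestronglyMeasurable_comp_sub {E : Type*} [TopologicalSpace E] {u : Pt n → E}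
    (hu : AEStronglyMeasurable u) :
    AEStronglyMeasurable (fun p : Pt n × Pt n => u (p.1 - p.2)) (volume.prod volume) :=
  hu.comp_quasiMeasurePreserving (quasiMeasurePreserving_sub_of_right_invariant volume volume)

theorem aestronglyMeasurable_comp_add {E : Type*} [TopologicalSpace E] {u : Pt n → E}
    (hu : AEStronglyMeasurable u) :
    AEStronglyMeasurable (fun p : Pt n × Pt n => u (p.1 + p.2)) (volume.prod volume) :=
  hu.comp_quasiMeasurePreserving (quasiMeasurePreserving_add volume volume)

theorem aestronglyMeasurable_shift {E : Type*} [TopologicalSpace E] {u : Pt n → E}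
    (hu : AEStronglyMeasurable u) (z : Pt n) : AEStronglyMeasurable (fun x => u (x + z)) :=
  hu.comp_measurePreserving (measurePreserving_add_right volume z)

theorem lintegral_sub_change (F : Pt n → Pt n → ℝ≥0∞)
    (hF : AEMeasurable (fun p : Pt n × Pt n => F p.1 p.2) (volume.prod volume)) :
    ∫⁻ x, ∫⁻ y, F x y = ∫⁻ z, ∫⁻ x, F (x + z) x := by
  have hq : MeasurePreserving (fun p : Pt n × Pt n => (p.1 + p.2, p.1))
      (volume.prod volume) (volume.prod volume) :=
    Measure.measurePreserving_swap.comp (measurePreserving_prod_add volume volume)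
  rw [lintegral_lintegral_swap hF]
  have h1 : ∀ y, ∫⁻ x, F x y = ∫⁻ z, F (y + z) y := fun y =>
    (lintegral_add_left_eq_self (fun x => F x y) y).symm
  simp_rw [h1]
  exact lintegral_lintegral_swap (hF.comp_quasiMeasurePreserving hq.quasiMeasurePreserving)

/-- In this form the kernel is only a weight in `z`, so Plancherel and mollification can be applied
to `u(· + z) - u` for each fixed `z`. -/
theorem energy_eq_lintegral_shift {k : Pt n → ℝ≥0∞} (hk : Measurable k) {u : Pt n → ℂ}
    (hu : AEStronglyMeasurable u) :
    energy k u = ∫⁻ z, (∫⁻ x, ‖u (x + z) - u x‖ₑ ^ 2) * k z := by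
  unfold energy
  rw [lintegral_sub_change]
  · refine lintegral_congr fun z => ?_
    simp only [add_sub_cancel_left]
    rw [lintegral_mul_const'']
    exact ((aestronglyMeasurable_shift hu z).sub hu).enorm.pow_const 2
  · exact ((hu.comp_fst.sub hu.comp_snd).enorm.pow_const 2).mul
      (hk.comp (measurable_fst.sub measurable_snd)).aemeasurable

/-! ### Fourier transform and translations -/

open FourierTransform

/-- Translation of Schwartz functions, `x ↦ f (x + z)`. -/
def schwartzShift (z : Pt n) (f : 𝓢(Pt n, ℂ)) : 𝓢(Pt n, ℂ) :=
  SchwartzMap.compSubConstCLM ℂ (-z) f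

@[simp]
theorem schwartzShift_apply (z : Pt n) (f : 𝓢(Pt n, ℂ)) (x : Pt n) :
    schwartzShift z f x = f (x + z) := by
  simp [schwartzShift]

/-- The character `ξ ↦ exp (2πi ⟨z, ξ⟩)`. -/
def character (z ξ : Pt n) : ℂ := Complex.exp ((2 * Real.pi * inner ℝ z ξ : ℝ) * Complex.I)

theorem continuous_character : Continuous fun p : Pt n × Pt n => character p.1 p.2 := by
  unfold character; fun_prop

theorem norm_character (z ξ : Pt n) : ‖character z ξ‖ = 1 := Complex.norm_exp_ofReal_mul_I _

theorem character_neg (z ξ : Pt n) : character (-z) ξ * character z ξ = 1 := by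
  rw [character, character, ← Complex.exp_add, inner_neg_left]
  simp

theorem character_sub_one_mul (z ξ : Pt n) :
    (character z ξ - 1) * (character (-z) ξ - 1)
      = ((2 * (1 - Real.cos (2 * Real.pi * inner ℝ z ξ)) : ℝ) : ℂ) := by
  have h := character_neg z ξ
  have h2 : character z ξ + character (-z) ξ = 2 * Complex.cos (2 * Real.pi * inner ℝ z ξ : ℝ) := by
    rw [character, character, Complex.two_cos, inner_neg_left]
    congr 2
    push_cast
    ring
  have : (character z ξ - 1) * (character (-z) ξ - 1)
      = character (-z) ξ * character z ξ - (character z ξ + character (-z) ξ) + 1 := by ring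
  rw [this, h, h2]
  push_cast
  ring

theorem enorm_character_sub_one_sq (z ξ : Pt n) :
    ‖character z ξ - 1‖ₑ ^ 2
      = ENNReal.ofReal (2 * (1 - Real.cos (2 * Real.pi * inner ℝ z ξ))) := by
  have hconj : (starRingEnd ℂ) (character z ξ - 1) = character (-z) ξ - 1 := by
    rw [map_sub, map_one, character, character, ← Complex.exp_conj, inner_neg_left]
    simp [Complex.conj_ofNat]
  have h := character_sub_one_mul z ξ
  rw [← hconj, Complex.mul_conj, Complex.normSq_eq_norm_sq] at h
  rw [← ofReal_norm, ← ENNReal.ofReal_pow (norm_nonneg _)]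
  congr 1
  exact_mod_cast h

theorem fourier_schwartzShift (z : Pt n) (f : 𝓢(Pt n, ℂ)) (ξ : Pt n) :
    𝓕 (schwartzShift z f) ξ = character z ξ * 𝓕 f ξ := by
  have h := congrFun (VectorFourier.fourierIntegral_comp_add_right Real.fourierChar
    (volume : Measure (Pt n)) (innerₗ (Pt n)) f z) ξ
  have h1 : ((f : Pt n → ℂ) ∘ fun v => v + z) = schwartzShift z f := by
    ext x; simp
  rw [h1] at h
  rw [SchwartzMap.fourier_coe, SchwartzMap.fourier_coe]
  simp only [innerₗ_apply_apply, Circle.smul_def, Real.fourierChar_apply, smul_eq_mul] at h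
  exact h

theorem fourierInv_schwartzShift (z : Pt n) (f : 𝓢(Pt n, ℂ)) (ξ : Pt n) :
    𝓕⁻ (schwartzShift z f) ξ = character (-z) ξ * 𝓕⁻ f ξ := by
  rw [SchwartzMap.fourierInv_apply_eq, SchwartzMap.fourierInv_apply_eq]
  simp only [SchwartzMap.compCLMOfContinuousLinearEquiv_apply, Function.comp_apply,
    LinearIsometryEquiv.coe_toContinuousLinearEquiv, LinearIsometryEquiv.coe_neg]
  rw [fourier_schwartzShift]
  simp [character]

/-- Translation of `L²` functions. -/
def lpShift (z : Pt n) : Lp ℂ 2 (volume : Measure (Pt n)) →ₗᵢ[ℂ] Lp ℂ 2 (volume : Measure (Pt n)) :=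
  Lp.compMeasurePreservingₗᵢ ℂ (fun x => x + z) (measurePreserving_add_right volume z)

theorem coeFn_lpShift (z : Pt n) (f : Lp ℂ 2 (volume : Measure (Pt n))) :
    lpShift z f =ᵐ[volume] fun x => f (x + z) :=
  Lp.coeFn_compMeasurePreserving f (measurePreserving_add_right volume z)

theorem memLp_character (z : Pt n) : MemLp (fun ξ : Pt n => character z ξ) ⊤ := by
  refine memLp_top_of_bound ?_ 1 (Eventually.of_forall fun ξ => (norm_character z ξ).le)
  exact (continuous_character.comp (Continuous.prodMk_right z)).aestronglyMeasurable

theorem fourier_lpShift (z : Pt n) (f : Lp ℂ 2 (volume : Measure (Pt n))) :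
    (𝓕 (lpShift z f) : Lp ℂ 2 (volume : Measure (Pt n)))
      =ᵐ[volume] fun ξ => character z ξ * 𝓕 f ξ := by
  -- Multiplication by the bounded character as a continuous operator on `L²`. Both sides are then
  -- continuous in `f`, and density of Schwartz functions applies.
  let L := ContinuousLinearMap.holderL (volume : Measure (Pt n)) ⊤ 2 2
    (ContinuousLinearMap.mul ℂ ℂ) (memLp_character z).toLp
  have hL : ∀ g, L g =ᵐ[volume] fun ξ => character z ξ * g ξ := by
    intro g
    filter_upwards [ContinuousLinearMap.coeFn_holder (r := 2) (ContinuousLinearMap.mul ℂ ℂ)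
      (memLp_character z).toLp g, (memLp_character z).coeFn_toLp] with ξ h1 h2
    rw [ContinuousLinearMap.holderL_apply_apply, h1, h2]
    rfl
  have key : 𝓕 (lpShift z f) = L (𝓕 f) := by
    refine DenseRange.induction_on (SchwartzMap.denseRange_toLpCLM (E := Pt n) (F := ℂ)
      (p := 2) (μ := volume) ENNReal.ofNat_ne_top) f (isClosed_eq ?_ ?_) fun φ => ?_
    · exact (FourierTransform.continuous_fourier).comp (lpShift z).continuous
    · exact L.continuous.comp FourierTransform.continuous_fourier
    · have h1 : lpShift z (SchwartzMap.toLpCLM ℝ ℂ 2 volume φ)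
          = (schwartzShift z φ).toLp 2 volume := by
        refine Lp.ext ?_
        rw [SchwartzMap.toLpCLM_apply]
        filter_upwards [coeFn_lpShift z (φ.toLp 2 volume), (schwartzShift z φ).coeFn_toLp 2 volume,
          (measurePreserving_add_right volume z).quasiMeasurePreserving.ae
            (φ.coeFn_toLp 2 volume)] with x h1 h2 h3
        rw [h1, h2, h3, schwartzShift_apply]
      rw [h1, SchwartzMap.toLp_fourier_eq, SchwartzMap.toLpCLM_apply, SchwartzMap.toLp_fourier_eq]
      refine Lp.ext ?_
      filter_upwards [hL ((𝓕 φ).toLp 2 volume), (𝓕 (schwartzShift z φ)).coeFn_toLp 2 volume,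
        (𝓕 φ).coeFn_toLp 2 volume] with ξ h1 h2 h3
      rw [h1, h2, h3, fourier_schwartzShift]
  rw [key]
  exact hL _

theorem lintegral_enorm_sq_fourier (f : Lp ℂ 2 (volume : Measure (Pt n))) :
    ∫⁻ ξ, ‖𝓕 f ξ‖ₑ ^ 2 = ∫⁻ x, ‖f x‖ₑ ^ 2 := by
  rw [lintegral_enorm_sq_eq, lintegral_enorm_sq_eq, ← Lp.enorm_def, ← Lp.enorm_def,
    ← ofReal_norm, ← ofReal_norm, Lp.norm_fourier_eq]

/-- Plancherel, together with `|e^{iθ} - 1|² = 2(1 - cos θ)`. -/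
theorem lintegral_shift_sub_eq_fourier (z : Pt n) (f : Lp ℂ 2 (volume : Measure (Pt n))) :
    ∫⁻ x, ‖f (x + z) - f x‖ₑ ^ 2
      = ∫⁻ ξ, ENNReal.ofReal (2 * (1 - Real.cos (2 * Real.pi * inner ℝ z ξ))) * ‖𝓕 f ξ‖ₑ ^ 2 := by
  have h1 : ∫⁻ x, ‖f (x + z) - f x‖ₑ ^ 2 = ∫⁻ x, ‖(lpShift z f - f) x‖ₑ ^ 2 := by
    refine lintegral_congr_ae ?_
    filter_upwards [coeFn_lpShift z f, Lp.coeFn_sub (lpShift z f) f] with x h1 h2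
    rw [h2, Pi.sub_apply, h1]
  rw [h1, ← lintegral_enorm_sq_fourier]
  refine lintegral_congr_ae ?_
  have h2 : 𝓕 (lpShift z f - f) = 𝓕 (lpShift z f) - 𝓕 f := map_sub (Lp.fourierTransformₗᵢ _ _) _ _
  filter_upwards [fourier_lpShift z f, Lp.coeFn_sub (𝓕 (lpShift z f)) (𝓕 f)] with ξ h3 h4
  rw [h2, h4, Pi.sub_apply, h3, ← enorm_character_sub_one_sq, ← mul_pow, ← enorm_mul]
  congr 2
  ring

end

/-! ### `H^s` described by difference quotients. -/

section

variable {n : ℕ}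

open FourierTransform

/-! ### Distributions represented by functions -/

theorem exists_schwartz {f : Pt n → ℂ} (hf : ContDiff ℝ ∞ f) (hc : HasCompactSupport f) :
    ∃ φ : 𝓢(Pt n, ℂ), ∀ x, φ x = f x := ⟨hc.toSchwartzMap hf, fun _ => rfl⟩

theorem Represents.locallyIntegrable {T : 𝓢'(Pt n, ℂ)} {f : Pt n → ℂ} (h : Represents T f) :
    LocallyIntegrable f := by
  rw [locallyIntegrable_iff]
  intro K hK
  obtain ⟨R, hR⟩ := hK.isBounded.subset_closedBall (0 : Pt n)
  let b : ContDiffBump (0 : Pt n) := ⟨max R 1, max R 1 + 1, by positivity, by linarith⟩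
  have hc : HasCompactSupport (fun x => (b x : ℂ)) := b.hasCompactSupport.comp_left (g := fun x : ℝ => (x : ℂ)) Complex.ofReal_zero
  have hs : ContDiff ℝ ∞ (fun x => (b x : ℂ)) := Complex.ofRealCLM.contDiff.comp b.contDiff
  obtain ⟨φ, hφ⟩ := exists_schwartz hs hc
  have hi := (h φ).1
  refine (hi.integrableOn (s := K)).congr_fun (fun x hx => ?_) hK.measurableSet
  have : b x = 1 := b.one_of_mem_closedBall
    (Metric.closedBall_subset_closedBall (le_max_left R 1) (hR hx))
  simp [hφ, this]

theorem Represents.ae_eq {T : 𝓢'(Pt n, ℂ)} {f g : Pt n → ℂ} (hf : Represents T f)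
    (hg : Represents T g) : f =ᵐ[volume] g := by
  refine ae_eq_of_integral_contDiff_smul_eq hf.locallyIntegrable hg.locallyIntegrable
    fun φ hφ hφc => ?_
  have hc : HasCompactSupport (fun x => (φ x : ℂ)) := hφc.comp_left (g := fun x : ℝ => (x : ℂ)) Complex.ofReal_zero
  have hs : ContDiff ℝ ∞ (fun x => (φ x : ℂ)) := Complex.ofRealCLM.contDiff.comp hφ
  obtain ⟨ψ, hψ⟩ := exists_schwartz hs hc
  have h := (hf ψ).2.symm.trans (hg ψ).2
  simpa [hψ] using h

theorem Represents.congr {T : 𝓢'(Pt n, ℂ)} {f g : Pt n → ℂ} (hf : Represents T f)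
    (hfg : f =ᵐ[volume] g) : Represents T g := fun φ => by
  have : (fun x => φ x • f x) =ᵐ[volume] fun x => φ x • g x := by
    filter_upwards [hfg] with x hx
    rw [hx]
  exact ⟨(hf φ).1.congr this, by rw [(hf φ).2, integral_congr_ae this]⟩

theorem Represents.unique {T S : 𝓢'(Pt n, ℂ)} {f : Pt n → ℂ} (hT : Represents T f)
    (hS : Represents S f) : T = S := by
  ext φ
  rw [(hT φ).2, (hS φ).2]

theorem represents_lp {p : ℝ≥0∞} [hp : Fact (1 ≤ p)] (f : Lp ℂ p (volume : Measure (Pt n))) :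
    Represents (f : 𝓢'(Pt n, ℂ)) f := fun φ => by
  refine ⟨?_, Lp.toTemperedDistribution_apply f φ⟩
  have := ENNReal.HolderConjugate.conjExponent hp.out
  have : p.conjExponent.HolderTriple p 1 := ENNReal.HolderTriple.symm
  exact memLp_one_iff_integrable.1 ((Lp.memLp f).smul (φ.memLp p.conjExponent))

/-! ### The Bessel potential of an `L²` function -/

/-- The symbol `⟨ξ⟩^r`. -/
def bracket (r : ℝ) (ξ : Pt n) : ℂ := ((1 + ‖ξ‖ ^ 2) ^ (r / 2) : ℝ)

theorem hasTemperateGrowth_bracket (r : ℝ) : (bracket r : Pt n → ℂ).HasTemperateGrowth := by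
  unfold bracket
  fun_prop

theorem represents_smulLeft {g : Pt n → ℂ} (hg : g.HasTemperateGrowth) {T : 𝓢'(Pt n, ℂ)}
    {f : Pt n → ℂ} (h : Represents T f) :
    Represents (TemperedDistribution.smulLeftCLM ℂ g T) (fun x => g x * f x) := fun φ => by
  have := h (SchwartzMap.smulLeftCLM ℂ g φ)
  simp only [SchwartzMap.smulLeftCLM_apply_apply hg, smul_eq_mul] at this
  have e : ∀ x, g x * φ x * f x = φ x * (g x * f x) := fun x => by ring
  simp only [e] at this
  simpa only [TemperedDistribution.smulLeftCLM_apply_apply, smul_eq_mul] using this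

/-- Both distributions have Fourier transforms represented by functions, and a tempered distribution
determines its representing function almost everywhere. This turns membership in `H^s` into a
weighted `L²` condition. -/
theorem besselPotential_lp_eq_iff (r : ℝ) (f h : Lp ℂ 2 (volume : Measure (Pt n))) :
    TemperedDistribution.besselPotential (Pt n) ℂ r f = (h : 𝓢'(Pt n, ℂ)) ↔
      (fun ξ => bracket r ξ * 𝓕 f ξ) =ᵐ[volume] (𝓕 h : Lp ℂ 2 (volume : Measure (Pt n))) := by
  have h1 : 𝓕 (TemperedDistribution.besselPotential (Pt n) ℂ r f)
      = TemperedDistribution.smulLeftCLM ℂ (bracket r) ((𝓕 f : Lp ℂ 2 _) : 𝓢'(Pt n, ℂ)) := by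
    rw [TemperedDistribution.fourier_besselPotential_eq_smulLeftCLM_fourier_apply,
      Lp.fourier_toTemperedDistribution_eq]
    rfl
  have h2 := represents_smulLeft (hasTemperateGrowth_bracket r) (represents_lp (𝓕 f))
  have h3 : 𝓕 (h : 𝓢'(Pt n, ℂ)) = ((𝓕 h : Lp ℂ 2 _) : 𝓢'(Pt n, ℂ)) :=
    Lp.fourier_toTemperedDistribution_eq h
  constructor
  · intro e
    rw [← h1, e, h3] at h2
    exact h2.ae_eq (represents_lp _)
  · intro e
    have h4 := h2.unique ((represents_lp (𝓕 h)).congr e.symm)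
    rw [← h1, ← h3] at h4
    have := congrArg 𝓕⁻ h4
    rwa [fourierInv_fourier_eq, fourierInv_fourier_eq] at this

theorem enorm_bracket_sq (s : ℝ) (ξ : Pt n) :
    ‖bracket s ξ‖ₑ ^ 2 = ENNReal.ofReal ((1 + ‖ξ‖ ^ 2) ^ s) := by
  rw [bracket, ← ofReal_norm, Complex.norm_real, Real.norm_of_nonneg (by positivity),
    ← ENNReal.ofReal_pow (by positivity), ← Real.rpow_natCast, ← Real.rpow_mul (by positivity)]
  congr 2
  push_cast
  ring

/-! ### The space `H^s` and the energy -/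

theorem energy_congr (k : Pt n → ℝ≥0∞) {u v : Pt n → ℂ} (h : u =ᵐ[volume] v) :
    energy k u = energy k v := by
  refine lintegral_congr_ae ?_
  filter_upwards [h] with x hx
  refine lintegral_congr_ae ?_
  filter_upwards [h] with y hy
  rw [hx, hy]

/-- The square of a norm of `H^s`, in terms of difference quotients. -/
def sobSq (s : ℝ) (u : Pt n → ℂ) : ℝ≥0∞ :=
  energy (besselKernel n s) u + ENNReal.ofReal (2 * besselConst n s) * ∫⁻ x, ‖u x‖ₑ ^ 2

theorem sobSq_congr (s : ℝ) {u v : Pt n → ℂ} (h : u =ᵐ[volume] v) : sobSq s u = sobSq s v := by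
  rw [sobSq, sobSq, energy_congr _ h]
  congr 2
  refine lintegral_congr_ae ?_
  filter_upwards [h] with x hx
  rw [hx]

variable {s : ℝ}

/-- The energy has symbol `2c((1 + |ξ|²)^s - 1)` and the `L²` term adds back `2c`, where `c` is
`besselConst`. Everything is nonnegative, so Tonelli applies without assuming `f ∈ H^s`, and the
identity also detects membership. -/
theorem sobSq_lp (hs0 : 0 < s) (hs1 : s < 1) (f : Lp ℂ 2 (volume : Measure (Pt n))) :
    sobSq s f = ENNReal.ofReal (2 * besselConst n s) * ∫⁻ ξ, ‖bracket s ξ * 𝓕 f ξ‖ₑ ^ 2 := by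
  have hc := besselConst_pos n hs0 hs1
  have hm : AEMeasurable (fun ξ => ‖𝓕 f ξ‖ₑ ^ 2) (volume : Measure (Pt n)) :=
    (Lp.aestronglyMeasurable _).enorm.pow_const 2
  have h1 : energy (besselKernel n s) f = ∫⁻ ξ,
      ENNReal.ofReal (2 * besselConst n s * ((1 + ‖ξ‖ ^ 2) ^ s - 1)) * ‖𝓕 f ξ‖ₑ ^ 2 := by
    rw [energy_eq_lintegral_shift (measurable_besselKernel n s) (Lp.aestronglyMeasurable f)]
    simp_rw [lintegral_shift_sub_eq_fourier]
    have h2 : ∀ z : Pt n, (∫⁻ ξ, ENNReal.ofReal (2 * (1 - Real.cos (2 * Real.pi * inner ℝ z ξ))) *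
        ‖𝓕 f ξ‖ₑ ^ 2) * besselKernel n s z
        = ∫⁻ ξ, 2 * (ENNReal.ofReal (1 - Real.cos (2 * Real.pi * inner ℝ z ξ)) *
            besselKernel n s z) * ‖𝓕 f ξ‖ₑ ^ 2 := by
      intro z
      have hm2 : AEMeasurable (fun ξ => ENNReal.ofReal
          (2 * (1 - Real.cos (2 * Real.pi * inner ℝ z ξ))) * ‖𝓕 f ξ‖ₑ ^ 2) volume :=
        (Measurable.aemeasurable (by fun_prop)).mul hm
      rw [← lintegral_mul_const'' _ hm2]
      refine lintegral_congr fun ξ => ?_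
      rw [ENNReal.ofReal_mul (by norm_num)]
      simp only [ENNReal.ofReal_ofNat]
      ring
    simp_rw [h2]
    rw [lintegral_lintegral_swap]
    · refine lintegral_congr fun ξ => ?_
      have hk := measurable_besselKernel n s
      rw [lintegral_mul_const _ (by fun_prop), lintegral_const_mul _ (by fun_prop),
        lintegral_one_sub_cos_mul_besselKernel n hs0 hs1, mul_assoc 2 (besselConst n s),
        ENNReal.ofReal_mul (by norm_num : (0 : ℝ) ≤ 2)]
      simp
    · have hk := measurable_besselKernel n s
      refine AEMeasurable.mul (Measurable.aemeasurable (by fun_prop)) ?_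
      exact (Lp.aestronglyMeasurable (𝓕 f)).comp_snd.enorm.pow_const 2
  rw [sobSq, h1, ← lintegral_enorm_sq_fourier, ← lintegral_const_mul'' _ hm, ← lintegral_add_right'
    _ (hm.const_mul _), ← lintegral_const_mul' _ _ ENNReal.ofReal_ne_top]
  refine lintegral_congr fun ξ => ?_
  rw [← add_mul, enorm_mul, mul_pow, enorm_bracket_sq, ← ENNReal.ofReal_add _ (by positivity),
    ← mul_assoc, ← ENNReal.ofReal_mul (by positivity)]
  · congr 2
    ring
  · have : 1 ≤ (1 + ‖ξ‖ ^ 2) ^ s := Real.one_le_rpow (by simp) hs0.le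
    have : 0 ≤ (1 + ‖ξ‖ ^ 2) ^ s - 1 := by linarith
    positivity

theorem MemH.exists_lp (hs0 : 0 < s) {u : Pt n → ℂ} {T : 𝓢'(Pt n, ℂ)} (hT : Represents T u)
    (h : TemperedDistribution.MemSobolev s 2 T) :
    ∃ f : Lp ℂ 2 (volume : Measure (Pt n)), T = f ∧ u =ᵐ[volume] f := by
  obtain ⟨f, hf⟩ := TemperedDistribution.memSobolev_zero_iff.1 (h.mono hs0.le)
  refine ⟨f, hf, ?_⟩
  rw [hf] at hT
  exact hT.ae_eq (represents_lp f)

theorem memH_iff (hs0 : 0 < s) (hs1 : s < 1) {u : Pt n → ℂ} :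
    MemH s u ↔ MemLp u 2 ∧ sobSq s u < ⊤ := by
  have hc := besselConst_pos n hs0 hs1
  constructor
  · rintro ⟨_, T, hT, hTs⟩
    obtain ⟨f, rfl, huf⟩ := MemH.exists_lp hs0 hT hTs
    obtain ⟨h, hh⟩ := hTs
    refine ⟨(Lp.memLp f).ae_eq huf.symm, ?_⟩
    rw [sobSq_congr s huf, sobSq_lp hs0 hs1]
    refine ENNReal.mul_lt_top ENNReal.ofReal_lt_top ?_
    have h1 := (besselPotential_lp_eq_iff s f h).1 hh
    rw [lintegral_congr_ae (h1.mono fun ξ hξ => congrArg (fun w => ‖w‖ₑ ^ 2) hξ)]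
    exact (memLp_two_iff.1 (Lp.memLp (𝓕 h))).2
  · rintro ⟨hu, hfin⟩
    refine ⟨⟨one_le_two⟩, hu.toLp, (represents_lp hu.toLp).congr hu.coeFn_toLp, ?_⟩
    rw [sobSq_congr s hu.coeFn_toLp.symm, sobSq_lp hs0 hs1] at hfin
    -- Finite energy puts `⟨ξ⟩^s 𝓕f` in `L²`; its inverse Fourier transform is the required Bessel
    -- potential.
    have hg : MemLp (fun ξ => bracket s ξ * 𝓕 hu.toLp ξ) 2 := by
      refine memLp_two_iff.2 ⟨?_, ?_⟩
      · exact (hasTemperateGrowth_bracket s).1.continuous.aestronglyMeasurable.mul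
          (Lp.aestronglyMeasurable _)
      · refine lt_of_not_ge fun h => hfin.ne ?_
        rw [top_le_iff.1 h, ENNReal.mul_top]
        simpa using hc
    refine ⟨𝓕⁻ hg.toLp, (besselPotential_lp_eq_iff s _ _).2 ?_⟩
    rw [fourier_fourierInv_eq]
    exact hg.coeFn_toLp.symm

theorem hNorm_sq (hs0 : 0 < s) (hs1 : s < 1) {u : Pt n → ℂ} (hu : MemH s u) :
    ENNReal.ofReal (2 * besselConst n s) * hNorm s u ^ 2 = sobSq s u := by
  obtain ⟨_, T, hT, hTs⟩ := hu
  obtain ⟨f, rfl, huf⟩ := MemH.exists_lp hs0 hT hTs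
  obtain ⟨h, hh⟩ := hTs
  have hval : hNorm s u = ‖h‖ₑ := by
    -- The infimum runs over one element only: `u` determines the distribution, which in turn
    -- determines its Bessel potential in `L²`.
    refine le_antisymm (iInf₂_le h ⟨_, hT, hh⟩) (le_iInf₂ fun h' ⟨T', hT', hh'⟩ => le_of_eq ?_)
    have : T' = (f : 𝓢'(Pt n, ℂ)) := hT'.unique hT
    rw [this, hh] at hh'
    have := LinearMap.ker_eq_bot.1 (Lp.ker_toTemperedDistributionCLM_eq_bot (E := Pt n) (F := ℂ)
      (μ := volume) (p := 2)) hh'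
    rw [this]
  have h1 := (besselPotential_lp_eq_iff s f h).1 hh
  rw [hval, sobSq_congr s huf, sobSq_lp hs0 hs1,
    lintegral_congr_ae (h1.mono fun ξ hξ => congrArg (fun w => ‖w‖ₑ ^ 2) hξ), lintegral_enorm_sq_fourier,
    lintegral_enorm_sq_eq, Lp.enorm_def]

end

section

variable {n : ℕ} {E : Type*} [NormedAddCommGroup E] [NormedSpace ℝ E]

set_option linter.unusedSectionVars false

/-! ### Mollification -/

/-- The mollifiers. -/
def bump (n j : ℕ) : ContDiffBump (0 : Pt n) where
  rIn := 1 / (2 * ((j : ℝ) + 1))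
  rOut := 1 / ((j : ℝ) + 1)
  rIn_pos := by positivity
  rIn_lt_rOut := by
    have : (0 : ℝ) < j + 1 := by positivity
    gcongr
    linarith

/-- The probability measure whose density is a mollifier. -/
def bumpMeasure (n j : ℕ) : Measure (Pt n) :=
  volume.withDensity fun z => ENNReal.ofReal ((bump n j).normed volume z)

theorem bumpMeasure_ac (n j : ℕ) : bumpMeasure n j ≪ volume := withDensity_absolutelyContinuous _ _

theorem measurable_bump_normed (n j : ℕ) : Measurable ((bump n j).normed volume) :=
  (bump n j).continuous_normed.measurable

instance (n j : ℕ) : IsProbabilityMeasure (bumpMeasure n j) := ⟨by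
  rw [bumpMeasure, withDensity_apply _ MeasurableSet.univ, Measure.restrict_univ,
    ← ofReal_integral_eq_lintegral_ofReal (bump n j).integrable_normed
      (Eventually.of_forall fun x => (bump n j).nonneg_normed x), (bump n j).integral_normed,
    ENNReal.ofReal_one]⟩

theorem ae_bumpMeasure_norm_le (n j : ℕ) : ∀ᵐ z ∂bumpMeasure n j, ‖z‖ ≤ 1 / ((j : ℝ) + 1) := by
  rw [bumpMeasure, ae_withDensity_iff (measurable_bump_normed n j).ennreal_ofReal]
  refine Eventually.of_forall fun z hz => ?_
  by_contra h
  have h1 : z ∉ Function.support ((bump n j).normed volume) := by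
    rw [ContDiffBump.support_normed_eq]
    simpa [bump] using (not_le.1 h).le
  rw [Function.notMem_support] at h1
  simp [h1] at hz

/-- The mollification of a function. -/
def moll (j : ℕ) (u : Pt n → E) (x : Pt n) : E := ∫ z, u (x - z) ∂bumpMeasure n j

theorem moll_eq_integral (j : ℕ) (u : Pt n → E) (x : Pt n) :
    moll j u x = ∫ z, (bump n j).normed volume z • u (x - z) := by
  rw [moll, bumpMeasure, integral_withDensity_eq_integral_toReal_smul
    (measurable_bump_normed n j).ennreal_ofReal (Eventually.of_forall fun _ => ENNReal.ofReal_lt_top)]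
  refine integral_congr_ae (Eventually.of_forall fun z => ?_)
  simp [ENNReal.toReal_ofReal ((bump n j).nonneg_normed z)]

theorem moll_eq_convolution (j : ℕ) (u : Pt n → E) :
    moll j u = convolution ((bump n j).normed volume) u (ContinuousLinearMap.lsmul ℝ ℝ) volume := by
  ext x
  rw [moll_eq_integral, convolution_def]
  rfl

theorem contDiff_moll [CompleteSpace E] (j : ℕ) {u : Pt n → E} (hu : LocallyIntegrable u) :
    ContDiff ℝ ∞ (moll j u) := by
  rw [moll_eq_convolution]
  exact (bump n j).hasCompactSupport_normed.contDiff_convolution_left _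
    (bump n j).contDiff_normed hu

theorem integrable_sub_bumpMeasure (j : ℕ) {u : Pt n → E} (hu : LocallyIntegrable u) (x : Pt n) :
    Integrable (fun z => u (x - z)) (bumpMeasure n j) := by
  rw [bumpMeasure, integrable_withDensity_iff_integrable_smul₀'
    (measurable_bump_normed n j).ennreal_ofReal.aemeasurable
    (Eventually.of_forall fun _ => ENNReal.ofReal_lt_top)]
  have := (bump n j).hasCompactSupport_normed (μ := volume).convolutionExists_left
    (ContinuousLinearMap.lsmul ℝ ℝ) (bump n j).continuous_normed hu x
  refine this.integrable.congr (Eventually.of_forall fun z => ?_)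
  simp [ENNReal.toReal_ofReal ((bump n j).nonneg_normed z)]

theorem aestronglyMeasurable_sub_left {u : Pt n → E} (hu : AEStronglyMeasurable u) (x : Pt n) :
    AEStronglyMeasurable (fun z => u (x - z)) :=
  hu.comp_quasiMeasurePreserving (quasiMeasurePreserving_sub_left volume x)

theorem tendsto_moll_ae [CompleteSpace E] {u : Pt n → E} (hu : LocallyIntegrable u) :
    ∀ᵐ x, Tendsto (fun j => moll j u x) atTop (𝓝 (u x)) := by
  -- The outer radius is always twice the inner one. This bounded ratio is what gives convergence at
  -- almost every point for functions that are only locally integrable.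
  have h := ContDiffBump.ae_convolution_tendsto_right_of_locallyIntegrable (μ := volume)
    (φ := bump n) (l := atTop) (K := 2) (g := u) ?_ ?_ hu
  · filter_upwards [h] with x hx
    simpa only [moll_eq_convolution] using hx
  · exact tendsto_one_div_add_atTop_nhds_zero_nat
  · refine Eventually.of_forall fun j => le_of_eq ?_
    simp only [bump]
    field_simp

theorem norm_moll_le (j : ℕ) {u : Pt n → E} {M : ℝ} (hM : ∀ᵐ x, ‖u x‖ ≤ M) (x : Pt n) :
    ‖moll j u x‖ ≤ M := by
  have h : ∀ᵐ z ∂bumpMeasure n j, ‖u (x - z)‖ ≤ M :=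
    (bumpMeasure_ac n j).ae_le ((quasiMeasurePreserving_sub_left volume x).ae hM)
  simpa [moll] using norm_integral_le_of_norm_le_const h

theorem moll_eq_zero (j : ℕ) {u : Pt n → E} {K : Set (Pt n)} (hK : ∀ᵐ x, x ∉ K → u x = 0)
    {x : Pt n} (hx : x ∉ Metric.cthickening (1 / ((j : ℝ) + 1)) K) : moll j u x = 0 := by
  refine integral_eq_zero_of_ae ?_
  filter_upwards [ae_bumpMeasure_norm_le n j,
    (bumpMeasure_ac n j).ae_le ((quasiMeasurePreserving_sub_left volume x).ae hK)] with z hz h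
  refine h fun hmem => hx ?_
  refine Metric.mem_cthickening_of_dist_le x (x - z) _ K hmem ?_
  simpa using hz

theorem tsupport_moll_subset (j : ℕ) {u : Pt n → E} {K : Set (Pt n)} (hK : ∀ᵐ x, x ∉ K → u x = 0) :
    tsupport (moll j u) ⊆ Metric.cthickening (1 / ((j : ℝ) + 1)) K := by
  refine closure_minimal (fun x hx => ?_) Metric.isClosed_cthickening
  by_contra h
  exact hx (moll_eq_zero j hK h)

theorem hasCompactSupport_moll (j : ℕ) {u : Pt n → E} {K : Set (Pt n)} (hc : IsCompact K)
    (hK : ∀ᵐ x, x ∉ K → u x = 0) : HasCompactSupport (moll j u) :=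
  (hc.cthickening).of_isClosed_subset (isClosed_tsupport _) (tsupport_moll_subset j hK)

theorem isTest_moll {u : Pt n → ℂ} (hu : LocallyIntegrable u) {K Ω : Set (Pt n)} (hc : IsCompact K)
    (hΩ : IsOpen Ω) (hKΩ : K ⊆ Ω) (hK : ∀ᵐ x, x ∉ K → u x = 0) :
    ∀ᶠ j in atTop, IsTest Ω (moll j u) := by
  obtain ⟨δ, hδ, hsub⟩ := hc.exists_cthickening_subset_open hΩ hKΩ
  have h1 : ∀ᶠ j : ℕ in atTop, 1 / ((j : ℝ) + 1) < δ :=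
    tendsto_one_div_add_atTop_nhds_zero_nat.eventually_lt_const hδ
  filter_upwards [h1] with j hj
  exact ⟨contDiff_moll j hu, hasCompactSupport_moll j hc hK,
    (tsupport_moll_subset j hK).trans ((Metric.cthickening_mono hj.le K).trans hsub)⟩

/-- Jensen's inequality, as the inclusion of `L²` in `L¹` for a probability measure. -/
theorem enorm_integral_sq_le {α : Type*} [MeasurableSpace α] (ν : Measure α)
    [IsProbabilityMeasure ν] {f : α → E} (hf : AEStronglyMeasurable f ν) :
    ‖∫ z, f z ∂ν‖ₑ ^ 2 ≤ ∫⁻ z, ‖f z‖ₑ ^ 2 ∂ν := by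
  rw [lintegral_enorm_sq_eq]
  gcongr
  calc ‖∫ z, f z ∂ν‖ₑ ≤ ∫⁻ z, ‖f z‖ₑ ∂ν := enorm_integral_le_lintegral_enorm f
    _ = eLpNorm f 1 ν := eLpNorm_one_eq_lintegral_enorm.symm
    _ ≤ eLpNorm f 2 ν := eLpNorm_le_eLpNorm_of_exponent_le one_le_two hf

theorem lintegral_enorm_moll_sq_le (j : ℕ) {u : Pt n → E} (hu : AEStronglyMeasurable u) :
    ∫⁻ x, ‖moll j u x‖ₑ ^ 2 ≤ ∫⁻ x, ‖u x‖ₑ ^ 2 := by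
  calc ∫⁻ x, ‖moll j u x‖ₑ ^ 2
      ≤ ∫⁻ x, ∫⁻ z, ‖u (x - z)‖ₑ ^ 2 ∂bumpMeasure n j :=
        lintegral_mono fun x => enorm_integral_sq_le _
          ((aestronglyMeasurable_sub_left hu x).mono_ac (bumpMeasure_ac n j))
    _ = ∫⁻ z, (∫⁻ x, ‖u (x - z)‖ₑ ^ 2) ∂bumpMeasure n j := by
        refine lintegral_lintegral_swap ?_
        exact ((aestronglyMeasurable_comp_sub hu).mono_ac
          (Measure.AbsolutelyContinuous.rfl.prod (bumpMeasure_ac n j))).enorm.pow_const 2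
    _ = ∫⁻ x, ‖u x‖ₑ ^ 2 := by
        simp only [lintegral_sub_right_eq_self (fun x => ‖u x‖ₑ ^ 2), lintegral_const, measure_univ,
          mul_one]

theorem moll_shift_sub (j : ℕ) {u : Pt n → E} (hu : LocallyIntegrable u) (w x : Pt n) :
    moll j (fun x => u (x + w) - u x) x = moll j u (x + w) - moll j u x := by
  have h1 := integrable_sub_bumpMeasure j hu (x + w)
  have h2 := integrable_sub_bumpMeasure j hu x
  rw [moll, moll, moll, ← integral_sub h1 h2]
  refine integral_congr_ae (Eventually.of_forall fun z => ?_)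
  simp only [sub_add_eq_add_sub]

/-- Mollification commutes with the differences `u(· + z) - u` and contracts `L²`, so the inequality
holds for each `z` before the kernel is integrated. -/
theorem energy_moll_le {k : Pt n → ℝ≥0∞} (hk : Measurable k) (j : ℕ) {u : Pt n → ℂ}
    (hu : LocallyIntegrable u) : energy k (moll j u) ≤ energy k u := by
  rw [energy_eq_lintegral_shift hk (contDiff_moll j hu).continuous.aestronglyMeasurable,
    energy_eq_lintegral_shift hk hu.aestronglyMeasurable]
  refine lintegral_mono fun z => mul_le_mul_left ?_ _
  have h := lintegral_enorm_moll_sq_le j ((aestronglyMeasurable_shift hu.aestronglyMeasurable z).sub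
    hu.aestronglyMeasurable)
  refine le_trans (le_of_eq (lintegral_congr fun x => ?_)) h
  rw [← moll_shift_sub j hu]
  rfl

/-- On the Fourier side the multiplier `2(1 - cos 2π⟨z, ξ⟩)` is at most `4` and tends to `0` with
`z`, so dominated convergence applies. -/
theorem tendsto_lintegral_shift_sub {u : Pt n → ℂ} (hu : MemLp u 2) :
    Tendsto (fun z => ∫⁻ x, ‖u (x + z) - u x‖ₑ ^ 2) (𝓝 0) (𝓝 0) := by
  have h1 : ∀ z, ∫⁻ x, ‖u (x + z) - u x‖ₑ ^ 2
      = ∫⁻ ξ, ENNReal.ofReal (2 * (1 - Real.cos (2 * Real.pi * inner ℝ z ξ))) *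
        ‖(FourierTransform.fourier hu.toLp : Lp ℂ 2 (volume : Measure (Pt n))) ξ‖ₑ ^ 2 := by
    intro z
    rw [← lintegral_shift_sub_eq_fourier]
    refine lintegral_congr_ae ?_
    filter_upwards [hu.coeFn_toLp, (measurePreserving_add_right volume
      z).quasiMeasurePreserving.ae hu.coeFn_toLp] with x h1 h2
    rw [h1, h2]
  simp_rw [h1]
  set F := (FourierTransform.fourier hu.toLp : Lp ℂ 2 (volume : Measure (Pt n)))
  have hF : Measurable (fun ξ => ‖F ξ‖ₑ ^ 2) := (Lp.stronglyMeasurable F).enorm.pow_const 2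
  have hfin := (memLp_two_iff.1 (Lp.memLp F)).2
  have h0 : (0 : ℝ≥0∞) = ∫⁻ _ : Pt n, 0 := by simp
  rw [h0]
  refine tendsto_lintegral_filter_of_dominated_convergence (fun ξ => 4 * ‖F ξ‖ₑ ^ 2) ?_ ?_ ?_ ?_
  · exact Eventually.of_forall fun z => Measurable.mul (by fun_prop) hF
  · refine Eventually.of_forall fun z => Eventually.of_forall fun ξ => ?_
    gcongr
    rw [← ENNReal.ofReal_ofNat 4]
    apply ENNReal.ofReal_le_ofReal
    linarith [Real.neg_one_le_cos (2 * Real.pi * inner ℝ z ξ)]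
  · rw [lintegral_const_mul _ hF]
    exact (ENNReal.mul_lt_top (by simp) hfin).ne
  · filter_upwards [ae_lt_top hF hfin.ne] with ξ hξ
    have hc : Tendsto (fun z : Pt n => ENNReal.ofReal
        (2 * (1 - Real.cos (2 * Real.pi * inner ℝ z ξ)))) (𝓝 0) (𝓝 0) := by
      have : Continuous (fun z : Pt n => ENNReal.ofReal
        (2 * (1 - Real.cos (2 * Real.pi * inner ℝ z ξ)))) :=
        ENNReal.continuous_ofReal.comp (by fun_prop)
      simpa using this.tendsto 0
    simpa using ENNReal.Tendsto.mul_const hc (Or.inr hξ.ne)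

/-- By Jensen the error is at most an average of the translation errors over `|z| ≤ 1/(j+1)`. -/
theorem tendsto_lintegral_moll_sub {u : Pt n → ℂ} (hu : MemLp u 2) :
    Tendsto (fun j => ∫⁻ x, ‖moll j u x - u x‖ₑ ^ 2) atTop (𝓝 0) := by
  have hl : LocallyIntegrable u := hu.locallyIntegrable one_le_two
  have hle : ∀ j, ∫⁻ x, ‖moll j u x - u x‖ₑ ^ 2
      ≤ ∫⁻ z, (∫⁻ x, ‖u (x - z) - u x‖ₑ ^ 2) ∂bumpMeasure n j := by
    intro j
    have hm : AEStronglyMeasurable (fun p : Pt n × Pt n => u (p.1 - p.2) - u p.1)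
        (volume.prod (bumpMeasure n j)) :=
      ((aestronglyMeasurable_comp_sub hu.1).sub hu.1.comp_fst).mono_ac
        (Measure.AbsolutelyContinuous.rfl.prod (bumpMeasure_ac n j))
    rw [← lintegral_lintegral_swap (hm.enorm.pow_const 2)]
    refine lintegral_mono fun x => ?_
    have h1 := integrable_sub_bumpMeasure j hl x
    have h2 : moll j u x - u x = ∫ z, (u (x - z) - u x) ∂bumpMeasure n j := by
      rw [integral_sub h1 (integrable_const _)]
      simp [moll]
    rw [h2]
    exact enorm_integral_sq_le _ (h1.sub (integrable_const _)).aestronglyMeasurable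
  rw [ENNReal.tendsto_nhds_zero]
  intro ε hε
  have h := (ENNReal.tendsto_nhds_zero.1 (tendsto_lintegral_shift_sub hu)) ε hε
  obtain ⟨δ, hδ, hball⟩ := Metric.eventually_nhds_iff.1 h
  have h1 : ∀ᶠ j : ℕ in atTop, 1 / ((j : ℝ) + 1) < δ :=
    tendsto_one_div_add_atTop_nhds_zero_nat.eventually_lt_const hδ
  filter_upwards [h1] with j hj
  refine (hle j).trans ?_
  calc ∫⁻ z, (∫⁻ x, ‖u (x - z) - u x‖ₑ ^ 2) ∂bumpMeasure n j
      ≤ ∫⁻ _, ε ∂bumpMeasure n j := by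
        refine lintegral_mono_ae ?_
        filter_upwards [ae_bumpMeasure_norm_le n j] with z hz
        have := hball (y := -z) (by simpa using hz.trans_lt hj)
        simpa only [sub_eq_add_neg] using this
    _ = ε := by simp

theorem enorm_sub_sq_le (a b : E) : ‖a - b‖ₑ ^ 2 ≤ 2 * ‖a‖ₑ ^ 2 + 2 * ‖b‖ₑ ^ 2 := by
  have h : ‖a - b‖ ^ 2 ≤ 2 * ‖a‖ ^ 2 + 2 * ‖b‖ ^ 2 := by
    have h1 := norm_sub_le a b
    have h2 : ‖a - b‖ ^ 2 ≤ (‖a‖ + ‖b‖) ^ 2 := by gcongr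
    nlinarith [sq_nonneg (‖a‖ - ‖b‖)]
  have h2 := ENNReal.ofReal_le_ofReal h
  rwa [ENNReal.ofReal_add (by positivity) (by positivity), ENNReal.ofReal_mul (by norm_num),
    ENNReal.ofReal_mul (by norm_num), ENNReal.ofReal_pow (norm_nonneg _),
    ENNReal.ofReal_pow (norm_nonneg _), ENNReal.ofReal_pow (norm_nonneg _), ofReal_norm,
    ofReal_norm, ofReal_norm, ENNReal.ofReal_ofNat] at h2

/-- Dominated convergence in `z`: the inner `L²` norm tends to `0` for each shift, and contraction
bounds the integrand by four times that of the energy of `u`. -/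
theorem tendsto_energy_moll_sub {k : Pt n → ℝ≥0∞} (hk : Measurable k) {u : Pt n → ℂ}
    (hu : MemLp u 2) (hfin : energy k u < ⊤) :
    Tendsto (fun j => energy k (fun x => moll j u x - u x)) atTop (𝓝 0) := by
  have hl : LocallyIntegrable u := hu.locallyIntegrable one_le_two
  have hm : ∀ j, AEStronglyMeasurable (moll j u) := fun j =>
    (contDiff_moll j hl).continuous.aestronglyMeasurable
  have hd : ∀ z, MemLp (fun x => u (x + z) - u x) 2 := fun z =>
    (hu.comp_measurePreserving (measurePreserving_add_right volume z)).sub hu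
  have he : ∀ j, energy k (fun x => moll j u x - u x)
      = ∫⁻ z, (∫⁻ x, ‖moll j (fun x => u (x + z) - u x) x - (u (x + z) - u x)‖ₑ ^ 2) * k z := by
    intro j
    rw [energy_eq_lintegral_shift (u := fun x => moll j u x - u x) hk ((hm j).sub hu.1)]
    refine lintegral_congr fun z => ?_
    congr 1
    refine lintegral_congr fun x => ?_
    rw [moll_shift_sub j hl]
    congr 2
    abel
  simp_rw [he]
  have h0 : (0 : ℝ≥0∞) = ∫⁻ _ : Pt n, 0 := by simp
  rw [h0]
  have hbm : AEMeasurable (fun z : Pt n => (∫⁻ x, ‖u (x + z) - u x‖ₑ ^ 2) * k z) volume := by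
    refine AEMeasurable.mul ?_ hk.aemeasurable
    refine AEMeasurable.lintegral_prod_right'
      (f := fun p : Pt n × Pt n => ‖u (p.2 + p.1) - u p.2‖ₑ ^ 2) ?_
    have : AEStronglyMeasurable (fun p : Pt n × Pt n => u (p.2 + p.1)) (volume.prod volume) := by
      simpa only [add_comm] using aestronglyMeasurable_comp_add hu.1
    exact (this.sub hu.1.comp_snd).enorm.pow_const 2
  have hE : ∫⁻ z : Pt n, (∫⁻ x, ‖u (x + z) - u x‖ₑ ^ 2) * k z < ⊤ := by
    rwa [← energy_eq_lintegral_shift hk hu.1]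
  have hbound : ∀ j z, ∫⁻ x, ‖moll j (fun x => u (x + z) - u x) x - (u (x + z) - u x)‖ₑ ^ 2
      ≤ 4 * ∫⁻ x, ‖u (x + z) - u x‖ₑ ^ 2 := by
    intro j z
    have hv := (hd z).1
    calc ∫⁻ x, ‖moll j (fun x => u (x + z) - u x) x - (u (x + z) - u x)‖ₑ ^ 2
        ≤ ∫⁻ x, (2 * ‖moll j (fun x => u (x + z) - u x) x‖ₑ ^ 2 + 2 * ‖u (x + z) - u x‖ₑ ^ 2) :=
          lintegral_mono fun x => enorm_sub_sq_le _ _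
      _ = 2 * (∫⁻ x, ‖moll j (fun x => u (x + z) - u x) x‖ₑ ^ 2)
            + 2 * ∫⁻ x, ‖u (x + z) - u x‖ₑ ^ 2 := by
          rw [lintegral_add_right' _ ((hv.enorm.pow_const 2).const_mul _),
            lintegral_const_mul' _ _ (by simp), lintegral_const_mul' _ _ (by simp)]
      _ ≤ 2 * (∫⁻ x, ‖u (x + z) - u x‖ₑ ^ 2) + 2 * ∫⁻ x, ‖u (x + z) - u x‖ₑ ^ 2 :=
          add_le_add_left (mul_le_mul_right (lintegral_enorm_moll_sq_le j hv) _) _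
      _ = 4 * ∫⁻ x, ‖u (x + z) - u x‖ₑ ^ 2 := by
          rw [← add_mul]; norm_num
  refine tendsto_lintegral_of_dominated_convergence'
    (fun z => 4 * ((∫⁻ x, ‖u (x + z) - u x‖ₑ ^ 2) * k z)) ?_ ?_ ?_ ?_
  · refine fun j => AEMeasurable.mul ?_ hk.aemeasurable
    have hw := (hm j).sub hu.1
    have h1 : AEStronglyMeasurable (fun p : Pt n × Pt n => (moll j u - u) (p.2 + p.1))
        (volume.prod volume) := by
      simpa only [add_comm] using aestronglyMeasurable_comp_add hw
    have h2 := AEMeasurable.lintegral_prod_right' ((h1.sub hw.comp_snd).enorm.pow_const 2)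
    refine h2.congr (Eventually.of_forall fun z => lintegral_congr fun x => ?_)
    rw [moll_shift_sub j hl]
    congr 2
    simp only [Pi.sub_apply]
    abel
  · refine fun j => Eventually.of_forall fun z => ?_
    simp only [← mul_assoc]
    exact mul_le_mul_left (hbound j z) _
  · rw [lintegral_const_mul' _ _ (by simp)]
    exact (ENNReal.mul_lt_top (by simp) hE).ne
  · filter_upwards [ae_lt_top' hbm hE.ne] with z hz
    -- The kernel may be infinite, and then convergence of the other factor to `0` is not enough.
    -- Since the energy density is finite at almost every `z`, an infinite kernel value forces the
    -- difference to vanish there.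
    by_cases hkz : k z = ⊤
    · have h00 : ∫⁻ x, ‖u (x + z) - u x‖ₑ ^ 2 = 0 := by
        by_contra h
        rw [hkz, ENNReal.mul_top h] at hz
        exact lt_irrefl _ hz
      have h3 : ∀ j, ∫⁻ x, ‖moll j (fun x => u (x + z) - u x) x - (u (x + z) - u x)‖ₑ ^ 2 = 0 :=
        fun j => le_antisymm ((hbound j z).trans (by rw [h00, mul_zero])) zero_le
      simp [h3]
    · simpa using ENNReal.Tendsto.mul_const (tendsto_lintegral_moll_sub (hd z)) (Or.inr hkz)

end

section

variable {n : ℕ}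

/-! ### The fractional Sobolev inequality -/

/-- The Sobolev exponent `2n / (n - 2s)`. -/
def sobExp (n : ℕ) (s : ℝ) : ℝ := 2 * n / (n - 2 * s)

theorem two_lt_sobExp {s : ℝ} (hs0 : 0 < s) (hsn : 2 * s < n) : 2 < sobExp n s := by
  rw [sobExp, lt_div_iff₀ (by linarith)]
  linarith

/-- Optimization over the radius. The two terms have powers of `r` of opposite signs and are
balanced when `r^{d/2} = Q g^{-1/2}`; with `p = 2d/(d - 2s)` the exponent of `g` then becomes `1`.
If `g = 0`, let `r → ∞`. -/
theorem rpow_le_of_forall_radius {w g Q a b s d p : ℝ} (hw : 0 ≤ w) (hg : 0 ≤ g) (hQ : 0 < Q)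
    (ha : 0 ≤ a) (hb : 0 ≤ b) (hs : 0 < s) (hsd : 2 * s < d) (hp : p = 2 * d / (d - 2 * s))
    (h : ∀ r : ℝ, 0 < r → w ≤ a * r ^ s * g ^ (1 / 2 : ℝ) + b * r ^ (s - d / 2) * Q) :
    w ^ p ≤ (a + b) ^ p * Q ^ (p * (2 * s / d)) * g := by
  have hd : 0 < d := by linarith
  have hp0 : 0 < p := by rw [hp]; exact div_pos (by linarith) (by linarith)
  rcases hg.eq_or_lt with rfl | hg
  · have h1 : Tendsto (fun r : ℝ => b * r ^ (s - d / 2) * Q) atTop (𝓝 (b * 0 * Q)) := by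
      refine (Tendsto.const_mul _ ?_).mul_const _
      have := tendsto_rpow_neg_atTop (show 0 < d / 2 - s by linarith)
      simpa using this
    have h2 : w ≤ b * 0 * Q := by
      refine ge_of_tendsto h1 ?_
      filter_upwards [eventually_gt_atTop 0] with r hr
      simpa using h r hr
    have h3 : w = 0 := le_antisymm (by simpa using h2) hw
    rw [h3, Real.zero_rpow hp0.ne']
    simp
  · set r : ℝ := (Q * g ^ (-(1 / 2) : ℝ)) ^ (2 / d) with hr
    have hr0 : 0 < r := by positivity
    have hg' : 0 < g ^ (-(1 / 2) : ℝ) := by positivity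
    have e1 : r ^ (s - d / 2) * Q = r ^ s * g ^ (1 / 2 : ℝ) := by
      have : r ^ (d / 2) = Q * g ^ (-(1 / 2) : ℝ) := by
        rw [hr, ← Real.rpow_mul (by positivity)]
        have : 2 / d * (d / 2) = 1 := by field_simp
        rw [this, Real.rpow_one]
      rw [Real.rpow_sub hr0, this, Real.rpow_neg hg.le]
      field_simp
    have h1 : w ≤ (a + b) * (r ^ s * g ^ (1 / 2 : ℝ)) := by
      have := h r hr0
      rw [mul_assoc b, e1] at this
      linarith
    have h2 := Real.rpow_le_rpow hw h1 hp0.le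
    refine h2.trans (le_of_eq ?_)
    rw [Real.mul_rpow (by positivity) (by positivity), mul_assoc]
    congr 1
    rw [Real.mul_rpow (by positivity) (by positivity), ← Real.rpow_mul hr0.le,
      ← Real.rpow_mul hg.le, hr, ← Real.rpow_mul (by positivity),
      Real.mul_rpow hQ.le hg'.le, ← Real.rpow_mul hg.le, mul_assoc, ← Real.rpow_add hg]
    have e2 : 2 / d * (s * p) = p * (2 * s / d) := by ring
    have e3 : -(1 / 2) * (2 / d * (s * p)) + 1 / 2 * p = 1 := by
      rw [hp]
      have : d - 2 * s ≠ 0 := by linarith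
      field_simp
      ring
    rw [e2] at *
    rw [e3, Real.rpow_one]

/-- The inner integral in the definition of the energy. -/
def localEnergy (k : Pt n → ℝ≥0∞) (u : Pt n → ℂ) (x : Pt n) : ℝ≥0∞ :=
  ∫⁻ y, ‖u x - u y‖ₑ ^ 2 * k (x - y)

/-- The volume of the unit ball. -/
def unitVol (n : ℕ) : ℝ := (volume (Metric.ball (0 : Pt n) 1)).toReal

theorem unitVol_pos (n : ℕ) : 0 < unitVol n :=
  ENNReal.toReal_pos (Metric.measure_ball_pos _ _ one_pos).ne' measure_ball_lt_top.ne

theorem volume_ball_eq (x : Pt n) {r : ℝ} (hr : 0 < r) :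
    volume (Metric.ball x r) = ENNReal.ofReal (unitVol n * r ^ (n : ℝ)) := by
  rw [Measure.addHaar_ball_of_pos volume x hr, finrank_euclideanSpace, Fintype.card_fin,
    mul_comm, ENNReal.ofReal_mul (unitVol_pos n).le, unitVol, ENNReal.ofReal_toReal
    measure_ball_lt_top.ne, Real.rpow_natCast]

theorem lintegral_le_rpow_mul_measure {α : Type*} [MeasurableSpace α] (μ : Measure α) {p : ℝ}
    (hp : 1 < p) {f : α → ℝ≥0∞} (hf : AEMeasurable f μ) :
    ∫⁻ x, f x ∂μ ≤ (∫⁻ x, f x ^ p ∂μ) ^ (1 / p) * μ Set.univ ^ (1 - 1 / p) := by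
  have hpq := Real.HolderConjugate.conjExponent hp
  have h := ENNReal.lintegral_mul_le_Lp_mul_Lq μ hpq hf (aemeasurable_const (b := (1 : ℝ≥0∞)))
  have e : 1 / p.conjExponent = 1 - 1 / p := by
    have := hpq.inv_add_inv_eq_one
    rw [one_div, one_div]; linarith
  simpa [e] using h

/-- Within distance `r` the square root of the kernel is at least `r^{-(n/2+s)}`. -/
theorem le_rpow_half_homKernel {s : ℝ} (hs0 : 0 < s) (u : Pt n → ℂ) (x y : Pt n) {r : ℝ}
    (h : ‖x - y‖ ≤ r) :
    ‖u x - u y‖ₑ ≤ ENNReal.ofReal (r ^ ((n : ℝ) / 2 + s)) *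
      (‖u x - u y‖ₑ ^ 2 * homKernel n s (x - y)) ^ (1 / 2 : ℝ) := by
  rcases eq_or_ne x y with rfl | hxy
  · simp
  have hd : 0 < ‖x - y‖ := norm_pos_iff.2 (sub_ne_zero.2 hxy)
  have hr : 0 < r := hd.trans_le h
  rw [ENNReal.mul_rpow_of_nonneg _ _ (by norm_num), homKernel,
    ENNReal.ofReal_rpow_of_pos (by positivity), ← ENNReal.rpow_natCast, ← ENNReal.rpow_mul]
  have e : ((2 : ℕ) : ℝ) * (1 / 2) = 1 := by norm_num
  rw [e, ENNReal.rpow_one, mul_left_comm, ← ENNReal.ofReal_mul (by positivity)]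
  refine le_mul_of_one_le_right zero_le ?_
  rw [ENNReal.one_le_ofReal, ← Real.rpow_mul hd.le]
  have e2 : -((n : ℝ) + 2 * s) * (1 / 2) = -((n : ℝ) / 2 + s) := by ring
  rw [e2, Real.rpow_neg hd.le, ← div_eq_mul_inv, one_le_div (by positivity)]
  exact Real.rpow_le_rpow hd.le h (by positivity)

/-- Average `w(x) ≤ |u(x) - u(y)| + w(y)` over the ball of radius `r`. The difference is handled by
Cauchy-Schwarz against the kernel, and `w` by Hölder with the Sobolev exponent. The function `w`
stands for a truncation of `|u|`. -/
theorem ball_average_le {s : ℝ} (hs0 : 0 < s) (hsn : 2 * s < n) {u : Pt n → ℂ}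
    (hu : AEStronglyMeasurable u) {w : Pt n → ℝ} (hw0 : ∀ x, 0 ≤ w x) (hwm : AEStronglyMeasurable w)
    (hwu : ∀ x y, w x ≤ ‖u x - u y‖ + w y) (x : Pt n)
    (hg : localEnergy (homKernel n s) u x ≠ ⊤)
    (hP : ∫⁻ y, ENNReal.ofReal (w y) ^ sobExp n s ≠ ⊤) {r : ℝ} (hr : 0 < r) :
    w x ≤ unitVol n ^ (-(1 / 2) : ℝ) * r ^ s *
        (localEnergy (homKernel n s) u x).toReal ^ (1 / 2 : ℝ)
      + unitVol n ^ (-(1 / sobExp n s)) * r ^ (s - (n : ℝ) / 2) *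
        (∫⁻ y, ENNReal.ofReal (w y) ^ sobExp n s).toReal ^ (1 / sobExp n s) := by
  set p := sobExp n s with hpdef
  have hp : 2 < p := two_lt_sobExp hs0 hsn
  set V := unitVol n
  have hV : 0 < V := unitVol_pos n
  set B := V * r ^ (n : ℝ) with hB
  have hB0 : 0 < B := by positivity
  set g := localEnergy (homKernel n s) u x with hgdef
  set P := ∫⁻ y, ENNReal.ofReal (w y) ^ p with hPdef
  have hum : AEMeasurable (fun y => ‖u x - u y‖ₑ) (volume.restrict (Metric.ball x r)) :=
    (aestronglyMeasurable_const.sub hu).enorm.restrict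
  have hk := measurable_homKernel n s
  have hkm : AEMeasurable (fun y => ‖u x - u y‖ₑ ^ 2 * homKernel n s (x - y)) volume :=
    ((aestronglyMeasurable_const.sub hu).enorm.pow_const 2).mul
      (hk.comp (measurable_const.sub measurable_id)).aemeasurable
  have hvol : volume.restrict (Metric.ball x r) Set.univ = ENNReal.ofReal B := by
    rw [Measure.restrict_apply_univ, volume_ball_eq x hr]
  have h1 : ENNReal.ofReal (w x * B) ≤ (∫⁻ y in Metric.ball x r, ‖u x - u y‖ₑ)
      + ∫⁻ y in Metric.ball x r, ENNReal.ofReal (w y) := by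
    calc ENNReal.ofReal (w x * B) = ∫⁻ _ in Metric.ball x r, ENNReal.ofReal (w x) := by
          rw [setLIntegral_const, volume_ball_eq x hr, ENNReal.ofReal_mul (hw0 x)]
      _ ≤ ∫⁻ y in Metric.ball x r, (‖u x - u y‖ₑ + ENNReal.ofReal (w y)) := by
          refine lintegral_mono fun y => ?_
          rw [← ofReal_norm, ← ENNReal.ofReal_add (norm_nonneg _) (hw0 y)]
          exact ENNReal.ofReal_le_ofReal (hwu x y)
      _ = _ := lintegral_add_left' hum _
  have h2 : ∫⁻ y in Metric.ball x r, ‖u x - u y‖ₑ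
      ≤ ENNReal.ofReal (r ^ ((n : ℝ) / 2 + s) * (g.toReal ^ (1 / 2 : ℝ) * B ^ (1 / 2 : ℝ))) := by
    calc ∫⁻ y in Metric.ball x r, ‖u x - u y‖ₑ
        ≤ ∫⁻ y in Metric.ball x r, ENNReal.ofReal (r ^ ((n : ℝ) / 2 + s)) *
            (‖u x - u y‖ₑ ^ 2 * homKernel n s (x - y)) ^ (1 / 2 : ℝ) := by
          refine setLIntegral_mono' measurableSet_ball fun y hy => ?_
          refine le_rpow_half_homKernel hs0 u x y ?_
          rw [← dist_eq_norm, dist_comm]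
          exact (Metric.mem_ball.1 hy).le
      _ = ENNReal.ofReal (r ^ ((n : ℝ) / 2 + s)) * ∫⁻ y in Metric.ball x r,
            (‖u x - u y‖ₑ ^ 2 * homKernel n s (x - y)) ^ (1 / 2 : ℝ) :=
          lintegral_const_mul' _ _ ENNReal.ofReal_ne_top
      _ ≤ ENNReal.ofReal (r ^ ((n : ℝ) / 2 + s)) *
            (g ^ (1 / 2 : ℝ) * ENNReal.ofReal B ^ (1 / 2 : ℝ)) := by
          refine mul_le_mul_right ?_ _
          refine (lintegral_le_rpow_mul_measure _ one_lt_two (hkm.restrict.pow_const _)).trans ?_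
          rw [hvol]
          have e : (1 - 1 / 2 : ℝ) = 1 / 2 := by norm_num
          rw [e]
          gcongr
          calc ∫⁻ y in Metric.ball x r, ((‖u x - u y‖ₑ ^ 2 * homKernel n s (x - y)) ^ (1 / 2 : ℝ))
                ^ (2 : ℝ)
              = ∫⁻ y in Metric.ball x r, ‖u x - u y‖ₑ ^ 2 * homKernel n s (x - y) := by
                refine lintegral_congr fun y => ?_
                rw [← ENNReal.rpow_mul]; norm_num
            _ ≤ g := setLIntegral_le_lintegral _ _
      _ = _ := by
          rw [← ENNReal.ofReal_toReal hg, ENNReal.ofReal_rpow_of_nonneg ENNReal.toReal_nonneg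
            (by norm_num), ENNReal.ofReal_rpow_of_nonneg hB0.le (by norm_num),
            ENNReal.toReal_ofReal ENNReal.toReal_nonneg,
            ← ENNReal.ofReal_mul (by positivity), ← ENNReal.ofReal_mul (by positivity)]
  have h3 : ∫⁻ y in Metric.ball x r, ENNReal.ofReal (w y)
      ≤ ENNReal.ofReal (P.toReal ^ (1 / p) * B ^ (1 - 1 / p)) := by
    refine (lintegral_le_rpow_mul_measure _ (one_lt_two.trans hp)
      hwm.aemeasurable.ennreal_ofReal.restrict).trans ?_
    have hp1 : 1 / p < 1 := by
      rw [div_lt_one (by positivity)]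
      exact one_lt_two.trans hp
    rw [hvol, ENNReal.ofReal_mul (p := P.toReal ^ (1 / p)) (by positivity),
      ← ENNReal.ofReal_rpow_of_nonneg
      ENNReal.toReal_nonneg (by positivity), ← ENNReal.ofReal_rpow_of_nonneg hB0.le (sub_nonneg.2 hp1.le),
      ENNReal.ofReal_toReal hP]
    gcongr
    exact setLIntegral_le_lintegral _ _
  have h4 : w x * B ≤ r ^ ((n : ℝ) / 2 + s) * (g.toReal ^ (1 / 2 : ℝ) * B ^ (1 / 2 : ℝ))
      + P.toReal ^ (1 / p) * B ^ (1 - 1 / p) := by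
    have := h1.trans (add_le_add h2 h3)
    rwa [← ENNReal.ofReal_add (by positivity) (by positivity),
      ENNReal.ofReal_le_ofReal_iff (by positivity)] at this
  have h5 : w x ≤ r ^ ((n : ℝ) / 2 + s) * g.toReal ^ (1 / 2 : ℝ) * B ^ (-(1 / 2) : ℝ)
      + P.toReal ^ (1 / p) * B ^ (-(1 / p)) := by
    refine le_of_mul_le_mul_right (h4.trans (le_of_eq ?_)) hB0
    have e1 : B ^ (1 / 2 : ℝ) = B ^ (-(1 / 2) : ℝ) * B := by
      nth_rewrite 3 [← Real.rpow_one B]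
      rw [← Real.rpow_add hB0]; norm_num
    have e2 : B ^ (1 - 1 / p) = B ^ (-(1 / p)) * B := by
      nth_rewrite 3 [← Real.rpow_one B]
      rw [← Real.rpow_add hB0]; ring_nf
    rw [e1, e2]; ring
  refine h5.trans (le_of_eq ?_)
  have e3 : B ^ (-(1 / 2) : ℝ) * r ^ ((n : ℝ) / 2 + s) = V ^ (-(1 / 2) : ℝ) * r ^ s := by
    rw [hB, Real.mul_rpow hV.le (by positivity), ← Real.rpow_mul hr.le, mul_assoc,
      ← Real.rpow_add hr]
    congr 2; ring
  have e4 : B ^ (-(1 / p)) = V ^ (-(1 / p)) * r ^ (s - (n : ℝ) / 2) := by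
    rw [hB, Real.mul_rpow hV.le (by positivity), ← Real.rpow_mul hr.le]
    congr 2
    rw [hpdef, sobExp]
    have : (n : ℝ) ≠ 0 := by linarith
    field_simp
    ring
  rw [← e3, e4]; ring

/-- The constant of the Sobolev inequality. -/
def sobConst (n : ℕ) (s : ℝ) : ℝ :=
  (unitVol n ^ (-(1 / 2) : ℝ) + unitVol n ^ (-(1 / sobExp n s))) ^ sobExp n s

theorem sobConst_pos (n : ℕ) (s : ℝ) : 0 < sobConst n s := by
  have := unitVol_pos n
  unfold sobConst
  positivity

/-- Optimizing the radius at each point gives `w^p ≤ C P^{2s/n} g`, with `p` the Sobolev exponent,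
`P = ∫ w^p` and `g` the local energy. Integration gives `P ≤ C P^{2s/n} E` for the total energy `E`,
and one divides by the power of `P`, using `1 - 2s/n = 2/p`. This absorption is why `P` must be
known to be finite. -/
theorem sobolev_of_finite {s : ℝ} (hs0 : 0 < s) (hsn : 2 * s < n) {u : Pt n → ℂ}
    (hu : AEStronglyMeasurable u) {w : Pt n → ℝ} (hw0 : ∀ x, 0 ≤ w x) (hwm : AEStronglyMeasurable w)
    (hwu : ∀ x y, w x ≤ ‖u x - u y‖ + w y)
    (hP : ∫⁻ y, ENNReal.ofReal (w y) ^ sobExp n s ≠ ⊤) :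
    (∫⁻ y, ENNReal.ofReal (w y) ^ sobExp n s) ^ (2 / sobExp n s)
      ≤ ENNReal.ofReal (sobConst n s) * energy (homKernel n s) u := by
  have hp : 2 < sobExp n s := two_lt_sobExp hs0 hsn
  have hC := sobConst_pos n s
  have hV := unitVol_pos n
  have hn : (0 : ℝ) < n := by linarith
  set P := ∫⁻ y, ENNReal.ofReal (w y) ^ sobExp n s with hPdef
  have hp2 : 0 < 2 / sobExp n s := by positivity
  rcases eq_or_ne P 0 with h0 | h0
  · rw [h0, ENNReal.zero_rpow_of_pos hp2]
    exact zero_le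
  have hP0 : 0 < P.toReal := ENNReal.toReal_pos h0 hP
  set Q := P.toReal ^ (1 / sobExp n s) with hQ
  have hQ0 : 0 < Q := by positivity
  have hQp : Q ^ (sobExp n s * (2 * s / n)) = P.toReal ^ (2 * s / n) := by
    rw [hQ, ← Real.rpow_mul hP0.le]
    congr 1
    field_simp
  have hpt : ∀ x, ENNReal.ofReal (w x) ^ sobExp n s
      ≤ ENNReal.ofReal (sobConst n s * P.toReal ^ (2 * s / n)) *
        localEnergy (homKernel n s) u x := by
    intro x
    by_cases hg : localEnergy (homKernel n s) u x = ⊤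
    · rw [hg, ENNReal.mul_top]
      · exact le_top
      · rw [Ne, ENNReal.ofReal_eq_zero, not_le]
        positivity
    · have h := rpow_le_of_forall_radius (hw0 x) ENNReal.toReal_nonneg hQ0
        (by positivity : 0 ≤ unitVol n ^ (-(1 / 2) : ℝ))
        (by positivity : 0 ≤ unitVol n ^ (-(1 / sobExp n s))) hs0 hsn rfl
        (fun r hr => ball_average_le hs0 hsn hu hw0 hwm hwu x hg hP hr)
      rw [show 2 * (n : ℝ) / (n - 2 * s) = sobExp n s from rfl, hQp] at h
      rw [ENNReal.ofReal_rpow_of_nonneg (hw0 x) (by linarith), ← ENNReal.ofReal_toReal hg,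
        ← ENNReal.ofReal_mul (by positivity)]
      exact ENNReal.ofReal_le_ofReal h
  have hint : P ≤ ENNReal.ofReal (sobConst n s * P.toReal ^ (2 * s / n)) *
      energy (homKernel n s) u := by
    refine (lintegral_mono hpt).trans (le_of_eq ?_)
    rw [lintegral_const_mul' _ _ ENNReal.ofReal_ne_top]
    rfl
  by_cases hG : energy (homKernel n s) u = ⊤
  · rw [hG, ENNReal.mul_top]
    · exact le_top
    · rw [Ne, ENNReal.ofReal_eq_zero, not_le]
      exact hC
  · rw [← ENNReal.ofReal_toReal hP, ← ENNReal.ofReal_toReal hG,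
      ← ENNReal.ofReal_mul (by positivity),
      ENNReal.ofReal_le_ofReal_iff (by positivity), ENNReal.toReal_ofReal hP0.le] at hint
    rw [← ENNReal.ofReal_toReal hP, ← ENNReal.ofReal_toReal hG,
      ← ENNReal.ofReal_mul hC.le, ENNReal.ofReal_rpow_of_pos hP0]
    apply ENNReal.ofReal_le_ofReal
    have e : 2 / sobExp n s = 1 - 2 * s / n := by
      rw [sobExp]
      have : (n : ℝ) - 2 * s ≠ 0 := by linarith
      field_simp
    rw [e, Real.rpow_sub hP0, Real.rpow_one, div_le_iff₀ (by positivity)]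
    linarith

/-- The truncations `min |u| N` satisfy the averaging hypothesis, and their Sobolev integral is
finite because it is at most `N^{p-2} ∫ |u|²`, with `p` the Sobolev exponent. The bound does not
depend on `N`, so Fatou removes the truncation. -/
theorem sobolev_inequality {s : ℝ} (hs0 : 0 < s) (hsn : 2 * s < n) {u : Pt n → ℂ}
    (hu : MemLp u 2) :
    (∫⁻ y, ‖u y‖ₑ ^ sobExp n s) ^ (2 / sobExp n s)
      ≤ ENNReal.ofReal (sobConst n s) * energy (homKernel n s) u := by
  have hp : 2 < sobExp n s := two_lt_sobExp hs0 hsn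
  set R := ENNReal.ofReal (sobConst n s) * energy (homKernel n s) u
  have hN : ∀ N : ℕ, ∫⁻ y, ENNReal.ofReal (min ‖u y‖ N) ^ sobExp n s ≤ R ^ (sobExp n s / 2) := by
    intro N
    have hfin : ∫⁻ y, ENNReal.ofReal (min ‖u y‖ N) ^ sobExp n s ≠ ⊤ := by
      refine ne_top_of_le_ne_top (b := ∫⁻ y, ENNReal.ofReal (N : ℝ) ^ (sobExp n s - 2) *
        ‖u y‖ₑ ^ 2) ?_ (lintegral_mono fun y => ?_)
      · rw [lintegral_const_mul' _ _ (ENNReal.rpow_ne_top_of_nonneg (by linarith)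
          ENNReal.ofReal_ne_top)]
        exact ENNReal.mul_ne_top (ENNReal.rpow_ne_top_of_nonneg (by linarith) ENNReal.ofReal_ne_top)
          (memLp_two_iff.1 hu).2.ne
      · have e : sobExp n s = (sobExp n s - 2) + 2 := by ring
        have e2 : ENNReal.ofReal (min ‖u y‖ N) ^ sobExp n s
            = ENNReal.ofReal (min ‖u y‖ N) ^ (sobExp n s - 2) *
              ENNReal.ofReal (min ‖u y‖ N) ^ (2 : ℝ) := by
          rw [← ENNReal.rpow_add_of_nonneg _ _ (by linarith) (by norm_num), ← e]
        rw [e2, ENNReal.rpow_ofNat, ← ofReal_norm (u y)]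
        gcongr
        · exact min_le_right _ _
        · exact min_le_left _ _
    have h := sobolev_of_finite hs0 hsn hu.1 (w := fun y => min ‖u y‖ N)
      (fun y => le_min (norm_nonneg _) N.cast_nonneg)
      (hu.1.norm.aemeasurable.min aemeasurable_const).aestronglyMeasurable
      (fun x y => ?_) hfin
    · have h2 := ENNReal.rpow_le_rpow h (show 0 ≤ sobExp n s / 2 by positivity)
      rw [← ENNReal.rpow_mul] at h2
      have e : 2 / sobExp n s * (sobExp n s / 2) = 1 := by field_simp
      rwa [e, ENNReal.rpow_one] at h2
    · have h1 : ‖u x‖ ≤ ‖u x - u y‖ + ‖u y‖ := by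
        simpa using norm_add_le (u x - u y) (u y)
      rcases le_total ‖u y‖ (N : ℝ) with h | h
      · rw [min_eq_left h]
        exact (min_le_left _ _).trans h1
      · rw [min_eq_right h]
        exact (min_le_right _ _).trans (by linarith [norm_nonneg (u x - u y)])
  have hfatou : ∫⁻ y, ‖u y‖ₑ ^ sobExp n s ≤ R ^ (sobExp n s / 2) := by
    calc ∫⁻ y, ‖u y‖ₑ ^ sobExp n s
        = ∫⁻ y, liminf (fun N : ℕ => ENNReal.ofReal (min ‖u y‖ N) ^ sobExp n s) atTop := by
          refine lintegral_congr fun y => ?_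
          refine (Tendsto.liminf_eq ?_).symm
          refine tendsto_const_nhds.congr' ?_
          filter_upwards [tendsto_natCast_atTop_atTop.eventually_ge_atTop ‖u y‖] with N hN
          rw [min_eq_left hN, ofReal_norm]
      _ ≤ liminf (fun N : ℕ => ∫⁻ y, ENNReal.ofReal (min ‖u y‖ N) ^ sobExp n s) atTop :=
          lintegral_liminf_le' fun N =>
            ((hu.1.norm.aemeasurable.min aemeasurable_const).ennreal_ofReal).pow_const _
      _ ≤ R ^ (sobExp n s / 2) := by
          refine liminf_le_of_le (by isBoundedDefault) fun b hb => ?_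
          obtain ⟨N, hN'⟩ := hb.exists
          exact hN'.trans (hN N)
  refine (ENNReal.rpow_le_rpow hfatou (by positivity)).trans (le_of_eq ?_)
  rw [← ENNReal.rpow_mul]
  have e : sobExp n s / 2 * (2 / sobExp n s) = 1 := by field_simp
  rw [e, ENNReal.rpow_one]

end

section

variable {n : ℕ} {s : ℝ}

open FourierTransform

/-! ### The bilinear form of the Bessel operator -/

/-- The measure with density `besselKernel`. -/
def besselMeasure (n : ℕ) (s : ℝ) : Measure (Pt n) := volume.withDensity (besselKernel n s)

instance : SFinite (besselMeasure n s) := by unfold besselMeasure; infer_instance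

theorem besselMeasure_ac : besselMeasure n s ≪ volume := withDensity_absolutelyContinuous _ _

theorem besselMeasure_prod_ac :
    (besselMeasure n s).prod (volume : Measure (Pt n)) ≪ volume.prod volume :=
  besselMeasure_ac.prod Measure.AbsolutelyContinuous.rfl

theorem lintegral_besselMeasure_prod {F : Pt n × Pt n → ℝ≥0∞}
    (hF : AEMeasurable F (volume.prod volume)) :
    ∫⁻ p, F p ∂((besselMeasure n s).prod volume)
      = ∫⁻ z, (∫⁻ x, F (z, x)) * besselKernel n s z := by
  rw [lintegral_prod _ (hF.mono_ac besselMeasure_prod_ac), besselMeasure,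
    lintegral_withDensity_eq_lintegral_mul₀ (measurable_besselKernel n s).aemeasurable
      hF.lintegral_prod_right']
  refine lintegral_congr fun z => ?_
  rw [Pi.mul_apply, mul_comm]

/-- The function `(z, x) ↦ u (x + z) - u x`. -/
def diffq {E : Type*} [Sub E] (u : Pt n → E) (p : Pt n × Pt n) : E := u (p.2 + p.1) - u p.2

theorem aestronglyMeasurable_add_swap {E : Type*} [TopologicalSpace E] {u : Pt n → E}
    (hu : AEStronglyMeasurable u) :
    AEStronglyMeasurable (fun p : Pt n × Pt n => u (p.2 + p.1)) (volume.prod volume) := by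
  simpa only [add_comm] using aestronglyMeasurable_comp_add hu

theorem aestronglyMeasurable_diffq {E : Type*} [NormedAddCommGroup E] {u : Pt n → E}
    (hu : AEStronglyMeasurable u) :
    AEStronglyMeasurable (diffq u) (volume.prod volume) :=
  (aestronglyMeasurable_add_swap hu).sub hu.comp_snd

theorem lintegral_diffq_sq {u : Pt n → ℂ} (hu : AEStronglyMeasurable u) :
    ∫⁻ p, ‖diffq u p‖ₑ ^ 2 ∂((besselMeasure n s).prod volume) = energy (besselKernel n s) u := by
  rw [lintegral_besselMeasure_prod ((aestronglyMeasurable_diffq hu).enorm.pow_const 2),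
    energy_eq_lintegral_shift (measurable_besselKernel n s) hu]
  rfl

theorem memLp_diffq {u : Pt n → ℂ} (hu : AEStronglyMeasurable u)
    (h : energy (besselKernel n s) u < ⊤) :
    MemLp (diffq u) 2 ((besselMeasure n s).prod volume) :=
  memLp_two_iff.2 ⟨(aestronglyMeasurable_diffq hu).mono_ac besselMeasure_prod_ac, by
    rwa [lintegral_diffq_sq hu]⟩

theorem memH_schwartz (φ : 𝓢(Pt n, ℂ)) : MemH s φ := by
  refine ⟨⟨one_le_two⟩, _, fun ψ => ⟨?_, ?_⟩, φ.memSobolev⟩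
  · exact memLp_one_iff_integrable.1 ((φ.memLp 2).smul (ψ.memLp 2) : MemLp (⇑ψ • ⇑φ) 1 volume)
  · exact SchwartzMap.toTemperedDistributionCLM_apply_apply volume φ ψ

theorem energy_schwartz_lt_top (hs0 : 0 < s) (hs1 : s < 1) (φ : 𝓢(Pt n, ℂ)) :
    energy (besselKernel n s) φ < ⊤ :=
  lt_of_le_of_lt le_self_add ((memH_iff hs0 hs1).1 (memH_schwartz φ)).2

/-- The (transposed) Bessel operator of order `r` on Schwartz functions. -/
def besselOp (r : ℝ) (φ : 𝓢(Pt n, ℂ)) : 𝓢(Pt n, ℂ) :=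
  𝓕 (SchwartzMap.smulLeftCLM ℂ (bracket r) (𝓕⁻ φ))

theorem besselOp_schwartzShift (r : ℝ) (z : Pt n) (φ : 𝓢(Pt n, ℂ)) :
    besselOp r (schwartzShift z φ) = schwartzShift z (besselOp r φ) := by
  have h : 𝓕⁻ (besselOp r (schwartzShift z φ)) = 𝓕⁻ (schwartzShift z (besselOp r φ)) := by
    ext ξ
    rw [fourierInv_schwartzShift, besselOp, besselOp, fourierInv_fourier_eq,
      fourierInv_fourier_eq, SchwartzMap.smulLeftCLM_apply_apply (hasTemperateGrowth_bracket r),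
      SchwartzMap.smulLeftCLM_apply_apply (hasTemperateGrowth_bracket r),
      fourierInv_schwartzShift]
    simp only [smul_eq_mul]
    ring
  have := congrArg 𝓕 h
  rwa [fourier_fourierInv_eq, fourier_fourierInv_eq] at this

/-- Parseval without conjugation, hence `𝓕` on one factor and `𝓕⁻` on the other. The resulting
character factors are conjugate and multiply to `2(1 - cos)`. -/
theorem integral_diff_mul_diff (z : Pt n) (f g : 𝓢(Pt n, ℂ)) :
    ∫ x, (f (x + z) - f x) * (g (x + z) - g x)
      = ∫ ξ, ((2 * (1 - Real.cos (2 * Real.pi * inner ℝ z ξ)) : ℝ) : ℂ) * (𝓕 f ξ * 𝓕⁻ g ξ) := by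
  have h := SchwartzMap.integral_fourier_mul_eq (schwartzShift z f - f)
    (𝓕⁻ (schwartzShift z g - g))
  rw [fourier_fourierInv_eq] at h
  have h1 : ∫ x, (f (x + z) - f x) * (g (x + z) - g x)
      = ∫ x, (schwartzShift z f - f) x * (schwartzShift z g - g) x := by
    simp
  rw [h1, ← h]
  refine integral_congr_ae (Eventually.of_forall fun ξ => ?_)
  have h2 : 𝓕 (schwartzShift z f - f) = 𝓕 (schwartzShift z f) - 𝓕 f :=
    map_sub (FourierTransform.fourierCLE ℂ 𝓢(Pt n, ℂ)) _ _
  have h3 : 𝓕⁻ (schwartzShift z g - g) = 𝓕⁻ (schwartzShift z g) - 𝓕⁻ g :=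
    map_sub (FourierTransform.fourierCLE ℂ 𝓢(Pt n, ℂ)).symm _ _
  simp only [h2, h3, sub_apply, fourier_schwartzShift, fourierInv_schwartzShift]
  rw [← character_sub_one_mul]
  ring

theorem integrable_diffq_mul (hs0 : 0 < s) (hs1 : s < 1) (f g : 𝓢(Pt n, ℂ)) :
    Integrable (fun p => diffq f p * diffq g p) ((besselMeasure n s).prod volume) :=
  MemLp.integrable_mul (memLp_diffq f.continuous.aestronglyMeasurable
    (energy_schwartz_lt_top hs0 hs1 f)) (memLp_diffq g.continuous.aestronglyMeasurable
    (energy_schwartz_lt_top hs0 hs1 g))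

theorem integral_one_sub_cos_besselMeasure (hs0 : 0 < s) (hs1 : s < 1) (ξ : Pt n) :
    ∫ z, ((2 * (1 - Real.cos (2 * Real.pi * inner ℝ z ξ)) : ℝ) : ℂ) ∂besselMeasure n s
      = ((2 * besselConst n s * ((1 + ‖ξ‖ ^ 2) ^ s - 1) : ℝ) : ℂ) := by
  have hc := besselConst_pos n hs0 hs1
  have hb : 0 ≤ (1 + ‖ξ‖ ^ 2) ^ s - 1 := by
    have : 1 ≤ (1 + ‖ξ‖ ^ 2) ^ s := Real.one_le_rpow (by simp) hs0.le
    linarith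
  rw [integral_complex_ofReal, integral_const_mul, integral_eq_lintegral_of_nonneg_ae]
  · rw [besselMeasure, lintegral_withDensity_eq_lintegral_mul _ (measurable_besselKernel n s)
      (by fun_prop)]
    simp only [Pi.mul_apply]
    have : ∫⁻ z : Pt n, besselKernel n s z *
        ENNReal.ofReal (1 - Real.cos (2 * Real.pi * inner ℝ z ξ))
        = ENNReal.ofReal (besselConst n s * ((1 + ‖ξ‖ ^ 2) ^ s - 1)) := by
      rw [← lintegral_one_sub_cos_mul_besselKernel n hs0 hs1]
      exact lintegral_congr fun z => mul_comm _ _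
    rw [this, ENNReal.toReal_ofReal (by positivity), mul_assoc]
  · exact Eventually.of_forall fun z => sub_nonneg.2 (Real.cos_le_one _)
  · exact Continuous.aestronglyMeasurable (by fun_prop)

/-- The polarized form of the energy identity: `k` is the kernel of `J^{2s} - 1` up to the constant.
It transfers difference quotients to the Bessel operator, through which the `W^{2s, n/2s}`
hypothesis enters. -/
theorem integral_diffq_mul (hs0 : 0 < s) (hs1 : s < 1) (f g : 𝓢(Pt n, ℂ)) :
    ∫ p, diffq f p * diffq g p ∂((besselMeasure n s).prod volume)
      = 2 * besselConst n s * ((∫ x, f x * besselOp (2 * s) g x) - ∫ x, f x * g x) := by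
  have hc := besselConst_pos n hs0 hs1
  rw [integral_prod _ (integrable_diffq_mul hs0 hs1 f g)]
  simp only [diffq, integral_diff_mul_diff]
  set w : Pt n → ℂ := bracket (2 * s) with hw
  have hwt := hasTemperateGrowth_bracket (n := n) (2 * s)
  have hwr : ∀ ξ : Pt n, w ξ = (((1 + ‖ξ‖ ^ 2) ^ s : ℝ) : ℂ) := fun ξ => by
    rw [hw, bracket, mul_div_cancel_left₀ _ two_ne_zero]
  have hH : Integrable (fun ξ => 𝓕 f ξ * 𝓕⁻ g ξ) :=
    MemLp.integrable_mul ((𝓕 f).memLp 2) ((𝓕⁻ g).memLp 2)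
  have hwH : Integrable (fun ξ => w ξ * (𝓕 f ξ * 𝓕⁻ g ξ)) := by
    have h := MemLp.integrable_mul ((𝓕 f).memLp 2 volume)
      ((SchwartzMap.smulLeftCLM ℂ w (𝓕⁻ g)).memLp 2 volume)
    refine h.congr (Eventually.of_forall fun ξ => ?_)
    simp only [Pi.mul_apply]
    rw [SchwartzMap.smulLeftCLM_apply_apply hwt, smul_eq_mul]
    ring
  have hcont : Continuous fun p : Pt n × Pt n =>
      ((2 * (1 - Real.cos (2 * Real.pi * inner ℝ p.1 p.2)) : ℝ) : ℂ) * (𝓕 f p.2 * 𝓕⁻ g p.2) := by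
    have h1 := (𝓕 f).continuous
    have h2 := (𝓕⁻ g).continuous
    fun_prop
  have hi : Integrable (fun p : Pt n × Pt n =>
      ((2 * (1 - Real.cos (2 * Real.pi * inner ℝ p.1 p.2)) : ℝ) : ℂ) * (𝓕 f p.2 * 𝓕⁻ g p.2))
      ((besselMeasure n s).prod volume) := by
    refine ⟨hcont.aestronglyMeasurable, ?_⟩
    rw [hasFiniteIntegral_iff_enorm, lintegral_besselMeasure_prod
      (hcont.enorm.measurable.aemeasurable)]
    have hk := measurable_besselKernel n s
    have e1 : ∀ z : Pt n, (∫⁻ ξ, ‖((2 * (1 - Real.cos (2 * Real.pi * inner ℝ z ξ)) : ℝ) : ℂ) *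
        (𝓕 f ξ * 𝓕⁻ g ξ)‖ₑ) * besselKernel n s z
        = ∫⁻ ξ, 2 * (ENNReal.ofReal (1 - Real.cos (2 * Real.pi * inner ℝ z ξ)) *
          besselKernel n s z) * ‖𝓕 f ξ * 𝓕⁻ g ξ‖ₑ := by
      intro z
      have hm : Measurable fun ξ => ‖((2 * (1 - Real.cos (2 * Real.pi * inner ℝ z ξ)) : ℝ) : ℂ) *
        (𝓕 f ξ * 𝓕⁻ g ξ)‖ₑ := (hcont.comp (Continuous.prodMk_right z)).enorm.measurable
      rw [← lintegral_mul_const _ hm]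
      refine lintegral_congr fun ξ => ?_
      rw [enorm_mul, ← ofReal_norm ((_ : ℝ) : ℂ), Complex.norm_real, Real.norm_of_nonneg
        (by linarith [Real.cos_le_one (2 * Real.pi * inner ℝ z ξ)]),
        ENNReal.ofReal_mul (by norm_num), ENNReal.ofReal_ofNat]
      ring
    simp_rw [e1]
    rw [lintegral_lintegral_swap]
    -- Fubini is legitimate because the integral in `z` is at most a multiple of `⟨ξ⟩^{2s}`, which
    -- the Schwartz factors absorb.
    · have e2 : ∀ ξ : Pt n, ∫⁻ z, 2 * (ENNReal.ofReal (1 - Real.cos (2 * Real.pi * inner ℝ z ξ)) *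
          besselKernel n s z) * ‖𝓕 f ξ * 𝓕⁻ g ξ‖ₑ
          ≤ ENNReal.ofReal (2 * besselConst n s) * ‖w ξ * (𝓕 f ξ * 𝓕⁻ g ξ)‖ₑ := by
        intro ξ
        rw [lintegral_mul_const _ (by fun_prop), lintegral_const_mul _ (by fun_prop),
          lintegral_one_sub_cos_mul_besselKernel n hs0 hs1, enorm_mul (w ξ), ← mul_assoc]
        refine mul_le_mul_left ?_ _
        rw [hwr, ← ofReal_norm ((_ : ℝ) : ℂ), Complex.norm_real, Real.norm_of_nonneg (by positivity),
          ← ENNReal.ofReal_mul (by positivity)]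
        have e0 : ∀ c : ℝ, 2 * ENNReal.ofReal c = ENNReal.ofReal (2 * c) := fun c => by
          rw [ENNReal.ofReal_mul (by norm_num), ENNReal.ofReal_ofNat]
        rw [e0]
        apply ENNReal.ofReal_le_ofReal
        nlinarith
      refine lt_of_le_of_lt (lintegral_mono e2) ?_
      rw [lintegral_const_mul' _ _ ENNReal.ofReal_ne_top]
      exact ENNReal.mul_lt_top ENNReal.ofReal_lt_top hwH.2
    · refine Measurable.aemeasurable (Measurable.mul (by fun_prop) ?_)
      have h1 := (𝓕 f).continuous.measurable
      have h2 := (𝓕⁻ g).continuous.measurable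
      fun_prop
  rw [integral_integral_swap hi]
  have e3 : ∀ ξ : Pt n, ∫ z, ((2 * (1 - Real.cos (2 * Real.pi * inner ℝ z ξ)) : ℝ) : ℂ) *
      (𝓕 f ξ * 𝓕⁻ g ξ) ∂besselMeasure n s
      = 2 * besselConst n s * (w ξ * (𝓕 f ξ * 𝓕⁻ g ξ) - 𝓕 f ξ * 𝓕⁻ g ξ) := by
    intro ξ
    rw [integral_mul_const, integral_one_sub_cos_besselMeasure hs0 hs1, hwr]
    push_cast
    ring
  simp_rw [e3]
  rw [integral_const_mul, integral_sub hwH hH]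
  congr 2
  · have h := SchwartzMap.integral_fourier_mul_eq f (SchwartzMap.smulLeftCLM ℂ w (𝓕⁻ g))
    rw [besselOp, ← h]
    refine integral_congr_ae (Eventually.of_forall fun ξ => ?_)
    simp only
    rw [SchwartzMap.smulLeftCLM_apply_apply hwt, smul_eq_mul]
    ring
  · have h := SchwartzMap.integral_fourier_mul_eq f (𝓕⁻ g)
    rwa [fourier_fourierInv_eq] at h

end

section

variable {n : ℕ} {s : ℝ}

/-! ### Comparison of the kernels -/

/-- The tail of `homKernel`. -/
def tailKernel (n : ℕ) (s : ℝ) : Pt n → ℝ≥0∞ :=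
  Set.indicator {z | 1 < ‖z‖} (homKernel n s)

theorem measurable_tailKernel (n : ℕ) (s : ℝ) : Measurable (tailKernel n s) :=
  (measurable_homKernel n s).indicator (measurableSet_lt measurable_const measurable_norm)

theorem lintegral_tailKernel_lt_top (n : ℕ) (hs0 : 0 < s) : ∫⁻ z, tailKernel n s z < ⊤ := by
  have hfin := finite_integral_one_add_norm (E := Pt n) (μ := volume) (r := n + 2 * s)
    (by rw [finrank_euclideanSpace, Fintype.card_fin]; linarith)
  refine lt_of_le_of_lt (lintegral_mono (g := fun z => ENNReal.ofReal (2 ^ ((n : ℝ) + 2 * s)) *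
    ENNReal.ofReal ((1 + ‖z‖) ^ (-((n : ℝ) + 2 * s)))) fun z => ?_) ?_
  · rw [tailKernel, Set.indicator_apply]
    split_ifs with h
    · have hz : 1 < ‖z‖ := h
      beta_reduce
      rw [homKernel, ← ENNReal.ofReal_mul (by positivity)]
      apply ENNReal.ofReal_le_ofReal
      rw [Real.rpow_neg (by positivity), Real.rpow_neg (by positivity), ← div_eq_mul_inv,
        ← Real.div_rpow (by norm_num) (by positivity), ← Real.inv_rpow (by positivity)]
      refine Real.rpow_le_rpow (by positivity) ?_ (by positivity)
      rw [inv_le_comm₀ (by positivity) (by positivity), inv_div]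
      linarith
    · exact zero_le
  · rw [lintegral_const_mul' _ _ ENNReal.ofReal_ne_top]
    exact ENNReal.mul_lt_top ENNReal.ofReal_lt_top hfin

/-- Only the singularity at `0` matters for regularity. The tail is integrable, so it costs no more
than an `L²` norm, or a supremum bound on the multiplier in the weighted energy. -/
theorem homKernel_le_add (n : ℕ) (hs0 : 0 < s) (z : Pt n) :
    homKernel n s z ≤ ENNReal.ofReal (2 * Real.exp (1 + 2 * Real.pi ^ 2)) * besselKernel n s z
      + tailKernel n s z := by
  -- At `z = 0` the negative real power takes its default value `0`.
  rcases eq_or_ne z 0 with rfl | hz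
  · rw [homKernel, norm_zero, Real.zero_rpow (by have : (0 : ℝ) ≤ n := n.cast_nonneg; linarith)]
    simp
  · rcases le_or_gt ‖z‖ 1 with h | h
    · exact (homKernel_le n hs0 hz h).trans le_self_add
    · refine le_trans (le_of_eq ?_) le_add_self
      rw [tailKernel, Set.indicator_of_mem]
      exact h

/-- A weighted form of the energy. -/
def crossEnergy (k : Pt n → ℝ≥0∞) (m : Pt n → ℝ) (u : Pt n → ℂ) : ℝ≥0∞ :=
  ∫⁻ x, ∫⁻ y, ‖m x - m y‖ₑ ^ 2 * ‖u x‖ₑ ^ 2 * k (x - y)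

theorem lintegral_weight_shift {k : Pt n → ℝ≥0∞} (hk : Measurable k) {u : Pt n → ℂ}
    (hu : AEStronglyMeasurable u) :
    ∫⁻ x, ∫⁻ y, ‖u x‖ₑ ^ 2 * k (x - y) = (∫⁻ x, ‖u x‖ₑ ^ 2) * ∫⁻ z, k z := by
  have h : ∀ x, ∫⁻ y, ‖u x‖ₑ ^ 2 * k (x - y) = ‖u x‖ₑ ^ 2 * ∫⁻ z, k z := fun x => by
    rw [lintegral_const_mul _ (show Measurable fun y => k (x - y) by fun_prop),
      lintegral_sub_left_eq_self (fun y => k y) x]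
  simp_rw [h]
  rw [lintegral_mul_const'' _ (hu.enorm.pow_const 2)]

theorem crossEnergy_le_of_bounded {k : Pt n → ℝ≥0∞} (hk : Measurable k) {m : Pt n → ℝ} {M : ℝ}
    (hm : ∀ᵐ x, |m x| ≤ M) {u : Pt n → ℂ} (hu : AEStronglyMeasurable u) :
    crossEnergy k m u ≤ ENNReal.ofReal (2 * M) ^ 2 * ((∫⁻ x, ‖u x‖ₑ ^ 2) * ∫⁻ z, k z) := by
  rw [← lintegral_weight_shift hk hu, crossEnergy, ← lintegral_const_mul' _ _ (by finiteness)]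
  refine lintegral_mono_ae ?_
  filter_upwards [hm] with x hx
  rw [← lintegral_const_mul' _ _ (by finiteness)]
  refine lintegral_mono_ae ?_
  filter_upwards [hm] with y hy
  rw [← mul_assoc]
  gcongr
  rw [← ofReal_norm, Real.norm_eq_abs]
  apply ENNReal.ofReal_le_ofReal
  linarith [abs_sub (m x) (m y)]

theorem energy_homKernel_le_add (hs0 : 0 < s) {u : Pt n → ℂ} (hu : AEStronglyMeasurable u) :
    energy (homKernel n s) u ≤
      ENNReal.ofReal (2 * Real.exp (1 + 2 * Real.pi ^ 2)) * energy (besselKernel n s) u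
        + 4 * ((∫⁻ x, ‖u x‖ₑ ^ 2) * ∫⁻ z, tailKernel n s z) := by
  have hk := measurable_besselKernel n s
  have ht := measurable_tailKernel n s
  have hd : AEMeasurable (fun p : Pt n × Pt n => ‖u (p.2 + p.1) - u p.2‖ₑ ^ 2)
      (volume.prod volume) :=
    ((aestronglyMeasurable_add_swap hu).sub hu.comp_snd).enorm.pow_const 2
  have hd' := hd.lintegral_prod_right'
  rw [energy_eq_lintegral_shift (measurable_homKernel n s) hu, energy_eq_lintegral_shift hk hu]
  calc ∫⁻ z, (∫⁻ x, ‖u (x + z) - u x‖ₑ ^ 2) * homKernel n s z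
      ≤ ∫⁻ z, (ENNReal.ofReal (2 * Real.exp (1 + 2 * Real.pi ^ 2)) *
          ((∫⁻ x, ‖u (x + z) - u x‖ₑ ^ 2) * besselKernel n s z)
          + 4 * (∫⁻ x, ‖u x‖ₑ ^ 2) * tailKernel n s z) := by
        refine lintegral_mono fun z => ?_
        refine (mul_le_mul_right (homKernel_le_add n hs0 z) _).trans ?_
        rw [mul_add, mul_left_comm]
        refine add_le_add le_rfl (mul_le_mul_left ?_ _)
        calc ∫⁻ x, ‖u (x + z) - u x‖ₑ ^ 2
            ≤ ∫⁻ x, (2 * ‖u (x + z)‖ₑ ^ 2 + 2 * ‖u x‖ₑ ^ 2) :=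
              lintegral_mono fun x => enorm_sub_sq_le _ _
          _ = 2 * (∫⁻ x, ‖u (x + z)‖ₑ ^ 2) + 2 * ∫⁻ x, ‖u x‖ₑ ^ 2 := by
              rw [lintegral_add_right' _ ((hu.enorm.pow_const 2).const_mul _),
                lintegral_const_mul' _ _ (by simp), lintegral_const_mul' _ _ (by simp)]
          _ = 4 * ∫⁻ x, ‖u x‖ₑ ^ 2 := by
              rw [lintegral_add_right_eq_self (fun x => ‖u x‖ₑ ^ 2) z, ← add_mul]; norm_num
    _ = _ := by
        rw [lintegral_add_right' _ ((ht.const_mul _).aemeasurable),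
          lintegral_const_mul' _ _ ENNReal.ofReal_ne_top, lintegral_const_mul _ ht, mul_assoc]

theorem energy_le_sobSq (u : Pt n → ℂ) : energy (besselKernel n s) u ≤ sobSq s u := le_self_add

theorem lintegral_sq_le_sobSq (hs0 : 0 < s) (hs1 : s < 1) (u : Pt n → ℂ) :
    ∫⁻ x, ‖u x‖ₑ ^ 2 ≤ (ENNReal.ofReal (2 * besselConst n s))⁻¹ * sobSq s u := by
  have hc := besselConst_pos n hs0 hs1
  have h0 : ENNReal.ofReal (2 * besselConst n s) ≠ 0 := by
    rw [Ne, ENNReal.ofReal_eq_zero, not_le]; positivity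
  calc ∫⁻ x, ‖u x‖ₑ ^ 2 = (ENNReal.ofReal (2 * besselConst n s))⁻¹ *
        (ENNReal.ofReal (2 * besselConst n s) * ∫⁻ x, ‖u x‖ₑ ^ 2) := by
        rw [← mul_assoc, ENNReal.inv_mul_cancel h0 ENNReal.ofReal_ne_top, one_mul]
    _ ≤ _ := mul_le_mul_right le_add_self _

theorem exists_energy_homKernel_le (n : ℕ) (hs0 : 0 < s) (hs1 : s < 1) :
    ∃ C : ℝ≥0∞, C ≠ ⊤ ∧ ∀ u : Pt n → ℂ, AEStronglyMeasurable u →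
      energy (homKernel n s) u ≤ C * sobSq s u := by
  have hc := besselConst_pos n hs0 hs1
  have h0 : ENNReal.ofReal (2 * besselConst n s) ≠ 0 := by
    rw [Ne, ENNReal.ofReal_eq_zero, not_le]; positivity
  have ht := lintegral_tailKernel_lt_top n hs0
  refine ⟨ENNReal.ofReal (2 * Real.exp (1 + 2 * Real.pi ^ 2)) +
    4 * ((ENNReal.ofReal (2 * besselConst n s))⁻¹ * ∫⁻ z, tailKernel n s z), ?_, fun u hu => ?_⟩
  · have := ENNReal.inv_ne_top.2 h0
    exact ENNReal.add_ne_top.2 ⟨ENNReal.ofReal_ne_top, ENNReal.mul_ne_top (by simp)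
      (ENNReal.mul_ne_top this ht.ne)⟩
  · refine (energy_homKernel_le_add hs0 hu).trans ?_
    rw [add_mul]
    refine add_le_add (mul_le_mul_right (energy_le_sobSq u) _) ?_
    calc 4 * ((∫⁻ x, ‖u x‖ₑ ^ 2) * ∫⁻ z, tailKernel n s z)
        ≤ 4 * (((ENNReal.ofReal (2 * besselConst n s))⁻¹ * sobSq s u) *
            ∫⁻ z, tailKernel n s z) :=
          mul_le_mul_right (mul_le_mul_left (lintegral_sq_le_sobSq hs0 hs1 u) _) _
      _ = _ := by ring

theorem exists_sobolev_le (hs0 : 0 < s) (hs1 : s < 1) (hsn : 2 * s < n) :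
    ∃ C : ℝ≥0∞, C ≠ ⊤ ∧ ∀ u : Pt n → ℂ, MemLp u 2 →
      (∫⁻ y, ‖u y‖ₑ ^ sobExp n s) ^ (2 / sobExp n s) ≤ C * sobSq s u := by
  obtain ⟨C, hC, h⟩ := exists_energy_homKernel_le n hs0 hs1
  refine ⟨ENNReal.ofReal (sobConst n s) * C, ENNReal.mul_ne_top ENNReal.ofReal_ne_top hC,
    fun u hu => (sobolev_inequality hs0 hsn hu).trans ?_⟩
  rw [mul_assoc]
  exact mul_le_mul_right (h u hu.1) _

end

section

variable {n : ℕ} {s : ℝ}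

/-! ### The pairing with the Bessel operator -/

/-- `|⟨J^{2s} a, ψ⟩| ≤ C ‖ψ‖` for the norm of `L^{n/(n-2s)}`. -/
def PairBound (s : ℝ) (a : Pt n → ℂ) (C : ℝ≥0∞) : Prop :=
  ∀ ψ : 𝓢(Pt n, ℂ), ‖∫ x, a x * besselOp (2 * s) ψ x‖ₑ
    ≤ C * (∫⁻ x, ‖ψ x‖ₑ ^ (sobExp n s / 2)) ^ (2 / sobExp n s)

/-- The operator is moved onto `a`, where it gives a function in `L^{n/2s}`; Hölder with the
conjugate exponent `n/(n-2s)` concludes. -/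
theorem exists_pairBound (hs0 : 0 < s) (hsn : 2 * s < n) {a : Pt n → ℂ}
    (ha : MemSob (2 * s) (ENNReal.ofReal (n / (2 * s))) a) :
    ∃ C : ℝ≥0∞, C ≠ ⊤ ∧ PairBound s a C := by
  obtain ⟨_, T, hT, h, hh⟩ := ha
  have hq : 0 < (n : ℝ) / (2 * s) := div_pos (by linarith) (by linarith)
  have hfin := lintegral_rpow_enorm_lt_top_of_eLpNorm_lt_top (f := h)
    (by simpa using hq) ENNReal.ofReal_ne_top (Lp.memLp h).2
  rw [ENNReal.toReal_ofReal hq.le] at hfin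
  refine ⟨(∫⁻ x, ‖h x‖ₑ ^ ((n : ℝ) / (2 * s))) ^ (1 / ((n : ℝ) / (2 * s))), by finiteness,
    fun ψ => ?_⟩
  have e1 : ∫ x, a x * besselOp (2 * s) ψ x = ∫ x, ψ x * h x := by
    calc ∫ x, a x * besselOp (2 * s) ψ x = T (besselOp (2 * s) ψ) := by
          rw [(hT _).2]; simp [mul_comm]
      _ = TemperedDistribution.besselPotential (Pt n) ℂ (2 * s) T ψ := by
          rw [TemperedDistribution.besselPotential,
            TemperedDistribution.fourierMultiplierCLM_apply_apply]
          rfl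
      _ = _ := by
          rw [hh, Lp.toTemperedDistribution_apply]
          rfl
  have hconj : ((n : ℝ) / (2 * s)).HolderConjugate (sobExp n s / 2) := by
    have h1 : (n : ℝ) - 2 * s ≠ 0 := by linarith
    have h2 : (n : ℝ) ≠ 0 := by linarith
    refine ⟨?_, hq, by linarith [two_lt_sobExp hs0 hsn]⟩
    rw [sobExp]
    field_simp
    ring
  rw [e1]
  calc ‖∫ x, ψ x * h x‖ₑ ≤ ∫⁻ x, ‖ψ x * h x‖ₑ := enorm_integral_le_lintegral_enorm _
    _ = ∫⁻ x, ((fun x => ‖h x‖ₑ) * fun x => ‖ψ x‖ₑ) x :=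
        lintegral_congr fun x => by rw [enorm_mul, mul_comm]; rfl
    _ ≤ _ := ENNReal.lintegral_mul_le_Lp_mul_Lq volume hconj
        (Lp.aestronglyMeasurable h).enorm ψ.continuous.aestronglyMeasurable.enorm
    _ = _ := by rw [one_div_div (sobExp n s) 2]

/-- Since `besselOp` commutes with translations, the pairing with the mollified function is an
average of pairings of `a` with translates of `ψ`, whose norms all agree. The constant is therefore
unchanged. Boundedness of `a` justifies Fubini. -/
theorem PairBound.moll (j : ℕ) {a : Pt n → ℂ} {C : ℝ≥0∞} (h : PairBound s a C)
    (ha : AEStronglyMeasurable a) {M : ℝ} (hM : ∀ᵐ x, ‖a x‖ ≤ M) :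
    PairBound s (moll j a) C := by
  intro ψ
  set Ψ := besselOp (2 * s) ψ
  have hac : (volume : Measure (Pt n)).prod (bumpMeasure n j) ≪ volume.prod volume :=
    Measure.AbsolutelyContinuous.rfl.prod (bumpMeasure_ac n j)
  have hi : Integrable (fun p : Pt n × Pt n => a (p.1 - p.2) * Ψ p.1)
      (volume.prod (bumpMeasure n j)) := by
    refine Integrable.bdd_mul (c := M) (Ψ.integrable.comp_fst _) ?_ ?_
    · exact (aestronglyMeasurable_comp_sub ha).mono_ac hac
    · exact hac.ae_le ((quasiMeasurePreserving_sub volume volume).ae hM)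
  have e1 : ∫ x, FMCE.moll j a x * Ψ x
      = ∫ z, (∫ x, a x * besselOp (2 * s) (schwartzShift z ψ) x) ∂bumpMeasure n j := by
    simp_rw [FMCE.moll, ← integral_mul_const]
    rw [integral_integral_swap hi]
    refine integral_congr_ae (Eventually.of_forall fun z => ?_)
    simp only [besselOp_schwartzShift, schwartzShift_apply]
    rw [← integral_add_right_eq_self (fun x => a (x - z) * Ψ x) z]
    simp [Ψ]
  rw [e1]
  refine (enorm_integral_le_lintegral_enorm _).trans ?_
  refine (lintegral_mono (g := fun _ => C * (∫⁻ x, ‖ψ x‖ₑ ^ (sobExp n s / 2)) ^ (2 / sobExp n s))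
    fun z => (h _).trans_eq ?_).trans_eq (by simp)
  simp only [schwartzShift_apply]
  rw [lintegral_add_right_eq_self (fun x => ‖ψ x‖ₑ ^ (sobExp n s / 2)) z]

/-! ### A Caccioppoli inequality -/

/-- With `p = |v|`, `r = |w|`, one has `ap² - br² = (a-b)(p²+r²)/2 + (a+b)(p²-r²)/2`. The cross term
`(a-b)(p+r) · (a+b)(p-r)/2` is split by Young: one part uses up half of the good term, the other is
at most `2M²|v-w|²`. -/
theorem weighted_sq_sub_le {a b M : ℝ} (ha : |a| ≤ M) (hb : |b| ≤ M) (v w : ℂ) :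
    (a - b) ^ 2 * (‖v‖ ^ 2 + ‖w‖ ^ 2) / 4
      ≤ (a - b) * (a * ‖v‖ ^ 2 - b * ‖w‖ ^ 2) + 2 * M ^ 2 * ‖v - w‖ ^ 2 := by
  have h1 : |‖v‖ - ‖w‖| ≤ ‖v - w‖ := abs_norm_sub_norm_le v w
  have h2 : |a + b| ≤ 2 * M := by
    rw [abs_le] at *
    constructor <;> linarith [ha.1, ha.2, hb.1, hb.2]
  set p := ‖v‖
  set r := ‖w‖
  set d := ‖v - w‖
  have hd : (p - r) ^ 2 ≤ d ^ 2 := sq_le_sq' (by linarith [abs_le.1 h1]) (by linarith [abs_le.1 h1])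
  have hab : (a + b) ^ 2 ≤ 4 * M ^ 2 := by
    have := sq_le_sq' (by linarith [abs_le.1 h2]) (abs_le.1 h2).2
    linarith
  have h3 : (a + b) ^ 2 * (p - r) ^ 2 ≤ 4 * M ^ 2 * d ^ 2 := by gcongr
  nlinarith [sq_nonneg ((a - b) * (p + r) / 2 + (a + b) * (p - r)),
    mul_nonneg (sq_nonneg (a - b)) (sq_nonneg (p - r))]

end

/-! ### The Caccioppoli inequality for smooth functions. -/

section

variable {n : ℕ} {s : ℝ}

theorem exists_schwartz_ofReal {a : Pt n → ℝ} (ha : ContDiff ℝ ∞ a) (hac : HasCompactSupport a) :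
    ∃ φ : 𝓢(Pt n, ℂ), ∀ x, φ x = (a x : ℂ) :=
  exists_schwartz (f := fun x => (a x : ℂ)) (Complex.ofRealCLM.contDiff.comp ha)
    (hac.comp_left (g := fun x : ℝ => (x : ℂ)) Complex.ofReal_zero)

theorem hasCompactSupport_mul_norm_sq {a : Pt n → ℝ} (hac : HasCompactSupport a) (v : Pt n → ℂ) :
    HasCompactSupport fun x => a x * ‖v x‖ ^ 2 :=
  hac.mono fun x hx => by
    rw [Function.mem_support] at hx ⊢
    exact left_ne_zero_of_mul hx

/-- The operator is applied to `a` and tested against `φ = a|v|²`; smoothness and compact support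
make both Schwartz. The algebraic inequality bounds the weighted energy by this bilinear form plus
`2M²` times the energy of `v`. The form equals `2c(⟨a, J^{2s}φ⟩ - ⟨a, φ⟩)`, where `PairBound` and
Sobolev control the first pairing and the supremum bound the second. The constant depends on `a`
only through `M` and `C`, so that it survives mollification. -/
theorem exists_caccioppoli_smooth (hs0 : 0 < s) (hs1 : s < 1) (hsn : 2 * s < n) {M : ℝ}
    (hM0 : 0 ≤ M) {C : ℝ≥0∞} (hC : C ≠ ⊤) :
    ∃ D : ℝ≥0∞, D ≠ ⊤ ∧ ∀ (a : Pt n → ℝ) (v : Pt n → ℂ), ContDiff ℝ ∞ a → HasCompactSupport a →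
      (∀ x, |a x| ≤ M) → PairBound s (fun x => (a x : ℂ)) C → ContDiff ℝ ∞ v → MemLp v 2 →
      sobSq s v < ⊤ →
      ∫⁻ p, ENNReal.ofReal ((diffq a p) ^ 2 * (‖v (p.2 + p.1)‖ ^ 2 + ‖v p.2‖ ^ 2) / 4)
        ∂((besselMeasure n s).prod volume) ≤ D * sobSq s v := by
  obtain ⟨S, hS, hSob⟩ := exists_sobolev_le (n := n) hs0 hs1 hsn
  have hc := besselConst_pos n hs0 hs1
  have h0 : ENNReal.ofReal (2 * besselConst n s) ≠ 0 := by
    rw [Ne, ENNReal.ofReal_eq_zero, not_le]; positivity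
  have hσ := two_lt_sobExp hs0 hsn
  have hinv := ENNReal.inv_ne_top.2 h0
  refine ⟨ENNReal.ofReal (2 * besselConst n s) * (C * (ENNReal.ofReal M * S) +
    ENNReal.ofReal M ^ 2 * (ENNReal.ofReal (2 * besselConst n s))⁻¹) +
    ENNReal.ofReal (2 * M ^ 2), by finiteness, ?_⟩
  intro a v ha hac haM hpb hv hv2 hvs
  obtain ⟨f, hf⟩ := exists_schwartz_ofReal ha hac
  obtain ⟨φ, hφ⟩ := exists_schwartz_ofReal (ha.mul (hv.norm_sq ℝ))
    (hasCompactSupport_mul_norm_sq hac v)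
  have hven : energy (besselKernel n s) v < ⊤ := (energy_le_sobSq v).trans_lt hvs
  have hi := integrable_diffq_mul hs0 hs1 f φ
  have hire : Integrable (fun p => (diffq f p * diffq φ p).re)
      ((besselMeasure n s).prod volume) := hi.re
  have hid := memLp_diffq hv2.1 hven
  have hie : Integrable (fun p => 2 * M ^ 2 * ‖diffq v p‖ ^ 2)
      ((besselMeasure n s).prod volume) := by
    have := hid.integrable_norm_pow two_ne_zero
    exact Integrable.const_mul this _
  have hpt : ∀ p : Pt n × Pt n, (diffq a p) ^ 2 * (‖v (p.2 + p.1)‖ ^ 2 + ‖v p.2‖ ^ 2) / 4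
      ≤ (diffq f p * diffq φ p).re + 2 * M ^ 2 * ‖diffq v p‖ ^ 2 := by
    intro p
    refine (weighted_sq_sub_le (haM _) (haM _) _ _).trans_eq ?_
    rw [diffq, diffq, hf, hf, hφ, hφ]
    norm_cast
  have hnn : ∀ p : Pt n × Pt n,
      0 ≤ (diffq a p) ^ 2 * (‖v (p.2 + p.1)‖ ^ 2 + ‖v p.2‖ ^ 2) / 4 := fun p => by positivity
  have hfa : ‖∫ x, f x * φ x‖ₑ ≤ ENNReal.ofReal M ^ 2 * ∫⁻ x, ‖v x‖ₑ ^ 2 := by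
    rw [← lintegral_const_mul' _ _ (by finiteness)]
    refine (enorm_integral_le_lintegral_enorm _).trans (lintegral_mono fun x => ?_)
    rw [hf, hφ, enorm_mul, ← ofReal_norm, ← ofReal_norm ((_ : ℝ) : ℂ), ← ofReal_norm (v x),
      ← ENNReal.ofReal_mul (by positivity), ← ENNReal.ofReal_pow (by positivity),
      ← ENNReal.ofReal_pow (by positivity), ← ENNReal.ofReal_mul (by positivity)]
    apply ENNReal.ofReal_le_ofReal
    rw [Complex.norm_real, Complex.norm_real, norm_mul, norm_pow, norm_norm, Real.norm_eq_abs,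
      ← mul_assoc, sq M]
    gcongr <;> exact haM x
  -- Since `|φ| ≤ M|v|²`, its norm with half the Sobolev exponent is the square of the Sobolev norm
  -- of `v`, up to the factor `M`.
  have hφσ : (∫⁻ x, ‖φ x‖ₑ ^ (sobExp n s / 2)) ^ (2 / sobExp n s)
      ≤ ENNReal.ofReal M * (S * sobSq s v) := by
    have e : ∀ x, ‖φ x‖ₑ ^ (sobExp n s / 2)
        ≤ ENNReal.ofReal M ^ (sobExp n s / 2) * ‖v x‖ₑ ^ sobExp n s := by
      intro x
      have e1 : ‖φ x‖ₑ ≤ ENNReal.ofReal M * ‖v x‖ₑ ^ (2 : ℝ) := by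
        rw [hφ, ← ofReal_norm, ← ofReal_norm (v x), ENNReal.ofReal_rpow_of_nonneg (by positivity)
          (by norm_num), ← ENNReal.ofReal_mul (by positivity)]
        apply ENNReal.ofReal_le_ofReal
        rw [Complex.norm_real, norm_mul, norm_pow, norm_norm, Real.norm_eq_abs, Real.rpow_two]
        gcongr
        exact haM x
      refine (ENNReal.rpow_le_rpow e1 (by linarith)).trans_eq ?_
      rw [ENNReal.mul_rpow_of_nonneg _ _ (by linarith), ← ENNReal.rpow_mul]
      congr 2
      ring
    calc (∫⁻ x, ‖φ x‖ₑ ^ (sobExp n s / 2)) ^ (2 / sobExp n s)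
        ≤ (ENNReal.ofReal M ^ (sobExp n s / 2) * ∫⁻ x, ‖v x‖ₑ ^ sobExp n s) ^ (2 / sobExp n s) := by
          rw [← lintegral_const_mul' _ _ (by finiteness)]
          exact ENNReal.rpow_le_rpow (lintegral_mono e) (by positivity)
      _ = ENNReal.ofReal M * (∫⁻ x, ‖v x‖ₑ ^ sobExp n s) ^ (2 / sobExp n s) := by
          rw [ENNReal.mul_rpow_of_nonneg _ _ (by positivity), ← ENNReal.rpow_mul,
            div_mul_div_cancel₀ (by positivity), div_self (by positivity), ENNReal.rpow_one]
      _ ≤ _ := by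
          gcongr
          exact hSob v hv2
  have hpair : ‖∫ x, f x * besselOp (2 * s) φ x‖ₑ
      ≤ C * (ENNReal.ofReal M * (S * sobSq s v)) := by
    have := hpb φ
    simp_rw [← hf] at this
    exact this.trans (mul_le_mul_right hφσ _)
  have hB : ‖∫ p, diffq f p * diffq φ p ∂((besselMeasure n s).prod volume)‖ₑ ≤
      ENNReal.ofReal (2 * besselConst n s) * (C * (ENNReal.ofReal M * S) +
    ENNReal.ofReal M ^ 2 * (ENNReal.ofReal (2 * besselConst n s))⁻¹) * sobSq s v := by
    rw [integral_diffq_mul hs0 hs1, enorm_mul]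
    have e2 : ‖(2 * besselConst n s : ℂ)‖ₑ = ENNReal.ofReal (2 * besselConst n s) := by
      rw [← ofReal_norm]
      congr 1
      rw [norm_mul, Complex.norm_real, Real.norm_of_nonneg hc.le]
      simp
    rw [e2, mul_assoc]
    gcongr
    refine (enorm_sub_le).trans ((add_le_add hpair (hfa.trans
      (mul_le_mul_right (lintegral_sq_le_sobSq hs0 hs1 v) _))).trans_eq ?_)
    ring
  calc ∫⁻ p, ENNReal.ofReal ((diffq a p) ^ 2 * (‖v (p.2 + p.1)‖ ^ 2 + ‖v p.2‖ ^ 2) / 4)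
        ∂((besselMeasure n s).prod volume)
      ≤ ∫⁻ p, ENNReal.ofReal ((diffq f p * diffq φ p).re + 2 * M ^ 2 * ‖diffq v p‖ ^ 2)
        ∂((besselMeasure n s).prod volume) :=
        lintegral_mono fun p => ENNReal.ofReal_le_ofReal (hpt p)
    _ = ENNReal.ofReal (∫ p, ((diffq f p * diffq φ p).re + 2 * M ^ 2 * ‖diffq v p‖ ^ 2)
        ∂((besselMeasure n s).prod volume)) :=
        (ofReal_integral_eq_lintegral_ofReal (hire.add hie)
          (Eventually.of_forall fun p => (hnn p).trans (hpt p))).symm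
    _ = ENNReal.ofReal ((∫ p, (diffq f p * diffq φ p).re ∂((besselMeasure n s).prod volume))
        + ∫ p, 2 * M ^ 2 * ‖diffq v p‖ ^ 2 ∂((besselMeasure n s).prod volume)) := by
        rw [integral_add hire hie]
    _ ≤ ENNReal.ofReal (∫ p, (diffq f p * diffq φ p).re ∂((besselMeasure n s).prod volume))
        + ENNReal.ofReal (∫ p, 2 * M ^ 2 * ‖diffq v p‖ ^ 2 ∂((besselMeasure n s).prod volume)) :=
        ENNReal.ofReal_add_le
    _ ≤ ENNReal.ofReal (2 * besselConst n s) * (C * (ENNReal.ofReal M * S) +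
          ENNReal.ofReal M ^ 2 * (ENNReal.ofReal (2 * besselConst n s))⁻¹) * sobSq s v
        + ENNReal.ofReal (2 * M ^ 2) * sobSq s v := by
        refine add_le_add (le_trans ?_ hB) ?_
        · have := integral_re hi
          simp only [RCLike.re_to_complex] at this
          rw [this, ← ofReal_norm]
          exact ENNReal.ofReal_le_ofReal (Complex.re_le_norm _)
        · rw [ofReal_integral_eq_lintegral_ofReal hie (Eventually.of_forall fun p => by positivity)]
          have e3 : ∀ p : Pt n × Pt n, ENNReal.ofReal (2 * M ^ 2 * ‖diffq v p‖ ^ 2)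
              = ENNReal.ofReal (2 * M ^ 2) * ‖diffq v p‖ₑ ^ 2 := fun p => by
            rw [ENNReal.ofReal_mul (by positivity), ENNReal.ofReal_pow (norm_nonneg _), ofReal_norm]
          simp_rw [e3]
          rw [lintegral_const_mul' _ _ ENNReal.ofReal_ne_top, lintegral_diffq_sq hv2.1]
          exact mul_le_mul_right (energy_le_sobSq v) _
    _ = _ := by rw [add_mul]

end

/-! ### From smooth functions to bounded Sobolev functions. -/

section

variable {n : ℕ} {s : ℝ}

theorem moll_ofReal (j : ℕ) (m : Pt n → ℝ) (x : Pt n) :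
    moll j (fun x => (m x : ℂ)) x = ((moll j m x : ℝ) : ℂ) := integral_ofReal

theorem ae_aemeasurable_section {f : Pt n × Pt n → ℝ≥0∞}
    (hf : AEMeasurable f (volume.prod volume)) : ∀ᵐ x, AEMeasurable (fun y => f (x, y)) :=
  hf.aestronglyMeasurable.prodMk_left.mono fun _ h => h.aemeasurable

theorem sobSq_moll_le (j : ℕ) {u : Pt n → ℂ} (hu : MemLp u 2) :
    sobSq s (moll j u) ≤ sobSq s u :=
  add_le_add (energy_moll_le (measurable_besselKernel n s) j (hu.locallyIntegrable one_le_two))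
    (mul_le_mul_right (lintegral_enorm_moll_sq_le j hu.1) _)

theorem memLp_moll (j : ℕ) {u : Pt n → ℂ} (hu : MemLp u 2) : MemLp (moll j u) 2 :=
  memLp_two_iff.2 ⟨(contDiff_moll j (hu.locallyIntegrable one_le_two)).continuous.aestronglyMeasurable,
    (lintegral_enorm_moll_sq_le j hu.1).trans_lt (memLp_two_iff.1 hu).2⟩

theorem ae_diff_of_ae {P : Pt n → Prop} (h : ∀ᵐ x, P x) :
    ∀ᵐ p : Pt n × Pt n ∂((besselMeasure n s).prod volume), P (p.2 + p.1) ∧ P p.2 := by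
  refine besselMeasure_prod_ac.ae_le ?_
  have h1 : ∀ᵐ p : Pt n × Pt n ∂(volume.prod volume), P (p.1 + p.2) :=
    (quasiMeasurePreserving_add volume volume).ae h
  have h2 : ∀ᵐ p : Pt n × Pt n ∂(volume.prod volume), P p.2 :=
    Measure.quasiMeasurePreserving_snd.ae h
  filter_upwards [h1, h2] with p h1 h2
  exact ⟨by rwa [add_comm], h2⟩

/-- Both functions are mollified. The supremum, the pairing bound and `sobSq` do not increase, so
the constant is uniform, and convergence at almost every point with Fatou passes to the limit. -/
theorem exists_caccioppoli (hs0 : 0 < s) (hs1 : s < 1) (hsn : 2 * s < n) {m : Pt n → ℝ}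
    (hm : AEStronglyMeasurable m) {M : ℝ} (hM : ∀ᵐ x, |m x| ≤ M) {K : Set (Pt n)}
    (hK : IsCompact K) (hmK : ∀ᵐ x, x ∉ K → m x = 0)
    (hsob : MemSob (2 * s) (ENNReal.ofReal (n / (2 * s))) (fun x => (m x : ℂ))) :
    ∃ D : ℝ≥0∞, D ≠ ⊤ ∧ ∀ u : Pt n → ℂ, MemLp u 2 → sobSq s u < ⊤ →
      ∫⁻ p, ENNReal.ofReal ((diffq m p) ^ 2 * (‖u (p.2 + p.1)‖ ^ 2 + ‖u p.2‖ ^ 2) / 4)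
        ∂((besselMeasure n s).prod volume) ≤ D * sobSq s u := by
  obtain ⟨C, hC, hpb⟩ := exists_pairBound hs0 hsn hsob
  have hM0 : 0 ≤ M := by
    obtain ⟨x, hx⟩ := hM.exists
    exact (abs_nonneg _).trans hx
  obtain ⟨D, hD, h⟩ := exists_caccioppoli_smooth (n := n) hs0 hs1 hsn hM0 hC
  refine ⟨D, hD, fun u hu hus => ?_⟩
  have hml : LocallyIntegrable m :=
    (memLp_top_of_bound hm M hM).locallyIntegrable le_top
  have hul := hu.locallyIntegrable one_le_two
  have hj : ∀ j, ∫⁻ p, ENNReal.ofReal ((diffq (moll j m) p) ^ 2 *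
      (‖moll j u (p.2 + p.1)‖ ^ 2 + ‖moll j u p.2‖ ^ 2) / 4)
        ∂((besselMeasure n s).prod volume) ≤ D * sobSq s u := by
    intro j
    refine (h (moll j m) (moll j u) (contDiff_moll j hml) (hasCompactSupport_moll j hK hmK)
      (norm_moll_le j (u := m) (M := M) hM) ?_ (contDiff_moll j hul) (memLp_moll j hu)
      ((sobSq_moll_le j hu).trans_lt hus)).trans
      (mul_le_mul_right (sobSq_moll_le j hu) _)
    have := hpb.moll j (Complex.continuous_ofReal.comp_aestronglyMeasurable hm) (M := M)
      (by simpa using hM)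
    rwa [show moll j (fun x => (m x : ℂ)) = _ from funext (moll_ofReal j m)] at this
  have hlim : ∀ᵐ p : Pt n × Pt n ∂((besselMeasure n s).prod volume),
      ENNReal.ofReal ((diffq m p) ^ 2 * (‖u (p.2 + p.1)‖ ^ 2 + ‖u p.2‖ ^ 2) / 4)
        ≤ liminf (fun j => ENNReal.ofReal ((diffq (moll j m) p) ^ 2 *
      (‖moll j u (p.2 + p.1)‖ ^ 2 + ‖moll j u p.2‖ ^ 2) / 4)) atTop := by
    filter_upwards [ae_diff_of_ae ((tendsto_moll_ae hml).and (tendsto_moll_ae hul))]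
      with p ⟨⟨h1, h2⟩, h3, h4⟩
    refine (Tendsto.liminf_eq ?_).ge
    refine (ENNReal.continuous_ofReal.tendsto _).comp ?_
    exact (((h1.sub h3).pow 2).mul ((h2.norm.pow 2).add (h4.norm.pow 2))).div_const 4
  refine (lintegral_mono_ae hlim).trans ((lintegral_liminf_le' fun j => ?_).trans ?_)
  · have c1 := (contDiff_moll j hml).continuous
    have c2 := (contDiff_moll j hul).continuous
    have : Continuous fun p : Pt n × Pt n => (diffq (moll j m) p) ^ 2 *
      (‖moll j u (p.2 + p.1)‖ ^ 2 + ‖moll j u p.2‖ ^ 2) / 4 := by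
      unfold diffq
      fun_prop
    exact this.measurable.ennreal_ofReal.aemeasurable
  · exact liminf_le_of_frequently_le' (Frequently.of_forall hj)

theorem crossEnergy_le_add {k k₁ k₂ : Pt n → ℝ≥0∞} (hk₁ : Measurable k₁) {c : ℝ≥0∞} (hc : c ≠ ⊤)
    (h : ∀ z, k z ≤ c * k₁ z + k₂ z) {m : Pt n → ℝ} (hm : AEStronglyMeasurable m) {u : Pt n → ℂ}
    (hu : AEStronglyMeasurable u) :
    crossEnergy k m u ≤ c * crossEnergy k₁ m u + crossEnergy k₂ m u := by
  have hmeas : AEMeasurable (fun p : Pt n × Pt n => c * (‖m p.1 - m p.2‖ₑ ^ 2 * ‖u p.1‖ₑ ^ 2 *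
      k₁ (p.1 - p.2))) (volume.prod volume) := by
    have h1 := (hm.comp_fst.sub hm.comp_snd : AEStronglyMeasurable
      (fun p : Pt n × Pt n => m p.1 - m p.2) (volume.prod volume)).enorm
    have h2 := (hu.comp_fst : AEStronglyMeasurable
      (fun p : Pt n × Pt n => u p.1) (volume.prod volume)).enorm
    have h3 : Measurable fun p : Pt n × Pt n => k₁ (p.1 - p.2) := by fun_prop
    exact (((h1.pow_const 2).mul (h2.pow_const 2)).mul h3.aemeasurable).const_mul _
  simp only [crossEnergy]
  rw [← lintegral_const_mul' _ _ hc, ← lintegral_add_left' (by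
    simp_rw [← lintegral_const_mul' _ _ hc]
    exact hmeas.lintegral_prod_right')]
  refine lintegral_mono_ae ?_
  filter_upwards [ae_aemeasurable_section hmeas] with x hx
  rw [← lintegral_const_mul' _ _ hc, ← lintegral_add_left' hx]
  refine lintegral_mono fun y => (mul_le_mul_right (h _) _).trans_eq ?_
  ring

theorem crossEnergy_besselKernel_le {m : Pt n → ℝ} (hm : AEStronglyMeasurable m) {u : Pt n → ℂ}
    (hu : AEStronglyMeasurable u) :
    crossEnergy (besselKernel n s) m u ≤ 4 *
      ∫⁻ p, ENNReal.ofReal ((diffq m p) ^ 2 * (‖u (p.2 + p.1)‖ ^ 2 + ‖u p.2‖ ^ 2) / 4)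
        ∂((besselMeasure n s).prod volume) := by
  have h1 := (aestronglyMeasurable_diffq hm).enorm
  have h2 := (aestronglyMeasurable_add_swap hu).enorm
  have hk := measurable_besselKernel n s
  have hF : AEMeasurable (fun p : Pt n × Pt n => ‖diffq m p‖ₑ ^ 2 * ‖u (p.2 + p.1)‖ₑ ^ 2)
      (volume.prod volume) := (h1.pow_const 2).mul (h2.pow_const 2)
  have e : crossEnergy (besselKernel n s) m u
      = ∫⁻ p, ‖diffq m p‖ₑ ^ 2 * ‖u (p.2 + p.1)‖ₑ ^ 2 ∂((besselMeasure n s).prod volume) := by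
    rw [lintegral_besselMeasure_prod hF, crossEnergy, lintegral_sub_change]
    · refine lintegral_congr_ae ?_
      filter_upwards [ae_aemeasurable_section hF] with z hz
      rw [← lintegral_mul_const'' _ hz]
      refine lintegral_congr fun x => ?_
      simp [diffq]
    · have h1 := (hm.comp_fst.sub hm.comp_snd : AEStronglyMeasurable
        (fun p : Pt n × Pt n => m p.1 - m p.2) (volume.prod volume)).enorm
      have h2 := (hu.comp_fst : AEStronglyMeasurable
        (fun p : Pt n × Pt n => u p.1) (volume.prod volume)).enorm
      have h3 : Measurable fun p : Pt n × Pt n => besselKernel n s (p.1 - p.2) := by fun_prop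
      exact ((h1.pow_const 2).mul (h2.pow_const 2)).mul h3.aemeasurable
  rw [e, ← lintegral_const_mul' _ _ (by simp)]
  refine lintegral_mono fun p => ?_
  rw [← ofReal_norm, ← ofReal_norm, ← ENNReal.ofReal_pow (norm_nonneg _),
    ← ENNReal.ofReal_pow (norm_nonneg _), ← ENNReal.ofReal_mul (by positivity),
    show (4 : ℝ≥0∞) = ENNReal.ofReal 4 by simp, ← ENNReal.ofReal_mul (by norm_num)]
  apply ENNReal.ofReal_le_ofReal
  rw [Real.norm_eq_abs, sq_abs]
  have := mul_nonneg (sq_nonneg (diffq m p)) (sq_nonneg ‖u p.2‖)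
  linarith

/-- For the Bessel kernel this is the Caccioppoli inequality. For the homogeneous kernel the
integrable tail is added, and there boundedness of `m` suffices. -/
theorem exists_crossEnergy_le (hs0 : 0 < s) (hs1 : s < 1) (hsn : 2 * s < n) {m : Pt n → ℝ}
    (hm : AEStronglyMeasurable m) {M : ℝ} (hM : ∀ᵐ x, |m x| ≤ M) {K : Set (Pt n)}
    (hK : IsCompact K) (hmK : ∀ᵐ x, x ∉ K → m x = 0)
    (hsob : MemSob (2 * s) (ENNReal.ofReal (n / (2 * s))) (fun x => (m x : ℂ))) :
    ∃ D : ℝ≥0∞, D ≠ ⊤ ∧ ∀ u : Pt n → ℂ, MemH s u →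
      crossEnergy (besselKernel n s) m u ≤ D * sobSq s u ∧
      crossEnergy (homKernel n s) m u ≤ D * sobSq s u := by
  obtain ⟨D, hD, h⟩ := exists_caccioppoli hs0 hs1 hsn hm hM hK hmK hsob
  have hc := besselConst_pos n hs0 hs1
  have h0 : ENNReal.ofReal (2 * besselConst n s) ≠ 0 := by
    rw [Ne, ENNReal.ofReal_eq_zero, not_le]; positivity
  have hinv := ENNReal.inv_ne_top.2 h0
  have ht := (lintegral_tailKernel_lt_top n hs0).ne
  set t := ∫⁻ z, tailKernel n s z
  set E := ENNReal.ofReal (2 * Real.exp (1 + 2 * Real.pi ^ 2))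
  set D' : ℝ≥0∞ := E * (4 * D) +
    ENNReal.ofReal (2 * M) ^ 2 * ((ENNReal.ofReal (2 * besselConst n s))⁻¹ * t)
  refine ⟨4 * D + D', by finiteness, fun u hu => ?_⟩
  obtain ⟨hu2, hus⟩ := (memH_iff hs0 hs1).1 hu
  have h1 : crossEnergy (besselKernel n s) m u ≤ 4 * D * sobSq s u := by
    refine (crossEnergy_besselKernel_le hm hu2.1).trans ?_
    rw [mul_assoc]
    exact mul_le_mul_right (h u hu2 hus) _
  refine ⟨h1.trans (mul_le_mul_left le_self_add _), ?_⟩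
  refine (crossEnergy_le_add (measurable_besselKernel n s) ENNReal.ofReal_ne_top
    (homKernel_le_add n hs0) hm hu2.1).trans (le_trans ?_ (mul_le_mul_left le_add_self _))
  calc _ ≤ E * (4 * D * sobSq s u) + ENNReal.ofReal (2 * M) ^ 2 *
        (((ENNReal.ofReal (2 * besselConst n s))⁻¹ * sobSq s u) * t) := by
        refine add_le_add (mul_le_mul_right h1 _) ?_
        refine (crossEnergy_le_of_bounded (measurable_tailKernel n s) hM hu2.1).trans ?_
        exact mul_le_mul_right (mul_le_mul_left (lintegral_sq_le_sobSq hs0 hs1 u) _) _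
    _ = _ := by ring

/-! ### Multipliers -/

/-- Leibniz: `θ(x)u(x) - θ(y)u(y) = (θ(x) - θ(y))u(x) + θ(y)(u(x) - u(y))`. Comparing the increments
of `θ` with those of `m` lets one estimate serve both `γ^{1/2}` and its inverse. -/
theorem energy_mul_le {k : Pt n → ℝ≥0∞} (hk : Measurable k) {m θ : Pt n → ℝ} {B L : ℝ}
    (hθB : ∀ᵐ x, |θ x| ≤ B)
    (hθm : ∀ᵐ x, ∀ᵐ y, |θ x - θ y| ≤ L * |m x - m y|) (hL : 0 ≤ L)
    (hm : AEStronglyMeasurable m) {u : Pt n → ℂ}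
    (hu : AEStronglyMeasurable u) :
    energy k (fun x => θ x * u x) ≤
      2 * ENNReal.ofReal L ^ 2 * crossEnergy k m u + 2 * ENNReal.ofReal B ^ 2 * energy k u := by
  have h1 := (hm.comp_fst.sub hm.comp_snd : AEStronglyMeasurable
    (fun p : Pt n × Pt n => m p.1 - m p.2) (volume.prod volume)).enorm
  have h2 := (hu.comp_fst : AEStronglyMeasurable
    (fun p : Pt n × Pt n => u p.1) (volume.prod volume)).enorm
  have h3 : Measurable fun p : Pt n × Pt n => k (p.1 - p.2) := by fun_prop
  have hmeas : AEMeasurable (fun p : Pt n × Pt n => ‖m p.1 - m p.2‖ₑ ^ 2 * ‖u p.1‖ₑ ^ 2 *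
      k (p.1 - p.2)) (volume.prod volume) :=
    ((h1.pow_const 2).mul (h2.pow_const 2)).mul h3.aemeasurable
  simp only [energy, crossEnergy]
  rw [← lintegral_const_mul' _ _ (by finiteness), ← lintegral_const_mul' _ _ (by finiteness),
    ← lintegral_add_left' (hmeas.lintegral_prod_right'.const_mul _)]
  refine lintegral_mono_ae ?_
  filter_upwards [ae_aemeasurable_section hmeas, hθm] with x hx hxθ
  rw [← lintegral_const_mul' _ _ (by finiteness), ← lintegral_const_mul' _ _ (by finiteness),
    ← lintegral_add_left' (hx.const_mul _)]
  refine lintegral_mono_ae ?_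
  filter_upwards [hxθ, hθB] with y hy hyB
  have e : (θ x : ℂ) * u x - θ y * u y = ((θ x - θ y : ℝ) : ℂ) * u x - (-(θ y * (u x - u y))) := by
    push_cast; ring
  have b1 : ‖((θ x - θ y : ℝ) : ℂ) * u x‖ₑ ≤ ENNReal.ofReal L * ‖m x - m y‖ₑ * ‖u x‖ₑ := by
    rw [enorm_mul]
    gcongr
    rw [← ofReal_norm, ← ofReal_norm, ← ENNReal.ofReal_mul hL]
    apply ENNReal.ofReal_le_ofReal
    rwa [Complex.norm_real]
  have b2 : ‖-((θ y : ℂ) * (u x - u y))‖ₑ ≤ ENNReal.ofReal B * ‖u x - u y‖ₑ := by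
    rw [enorm_neg, enorm_mul]
    gcongr
    rw [← ofReal_norm]
    apply ENNReal.ofReal_le_ofReal
    rwa [Complex.norm_real]
  rw [e]
  calc _ ≤ (2 * (ENNReal.ofReal L * ‖m x - m y‖ₑ * ‖u x‖ₑ) ^ 2
        + 2 * (ENNReal.ofReal B * ‖u x - u y‖ₑ) ^ 2) * k (x - y) := by
        refine mul_le_mul_left ((enorm_sub_sq_le _ _).trans ?_) _
        gcongr
    _ = _ := by ring

end

/-! ### Multipliers on `H^s` and on the closure of the test functions. -/

section

variable {n : ℕ} {s : ℝ}

theorem MemH.memLp (hs0 : 0 < s) (hs1 : s < 1) {u : Pt n → ℂ} (hu : MemH s u) : MemLp u 2 :=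
  ((memH_iff hs0 hs1).1 hu).1

theorem MemH.congr (hs0 : 0 < s) (hs1 : s < 1) {u v : Pt n → ℂ} (hu : MemH s u)
    (h : u =ᵐ[volume] v) : MemH s v := by
  obtain ⟨h1, h2⟩ := (memH_iff hs0 hs1).1 hu
  exact (memH_iff hs0 hs1).2 ⟨(memLp_congr_ae h).1 h1, by rwa [← sobSq_congr s h]⟩

theorem sobSq_sub_le {u v : Pt n → ℂ} (hu : AEStronglyMeasurable u) :
    sobSq s (fun x => u x - v x) ≤ 2 * sobSq s u + 2 * sobSq s v := by
  have hk := measurable_besselKernel n s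
  have hm : AEMeasurable (fun p : Pt n × Pt n => 2 * (‖u p.1 - u p.2‖ₑ ^ 2 *
      besselKernel n s (p.1 - p.2))) (volume.prod volume) := by
    have h1 := (hu.comp_fst.sub hu.comp_snd : AEStronglyMeasurable
      (fun p : Pt n × Pt n => u p.1 - u p.2) (volume.prod volume)).enorm
    have h3 : Measurable fun p : Pt n × Pt n => besselKernel n s (p.1 - p.2) := by fun_prop
    exact ((h1.pow_const 2).mul h3.aemeasurable).const_mul _
  have h1 : energy (besselKernel n s) (fun x => u x - v x)
      ≤ 2 * energy (besselKernel n s) u + 2 * energy (besselKernel n s) v := by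
    simp only [energy]
    rw [← lintegral_const_mul' _ _ (by simp), ← lintegral_const_mul' _ _ (by simp),
      ← lintegral_add_left' (by
        simp_rw [← lintegral_const_mul' 2 _ ENNReal.ofNat_ne_top]
        exact hm.lintegral_prod_right')]
    refine lintegral_mono_ae ?_
    filter_upwards [ae_aemeasurable_section hm] with x hx
    rw [← lintegral_const_mul' _ _ (by simp), ← lintegral_const_mul' _ _ (by simp),
      ← lintegral_add_left' hx]
    refine lintegral_mono fun y => ?_
    rw [show u x - v x - (u y - v y) = (u x - u y) - (v x - v y) by ring]
    refine (mul_le_mul_left (enorm_sub_sq_le _ _) _).trans_eq ?_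
    ring
  have h2 : ∫⁻ x, ‖u x - v x‖ₑ ^ 2 ≤ 2 * (∫⁻ x, ‖u x‖ₑ ^ 2) + 2 * ∫⁻ x, ‖v x‖ₑ ^ 2 := by
    rw [← lintegral_const_mul' _ _ (by simp), ← lintegral_const_mul' _ _ (by simp),
      ← lintegral_add_left' ((hu.enorm.pow_const 2).const_mul _)]
    exact lintegral_mono fun x => enorm_sub_sq_le _ _
  refine (add_le_add h1 (mul_le_mul_right h2 _)).trans_eq ?_
  simp only [sobSq]
  ring

theorem MemH.sub (hs0 : 0 < s) (hs1 : s < 1) {u v : Pt n → ℂ} (hu : MemH s u) (hv : MemH s v) :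
    MemH s (fun x => u x - v x) := by
  obtain ⟨h1, h2⟩ := (memH_iff hs0 hs1).1 hu
  obtain ⟨h3, h4⟩ := (memH_iff hs0 hs1).1 hv
  exact (memH_iff hs0 hs1).2 ⟨h1.sub h3, (sobSq_sub_le h1.1).trans_lt (by finiteness)⟩

theorem IsTest.memH {Ω : Set (Pt n)} {φ : Pt n → ℂ} (h : IsTest Ω φ) : MemH s φ := by
  obtain ⟨ψ, hψ⟩ := exists_schwartz h.1 h.2.1
  rw [show φ = ψ from funext fun x => (hψ x).symm]
  exact memH_schwartz ψ

theorem memHTilde_iff (hs0 : 0 < s) (hs1 : s < 1) {Ω : Set (Pt n)} {u : Pt n → ℂ} :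
    MemHTilde s Ω u ↔ MemH s u ∧ ∃ φ : ℕ → Pt n → ℂ, (∀ k, IsTest Ω (φ k)) ∧
      Tendsto (fun k => sobSq s (fun x => u x - φ k x)) atTop (𝓝 0) := by
  refine and_congr_right fun hu => exists_congr fun φ => and_congr_right fun hφ => ?_
  have hc := besselConst_pos n hs0 hs1
  have h0 : ENNReal.ofReal (2 * besselConst n s) ≠ 0 := by
    rw [Ne, ENNReal.ofReal_eq_zero, not_le]; positivity
  have e : ∀ k, ENNReal.ofReal (2 * besselConst n s) * hNorm s (fun x => u x - φ k x) ^ 2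
      = sobSq s (fun x => u x - φ k x) := fun k => hNorm_sq hs0 hs1 (hu.sub hs0 hs1 (hφ k).memH)
  constructor
  · intro h
    simp_rw [← e]
    have := ENNReal.Tendsto.const_mul (a := ENNReal.ofReal (2 * besselConst n s))
      (ENNReal.Tendsto.pow (n := 2) h) (Or.inr ENNReal.ofReal_ne_top)
    simpa using this
  · intro h
    have h1 := ENNReal.Tendsto.const_mul (a := (ENNReal.ofReal (2 * besselConst n s))⁻¹) h
      (Or.inr (ENNReal.inv_ne_top.2 h0))
    have h2 := h1.ennrpow_const (1 / 2)
    rw [mul_zero, ENNReal.zero_rpow_of_pos (by norm_num)] at h2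
    refine h2.congr fun k => ?_
    rw [← e, ← mul_assoc, ENNReal.inv_mul_cancel h0 ENNReal.ofReal_ne_top, one_mul,
      ← ENNReal.rpow_natCast, ← ENNReal.rpow_mul]
    norm_num

theorem MemHTilde.congr (hs0 : 0 < s) (hs1 : s < 1) {Ω : Set (Pt n)} {u v : Pt n → ℂ}
    (hu : MemHTilde s Ω u) (h : u =ᵐ[volume] v) : MemHTilde s Ω v := by
  rw [memHTilde_iff hs0 hs1] at hu ⊢
  obtain ⟨h1, φ, hφ, hlim⟩ := hu
  refine ⟨h1.congr hs0 hs1 h, φ, hφ, hlim.congr fun k => sobSq_congr s ?_⟩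
  filter_upwards [h] with x hx
  rw [hx]

/-- Mollification converges in the energy and in `L²`, and at small scales the support, which has
positive distance to the complement of `Ω`, stays inside. -/
theorem exists_isTest_sobSq_lt (hs0 : 0 < s) (hs1 : s < 1) {Ω : Set (Pt n)} (hΩ : IsOpen Ω)
    {u : Pt n → ℂ} (hu : MemH s u) {K : Set (Pt n)} (hK : IsCompact K) (hKΩ : K ⊆ Ω)
    (huK : ∀ᵐ x, x ∉ K → u x = 0) {ε : ℝ≥0∞} (hε : 0 < ε) :
    ∃ ψ, IsTest Ω ψ ∧ sobSq s (fun x => u x - ψ x) < ε := by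
  obtain ⟨h2, hfin⟩ := (memH_iff hs0 hs1).1 hu
  have hl : Tendsto (fun j => sobSq s (fun x => moll j u x - u x)) atTop (𝓝 0) := by
    have := (tendsto_energy_moll_sub (measurable_besselKernel n s) h2
      ((energy_le_sobSq u).trans_lt hfin)).add
      (ENNReal.Tendsto.const_mul (a := ENNReal.ofReal (2 * besselConst n s))
        (tendsto_lintegral_moll_sub h2) (Or.inr ENNReal.ofReal_ne_top))
    simpa [sobSq] using this
  obtain ⟨j, hj1, hj2⟩ := ((isTest_moll (h2.locallyIntegrable one_le_two) hK hΩ hKΩ huK).and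
    (hl.eventually_lt_const hε)).exists
  refine ⟨moll j u, hj1, lt_of_eq_of_lt ?_ hj2⟩
  have e : ∀ a b : ℂ, ‖a - b‖ₑ = ‖b - a‖ₑ := fun a b => by rw [← enorm_neg, neg_sub]
  simp only [sobSq, energy]
  congr 1
  · refine lintegral_congr fun x => lintegral_congr fun y => ?_
    rw [← enorm_neg]
    congr 3
    ring
  · congr 1
    exact lintegral_congr fun x => by rw [e]

/-- Multiplication by `θ` is bounded on `H^s`. -/
def IsMultiplier (s : ℝ) (θ : Pt n → ℝ) : Prop :=
  (∀ u : Pt n → ℂ, MemH s u → MemH s fun x => θ x * u x) ∧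
    ∃ C : ℝ≥0∞, C ≠ ⊤ ∧ ∀ u : Pt n → ℂ, MemH s u → sobSq s (fun x => θ x * u x) ≤ C * sobSq s u

/-- If `φ_k` are test functions approaching `u`, then `θφ_k` approaches `θu` by boundedness. The
product `θφ_k` need not be smooth, but its support is compact in `Ω`, so it is itself close to a
test function `ψ_k`. -/
theorem IsMultiplier.memHTilde (hs0 : 0 < s) (hs1 : s < 1) {θ : Pt n → ℝ} (hθ : IsMultiplier s θ)
    {Ω : Set (Pt n)} (hΩ : IsOpen Ω) {u : Pt n → ℂ} (hu : MemHTilde s Ω u) :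
    MemHTilde s Ω fun x => θ x * u x := by
  obtain ⟨hθ1, C, hC, hθC⟩ := hθ
  rw [memHTilde_iff hs0 hs1] at hu ⊢
  obtain ⟨h1, φ, hφ, hlim⟩ := hu
  refine ⟨hθ1 u h1, ?_⟩
  have hex : ∀ k : ℕ, ∃ ψ, IsTest Ω ψ ∧
      sobSq s (fun x => θ x * φ k x - ψ x) < (k + 1 : ℝ≥0∞)⁻¹ := fun k =>
    exists_isTest_sobSq_lt hs0 hs1 hΩ (hθ1 _ (hφ k).memH) (hφ k).2.1 (hφ k).2.2
      (Eventually.of_forall fun x hx => by rw [image_eq_zero_of_notMem_tsupport hx, mul_zero])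
      (ENNReal.inv_pos.2 (by finiteness))
  choose ψ hψ1 hψ2 using hex
  refine ⟨ψ, hψ1, ?_⟩
  have hb : ∀ k, sobSq s (fun x => θ x * u x - ψ k x)
      ≤ 2 * (C * sobSq s (fun x => u x - φ k x)) + 2 * (2 * (k + 1 : ℝ≥0∞)⁻¹) := by
    intro k
    have hd := h1.sub hs0 hs1 (hφ k).memH (s := s)
    have e : (fun x => θ x * u x - ψ k x) = fun x => θ x * (u x - φ k x)
        - (ψ k x - θ x * φ k x) := by
      ext x; ring
    have e2 : sobSq s (fun x => ψ k x - θ x * φ k x)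
        = sobSq s (fun x => θ x * φ k x - ψ k x) := by
      simp only [sobSq, energy]
      congr 1
      · refine lintegral_congr fun x => lintegral_congr fun y => ?_
        rw [← enorm_neg]
        congr 3
        ring
      · congr 1
        exact lintegral_congr fun x => by rw [← enorm_neg, neg_sub]
    rw [e]
    refine (sobSq_sub_le ((hθ1 _ hd).memLp hs0 hs1).1).trans ?_
    rw [e2]
    gcongr
    · exact hθC _ hd
    · exact (hψ2 k).le.trans (le_mul_of_one_le_left' one_le_two)
  refine tendsto_of_tendsto_of_tendsto_of_le_of_le tendsto_const_nhds ?_ (fun _ => zero_le) hb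
  have t1 := ENNReal.Tendsto.const_mul (a := 2) (ENNReal.Tendsto.const_mul (a := C) hlim
    (Or.inr hC)) (Or.inr ENNReal.ofNat_ne_top)
  have t2 : Tendsto (fun k : ℕ => (k + 1 : ℝ≥0∞)⁻¹) atTop (𝓝 0) := by
    have := (tendsto_add_atTop_iff_nat 1).2 ENNReal.tendsto_inv_nat_nhds_zero
    simpa using this
  have t3 := ENNReal.Tendsto.const_mul (a := 2) (ENNReal.Tendsto.const_mul (a := 2) t2
    (Or.inr ENNReal.ofNat_ne_top)) (Or.inr ENNReal.ofNat_ne_top)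
  simpa using t1.add t3

theorem isMultiplier_of_le (hs0 : 0 < s) (hs1 : s < 1) {m θ : Pt n → ℝ} {B L : ℝ}
    (hθ : AEStronglyMeasurable θ) (hθB : ∀ᵐ x, |θ x| ≤ B)
    (hθm : ∀ᵐ x, ∀ᵐ y, |θ x - θ y| ≤ L * |m x - m y|) (hL : 0 ≤ L)
    (hm : AEStronglyMeasurable m) {D : ℝ≥0∞} (hD : D ≠ ⊤)
    (h : ∀ u : Pt n → ℂ, MemH s u → crossEnergy (besselKernel n s) m u ≤ D * sobSq s u) :
    IsMultiplier s θ := by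
  have hb : ∀ u : Pt n → ℂ, MemH s u → sobSq s (fun x => θ x * u x) ≤
      (2 * ENNReal.ofReal L ^ 2 * D + 3 * ENNReal.ofReal B ^ 2) * sobSq s u := by
    intro u hu
    have hu2 := hu.memLp hs0 hs1
    have h1 := energy_mul_le (measurable_besselKernel n s) hθB hθm hL hm hu2.1
    have h2 : ∫⁻ x, ‖(θ x : ℂ) * u x‖ₑ ^ 2 ≤ ENNReal.ofReal B ^ 2 * ∫⁻ x, ‖u x‖ₑ ^ 2 := by
      rw [← lintegral_const_mul' _ _ (by finiteness)]
      refine lintegral_mono_ae ?_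
      filter_upwards [hθB] with x hx
      rw [enorm_mul, mul_pow]
      gcongr
      rw [← ofReal_norm]
      apply ENNReal.ofReal_le_ofReal
      rwa [Complex.norm_real]
    calc sobSq s (fun x => θ x * u x) ≤ 2 * ENNReal.ofReal L ^ 2 * (D * sobSq s u)
          + 2 * ENNReal.ofReal B ^ 2 * sobSq s u + ENNReal.ofReal B ^ 2 *
            (ENNReal.ofReal (2 * besselConst n s) * ∫⁻ x, ‖u x‖ₑ ^ 2) := by
          refine add_le_add (h1.trans (add_le_add (mul_le_mul_right (h u hu) _)
            (mul_le_mul_right (energy_le_sobSq u) _))) ((mul_le_mul_right h2 _).trans_eq ?_)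
          ring
      _ ≤ 2 * ENNReal.ofReal L ^ 2 * (D * sobSq s u)
          + 2 * ENNReal.ofReal B ^ 2 * sobSq s u + ENNReal.ofReal B ^ 2 * sobSq s u :=
          add_le_add le_rfl (mul_le_mul_right le_add_self _)
      _ = _ := by ring
  refine ⟨fun u hu => ?_, _, by finiteness, hb⟩
  obtain ⟨hu2, hus⟩ := (memH_iff hs0 hs1).1 hu
  refine (memH_iff hs0 hs1).2 ⟨?_, (hb u hu).trans_lt (by finiteness)⟩
  refine hu2.of_le_mul (c := B) ((Complex.continuous_ofReal.comp_aestronglyMeasurable hθ).mul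
    hu2.1) ?_
  filter_upwards [hθB] with x hx
  rw [norm_mul, Complex.norm_real]
  gcongr
  exact hx

/-! ### Conductivities -/

section Conductivity

variable {Ω : Set (Pt n)} {γ : Pt n → ℝ}

theorem IsConductivity.exists_bounds (hγ : IsConductivity s Ω γ) :
    ∃ a b : ℝ, 0 < a ∧ ∀ᵐ x, a ≤ Real.sqrt (γ x) ∧ Real.sqrt (γ x) ≤ b := by
  obtain ⟨a, b, ha, h⟩ := hγ.bounds
  refine ⟨Real.sqrt a, Real.sqrt b, Real.sqrt_pos.2 ha, ?_⟩
  filter_upwards [h] with x hx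
  exact ⟨Real.sqrt_le_sqrt hx.1, Real.sqrt_le_sqrt hx.2⟩

theorem IsConductivity.aestronglyMeasurable_sqrt (hγ : IsConductivity s Ω γ) :
    AEStronglyMeasurable fun x => Real.sqrt (γ x) :=
  (Real.continuous_sqrt.measurable.comp_aemeasurable hγ.aemeasurable).aestronglyMeasurable

theorem IsConductivity.ae_pos (hγ : IsConductivity s Ω γ) : ∀ᵐ x, 0 < Real.sqrt (γ x) := by
  obtain ⟨a, b, ha, h⟩ := hγ.exists_bounds
  filter_upwards [h] with x hx using ha.trans_le hx.1

/-- Constants cancel in differences, so the estimate for `γ^{1/2} - 1`, to which the Sobolev and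
support hypotheses apply, is one for `γ^{1/2}`. -/
theorem IsConductivity.exists_crossEnergy_le (hs0 : 0 < s) (hs1 : s < 1) (hsn : 2 * s < n)
    (hγ : IsConductivity s Ω γ) :
    ∃ D : ℝ≥0∞, D ≠ ⊤ ∧ ∀ u : Pt n → ℂ, MemH s u →
      crossEnergy (besselKernel n s) (fun x => Real.sqrt (γ x)) u ≤ D * sobSq s u ∧
      crossEnergy (homKernel n s) (fun x => Real.sqrt (γ x)) u ≤ D * sobSq s u := by
  obtain ⟨a, b, ha, h⟩ := hγ.exists_bounds
  obtain ⟨K, hK, _, hγK⟩ := hγ.support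
  have := FMCE.exists_crossEnergy_le (M := b + 1) hs0 hs1 hsn
    (hγ.aestronglyMeasurable_sqrt.sub aestronglyMeasurable_const :
      AEStronglyMeasurable fun x => Real.sqrt (γ x) - 1) (by
      filter_upwards [h] with x hx
      rw [abs_le]
      constructor <;> linarith [Real.sqrt_nonneg (γ x)]) hK hγK hγ.sobolev
  simpa only [crossEnergy, sub_sub_sub_cancel_right] using this

theorem IsConductivity.isMultiplier_sqrt (hs0 : 0 < s) (hs1 : s < 1) (hsn : 2 * s < n)
    (hγ : IsConductivity s Ω γ) : IsMultiplier s fun x => Real.sqrt (γ x) := by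
  obtain ⟨a, b, ha, h⟩ := hγ.exists_bounds
  obtain ⟨D, hD, hc⟩ := hγ.exists_crossEnergy_le hs0 hs1 hsn
  refine isMultiplier_of_le (B := b) (L := 1) hs0 hs1 hγ.aestronglyMeasurable_sqrt ?_ ?_
    zero_le_one hγ.aestronglyMeasurable_sqrt hD fun u hu => (hc u hu).1
  · filter_upwards [h] with x hx
    rw [abs_of_nonneg (Real.sqrt_nonneg _)]
    exact hx.2
  · exact Eventually.of_forall fun x => Eventually.of_forall fun y => (one_mul _).ge

theorem IsConductivity.isMultiplier_inv_sqrt (hs0 : 0 < s) (hs1 : s < 1) (hsn : 2 * s < n)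
    (hγ : IsConductivity s Ω γ) : IsMultiplier s fun x => (Real.sqrt (γ x))⁻¹ := by
  obtain ⟨a, b, ha, h⟩ := hγ.exists_bounds
  obtain ⟨D, hD, hc⟩ := hγ.exists_crossEnergy_le hs0 hs1 hsn
  -- Inversion is Lipschitz with constant `a⁻²` on `[a, ∞)`.
  refine isMultiplier_of_le (B := a⁻¹) (L := a⁻¹ * a⁻¹) hs0 hs1
    hγ.aestronglyMeasurable_sqrt.aemeasurable.inv.aestronglyMeasurable ?_ ?_
    (by positivity) hγ.aestronglyMeasurable_sqrt hD fun u hu => (hc u hu).1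
  · filter_upwards [h] with x hx
    rw [abs_of_nonneg (by positivity)]
    exact inv_anti₀ ha hx.1
  · filter_upwards [h] with x hx
    filter_upwards [h] with y hy
    have hx0 := ha.trans_le hx.1
    have hy0 := ha.trans_le hy.1
    rw [inv_sub_inv hx0.ne' hy0.ne', abs_div, abs_sub_comm, div_eq_inv_mul,
      abs_of_pos (mul_pos hx0 hy0), mul_inv]
    gcongr
    · exact hx.1
    · exact hy.1

end Conductivity

end

/-! ### Square integrability of the gradients and of the magnetic terms. -/

section

variable {n : ℕ} {s : ℝ}

/-! ### The bilinear product -/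

theorem dot_comm (a b : Vec n) : dot a b = dot b a :=
  Finset.sum_congr rfl fun _ _ => mul_comm _ _

theorem dot_add_left (a b c : Vec n) : dot (a + b) c = dot a c + dot b c := by
  simp [dot, add_mul, Finset.sum_add_distrib]

theorem dot_add_right (a b c : Vec n) : dot a (b + c) = dot a b + dot a c := by
  simp [dot, mul_add, Finset.sum_add_distrib]

theorem dot_smul_left (c : ℂ) (a b : Vec n) : dot (c • a) b = c * dot a b := by
  simp [dot, Finset.mul_sum, mul_assoc]

theorem dot_smul_right (c : ℂ) (a b : Vec n) : dot a (c • b) = c * dot a b := by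
  rw [dot_comm, dot_smul_left, dot_comm]

theorem norm_dot_le (a b : Vec n) : ‖dot a b‖ ≤ ‖a‖ * ‖b‖ := by
  rw [EuclideanSpace.norm_eq, EuclideanSpace.norm_eq]
  refine (norm_sum_le _ _).trans ?_
  simp_rw [norm_mul]
  exact Real.sum_mul_le_sqrt_mul_sqrt _ _ _

theorem continuous_dot : Continuous fun p : Vec n × Vec n => dot p.1 p.2 := by
  unfold dot
  fun_prop

theorem integrable_dot {α : Type*} [MeasurableSpace α] {μ : Measure α} {V W : α → Vec n}
    (hV : MemLp V 2 μ) (hW : MemLp W 2 μ) : Integrable (fun z => dot (V z) (W z)) μ := by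
  have h : Integrable (fun z => ‖V z‖ * ‖W z‖) μ := hV.norm.integrable_mul hW.norm
  have hm : AEStronglyMeasurable (fun z => (V z, W z)) μ := hV.1.prodMk hW.1
  have hd : AEStronglyMeasurable (fun z => dot (V z) (W z)) μ :=
    Continuous.comp_aestronglyMeasurable (g := fun p : Vec n × Vec n => dot p.1 p.2)
      (f := fun z => (V z, W z)) continuous_dot hm
  exact h.mono' hd (Eventually.of_forall fun z => norm_dot_le _ _)

theorem continuous_toVec : Continuous (toVec : Pt n → Vec n) := by
  unfold toVec
  refine (PiLp.continuous_toLp 2 _).comp ?_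
  fun_prop

theorem norm_toVec (z : Pt n) : ‖toVec z‖ = ‖z‖ := by
  rw [EuclideanSpace.norm_eq, EuclideanSpace.norm_eq]
  simp [toVec]

theorem toVec_neg (z : Pt n) : toVec (-z) = -toVec z := by
  ext i
  simp [toVec]

theorem toVec_zero : toVec (0 : Pt n) = 0 := by
  ext i
  simp [toVec]

theorem dot_toVec_self (z : Pt n) : dot (toVec z) (toVec z) = ((‖z‖ ^ 2 : ℝ) : ℂ) := by
  rw [EuclideanSpace.norm_sq_eq]
  simp [toVec, dot, sq]

/-! ### The kernel of the fractional gradient -/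

theorem alpha_swap (s : ℝ) (x y : Pt n) : alpha s y x = -alpha s x y := by
  rw [alpha, alpha, norm_sub_rev, ← neg_sub y x, toVec_neg, smul_neg]

theorem fracGrad_swap (s : ℝ) (u : Pt n → ℂ) (x y : Pt n) :
    fracGrad s u y x = fracGrad s u x y := by
  rw [fracGrad, fracGrad, alpha_swap, smul_neg, ← neg_smul, neg_sub]

theorem measurable_alpha (n : ℕ) (s : ℝ) :
    Measurable fun z : Pt n × Pt n => alpha s z.1 z.2 := by
  unfold alpha
  have h1 : Measurable fun z : Pt n × Pt n => toVec (z.2 - z.1) :=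
    (continuous_toVec.comp (continuous_snd.sub continuous_fst)).measurable
  have h2 : Measurable fun z : Pt n × Pt n =>
      ((Real.sqrt (fracConst n s) / Real.sqrt 2 / ‖z.2 - z.1‖ ^ ((n : ℝ) / 2 + s + 1) : ℝ) : ℂ) := by
    fun_prop
  exact h2.smul h1

/-- The numerator of `alpha` lowers the exponent `n/2 + s + 1` by one, so the `L²` norm of `∇^s u`
is an energy with `homKernel`. On the diagonal both sides are `0`. -/
theorem enorm_alpha_sq (hs0 : 0 < s) (x y : Pt n) :
    ‖alpha s x y‖ₑ ^ 2 = ENNReal.ofReal ((Real.sqrt (fracConst n s) / Real.sqrt 2) ^ 2) *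
      homKernel n s (x - y) := by
  rw [homKernel, ← ENNReal.ofReal_mul (by positivity), ← ofReal_norm,
    ← ENNReal.ofReal_pow (norm_nonneg _), alpha, norm_smul, norm_toVec, Complex.norm_real,
    Real.norm_of_nonneg (by positivity), norm_sub_rev y x]
  congr 1
  rcases (norm_nonneg (x - y)).eq_or_lt' with h | h
  · have : (0 : ℝ) ≤ n := n.cast_nonneg
    rw [h, Real.zero_rpow (by linarith), Real.zero_rpow (by linarith)]
    simp
  · rw [mul_pow, div_pow _ (‖x - y‖ ^ _), div_mul_eq_mul_div, mul_div_assoc]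
    congr 1
    rw [← Real.rpow_natCast _ 2, ← Real.rpow_natCast (‖x - y‖ ^ _) 2, ← Real.rpow_mul h.le,
      ← Real.rpow_sub h]
    congr 1
    push_cast
    ring

/-- The vector `alpha s x y` is a multiple of `x - y` and sees only the parallel component. It
vanishes on the diagonal, so the value of `parPart` there is immaterial. -/
theorem dot_parPart_alpha (B : Pt n → Pt n → Vec n) (x y : Pt n) :
    dot (parPart B x y) (alpha s x y) = dot (B x y) (alpha s x y) := by
  rcases eq_or_ne x y with rfl | h
  · simp [alpha, toVec_zero, dot]
  · have hn : ((‖x - y‖ ^ 2 : ℝ) : ℂ) ≠ 0 := by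
      have : ‖x - y‖ ≠ 0 := norm_ne_zero_iff.2 (sub_ne_zero.2 h)
      exact_mod_cast pow_ne_zero 2 this
    rw [alpha, ← neg_sub x y, toVec_neg, smul_neg, ← neg_smul, dot_smul_right, dot_smul_right,
      parPart, if_neg h, dot_smul_left, dot_toVec_self, div_mul_cancel₀ _ hn]

theorem dot_parPart_fracGrad (B : Pt n → Pt n → Vec n) (φ : Pt n → ℂ) (x y : Pt n) :
    dot (parPart B x y) (fracGrad s φ x y) = dot (B x y) (fracGrad s φ x y) := by
  rw [fracGrad, dot_smul_right, dot_smul_right, dot_parPart_alpha]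

/-! ### Square integrability -/

theorem memLp_swap {V : Pt n → Pt n → Vec n} (h : MemLp (fun z : Pt n × Pt n => V z.1 z.2) 2 volume) :
    MemLp (fun z : Pt n × Pt n => V z.2 z.1) 2 volume :=
  h.comp_measurePreserving (Measure.measurePreserving_swap (μ := volume) (ν := volume))

theorem memLp_smul_alpha (hs0 : 0 < s) {F : Pt n → Pt n → ℂ}
    (hF : AEStronglyMeasurable (fun z : Pt n × Pt n => F z.1 z.2) (volume.prod volume))
    (h : ∫⁻ x, ∫⁻ y, ‖F x y‖ₑ ^ 2 * homKernel n s (x - y) < ⊤) :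
    MemLp (fun z : Pt n × Pt n => F z.1 z.2 • alpha s z.1 z.2) 2 volume := by
  have hm : AEStronglyMeasurable (fun z : Pt n × Pt n => F z.1 z.2 • alpha s z.1 z.2)
      (volume.prod volume) := hF.smul (measurable_alpha n s).aestronglyMeasurable
  refine memLp_two_iff.2 ⟨hm, ?_⟩
  rw [Measure.volume_eq_prod, lintegral_prod _ (hm.enorm.pow_const 2)]
  simp_rw [enorm_smul, mul_pow, enorm_alpha_sq hs0, mul_left_comm (_ ^ 2) (ENNReal.ofReal _)]
  simp_rw [lintegral_const_mul' _ _ ENNReal.ofReal_ne_top]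
  exact ENNReal.mul_lt_top ENNReal.ofReal_lt_top h

theorem MemH.memLp_fracGrad (hs0 : 0 < s) (hs1 : s < 1) {u : Pt n → ℂ} (hu : MemH s u) :
    MemLp (fun z : Pt n × Pt n => fracGrad s u z.1 z.2) 2 volume := by
  obtain ⟨C, hC, h⟩ := exists_energy_homKernel_le n hs0 hs1
  obtain ⟨h2, hfin⟩ := (memH_iff hs0 hs1).1 hu
  exact memLp_smul_alpha (F := fun x y => u x - u y) hs0 (h2.1.comp_fst.sub h2.1.comp_snd)
    ((h u h2.1).trans_lt (by finiteness))

theorem IsConductivity.memLp_smul_fracGrad (hs0 : 0 < s) (hs1 : s < 1) (hsn : 2 * s < n)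
    {Ω : Set (Pt n)} {γ : Pt n → ℝ} (hγ : IsConductivity s Ω γ) {u : Pt n → ℂ} (hu : MemH s u) :
    MemLp (fun z : Pt n × Pt n => u z.1 • fracGrad s (sqrtC γ) z.1 z.2) 2 volume := by
  obtain ⟨D, hD, h⟩ := hγ.exists_crossEnergy_le hs0 hs1 hsn
  obtain ⟨h2, hfin⟩ := (memH_iff hs0 hs1).1 hu
  have hg : AEStronglyMeasurable (sqrtC γ) :=
    Complex.continuous_ofReal.comp_aestronglyMeasurable hγ.aestronglyMeasurable_sqrt
  have := memLp_smul_alpha (F := fun x y => u x * (sqrtC γ x - sqrtC γ y)) hs0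
    (h2.1.comp_fst.mul (hg.comp_fst.sub hg.comp_snd)) (s := s) (by
      refine lt_of_le_of_lt (le_of_eq ?_) ((h u hu).2.trans_lt (by finiteness))
      refine lintegral_congr fun x => lintegral_congr fun y => ?_
      rw [enorm_mul, mul_pow, mul_comm (_ ^ 2) (_ ^ 2)]
      congr 3
      rw [sqrtC, sqrtC, ← Complex.ofReal_sub, ← ofReal_norm, ← ofReal_norm, Complex.norm_real])
  simpa only [fracGrad, smul_smul] using this

theorem MemH.memLp_rpow (hs0 : 0 < s) (hs1 : s < 1) (hsn : 2 * s < n) {u : Pt n → ℂ}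
    (hu : MemH s u) {r : ℝ} (h2r : 2 ≤ r) (hr : r ≤ sobExp n s) :
    MemLp u (ENNReal.ofReal r) := by
  obtain ⟨S, hS, h⟩ := exists_sobolev_le (n := n) hs0 hs1 hsn
  obtain ⟨h2, hfin⟩ := (memH_iff hs0 hs1).1 hu
  have hσ := two_lt_sobExp hs0 hsn
  refine ⟨h2.1, ?_⟩
  rw [eLpNorm_lt_top_iff_lintegral_rpow_enorm_lt_top (by simp; linarith) ENNReal.ofReal_ne_top,
    ENNReal.toReal_ofReal (by linarith)]
  have hb := (h u h2).trans_lt (ENNReal.mul_lt_top hS.lt_top hfin)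
  have hb' := (ENNReal.rpow_lt_top_iff_of_pos (by positivity)).1 hb
  calc ∫⁻ x, ‖u x‖ₑ ^ r ≤ ∫⁻ x, (‖u x‖ₑ ^ 2 + ‖u x‖ₑ ^ sobExp n s) := by
        refine lintegral_mono fun x => ?_
        rcases le_total ‖u x‖ₑ 1 with hx | hx
        · refine le_trans ?_ le_self_add
          rw [← ENNReal.rpow_two]
          exact ENNReal.rpow_le_rpow_of_exponent_ge hx h2r
        · exact (ENNReal.rpow_le_rpow_of_exponent_le hx hr).trans le_add_self
    _ = (∫⁻ x, ‖u x‖ₑ ^ 2) + ∫⁻ x, ‖u x‖ₑ ^ sobExp n s :=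
        lintegral_add_left' (h2.1.enorm.pow_const 2) _
    _ < ⊤ := ENNReal.add_lt_top.2 ⟨(memLp_two_iff.1 h2).2, hb'⟩

theorem two_le_expP (n : ℕ) (s : ℝ) : 2 ≤ expP n s := le_max_left _ _

/-- With `p = expP n s`, the inequality `2p' ≤ 2n/(n-2s)` is equivalent to `p ≥ n/2s`. This exponent
is dual to that of `q`, and to that of the marginals of `A`. -/
theorem MemH.memLp_dual (hs0 : 0 < s) (hs1 : s < 1) (hsn : 2 * s < n) {u : Pt n → ℂ}
    (hu : MemH s u) : MemLp u (ENNReal.ofReal (2 * (expP n s / (expP n s - 1)))) := by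
  have hp := two_le_expP n s
  refine hu.memLp_rpow hs0 hs1 hsn ?_ ?_
  · have : 1 ≤ expP n s / (expP n s - 1) := by
      rw [one_le_div (by linarith)]; linarith
    linarith
  · have h1 : (n : ℝ) / (2 * s) ≤ expP n s := le_max_right _ _
    rw [div_le_iff₀ (by linarith)] at h1
    rw [sobExp, mul_div_assoc]
    gcongr 2 * ?_
    rw [div_le_div_iff₀ (by linarith) (by linarith)]
    nlinarith

theorem holderTriple_two (n : ℕ) (s : ℝ) :
    ENNReal.HolderTriple (ENNReal.ofReal (2 * expP n s))
      (ENNReal.ofReal (2 * (expP n s / (expP n s - 1)))) 2 := by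
  have hp := two_le_expP n s
  have h : Real.HolderTriple (2 * expP n s) (2 * (expP n s / (expP n s - 1))) 2 := by
    have h1 : expP n s - 1 ≠ 0 := by linarith
    have h2 : expP n s ≠ 0 := by linarith
    refine ⟨by field_simp; ring, by linarith, mul_pos two_pos (div_pos (by linarith) (by linarith))⟩
  simpa using h.ennrealOfReal

/-- Integrating first in `y` leaves `∫ |u|² (J₂ B)²`, which is finite by Hölder with `1/(2p) +
1/(2p') = 1/2`. -/
theorem memLp_smul_of_memLp_J₂ (hs0 : 0 < s) (hs1 : s < 1) (hsn : 2 * s < n)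
    {B : Pt n → Pt n → Vec n} (hB : MemLp (fun z : Pt n × Pt n => B z.1 z.2) 2 volume)
    (hJ : MemLp (J₂ B) (ENNReal.ofReal (2 * expP n s)) volume) {u : Pt n → ℂ} (hu : MemH s u) :
    MemLp (fun z : Pt n × Pt n => u z.1 • B z.1 z.2) 2 volume := by
  have hu2 := hu.memLp hs0 hs1
  have := holderTriple_two n s
  have hJu : MemLp (fun x => J₂ B x • u x) 2 volume :=
    MemLp.smul (hu.memLp_dual hs0 hs1 hsn) hJ
  have hm : AEStronglyMeasurable (fun z : Pt n × Pt n => u z.1 • B z.1 z.2) (volume.prod volume) :=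
    hu2.1.comp_fst.smul hB.1
  refine memLp_two_iff.2 ⟨hm, ?_⟩
  rw [Measure.volume_eq_prod, lintegral_prod _ (hm.enorm.pow_const 2)]
  have hBi : ∀ᵐ x, Integrable (fun y => ‖B x y‖ ^ 2) :=
    (hB.integrable_norm_pow two_ne_zero : Integrable _ (volume.prod volume)).prod_right_ae
  refine lt_of_eq_of_lt (lintegral_congr_ae ?_) (memLp_two_iff.1 hJu).2
  filter_upwards [hBi] with x hx
  simp_rw [enorm_smul, mul_pow]
  rw [lintegral_const_mul' _ _ (by finiteness), mul_comm]
  congr 1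
  rw [← ofReal_norm (J₂ B x), ← ENNReal.ofReal_pow (norm_nonneg _), Real.norm_eq_abs, sq_abs, J₂,
    Real.sq_sqrt (integral_nonneg fun y => by positivity),
    ofReal_integral_eq_lintegral_ofReal hx (Eventually.of_forall fun y => by positivity)]
  refine lintegral_congr fun y => ?_
  rw [ENNReal.ofReal_pow (norm_nonneg _), ofReal_norm]

section Potential

variable {Ω : Set (Pt n)} {A : Pt n → Pt n → Vec n} {q : Pt n → ℝ}

theorem MemP.memLp_smul_fst (hs0 : 0 < s) (hs1 : s < 1) (hsn : 2 * s < n) (hP : MemP s Ω A q)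
    {u : Pt n → ℂ} (hu : MemH s u) :
    MemLp (fun z : Pt n × Pt n => u z.1 • A z.1 z.2) 2 volume :=
  memLp_smul_of_memLp_J₂ hs0 hs1 hsn hP.p5_memLp hP.p1_snd hu

theorem MemP.memLp_smul_snd (hs0 : 0 < s) (hs1 : s < 1) (hsn : 2 * s < n) (hP : MemP s Ω A q)
    {u : Pt n → ℂ} (hu : MemH s u) :
    MemLp (fun z : Pt n × Pt n => u z.2 • A z.1 z.2) 2 volume :=
  memLp_swap (V := fun x y => u x • A y x)
    (memLp_smul_of_memLp_J₂ (B := fun x y => A y x) hs0 hs1 hsn (memLp_swap hP.p5_memLp)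
      hP.p1_fst hu)

theorem MemP.memLp_magGrad (hs0 : 0 < s) (hs1 : s < 1) (hsn : 2 * s < n) (hP : MemP s Ω A q)
    {u : Pt n → ℂ} (hu : MemH s u) :
    MemLp (fun z : Pt n × Pt n => magGrad s A u z.1 z.2) 2 volume :=
  (hu.memLp_fracGrad hs0 hs1).add (hP.memLp_smul_fst hs0 hs1 hsn hu)

theorem MemP.integrableOn_mul (hs0 : 0 < s) (hs1 : s < 1) (hsn : 2 * s < n) (hP : MemP s Ω A q)
    {u v : Pt n → ℂ} (hu : MemH s u) (hv : MemH s v) :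
    IntegrableOn (fun x => (q x : ℂ) * (u x * v x)) Ω volume := by
  have hp := two_le_expP n s
  have h1 : expP n s - 1 ≠ 0 := by linarith
  have h2 : expP n s ≠ 0 := by linarith
  have hp' : 0 < expP n s / (expP n s - 1) := div_pos (by linarith) (by linarith)
  have t1 : Real.HolderTriple (2 * (expP n s / (expP n s - 1))) (2 * (expP n s / (expP n s - 1)))
      (expP n s / (expP n s - 1)) := ⟨by field_simp; ring, by linarith, by linarith⟩
  have t2 : Real.HolderTriple (expP n s) (expP n s / (expP n s - 1)) 1 :=
    ⟨by field_simp; ring, by linarith, hp'⟩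
  have := t1.ennrealOfReal
  have : ENNReal.HolderTriple (ENNReal.ofReal (expP n s))
    (ENNReal.ofReal (expP n s / (expP n s - 1))) 1 := by simpa using t2.ennrealOfReal
  have huv : MemLp (fun x => u x * v x) (ENNReal.ofReal (expP n s / (expP n s - 1))) volume :=
    MemLp.mul' (hv.memLp_dual hs0 hs1 hsn) (hu.memLp_dual hs0 hs1 hsn)
  have hq : MemLp (fun x => (q x : ℂ)) (ENNReal.ofReal (expP n s)) (volume.restrict Ω) :=
    hP.p4.ofReal
  have h : MemLp (fun x => (q x : ℂ) * (u x * v x)) 1 (volume.restrict Ω) :=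
    MemLp.mul' (huv.restrict Ω) hq
  exact memLp_one_iff_integrable.1 h

end Potential

end

section

variable {n : ℕ} {s : ℝ}

/-! ### Absolute convergence -/

theorem fracGrad_mul (s : ℝ) (u v : Pt n → ℂ) (x y : Pt n) :
    fracGrad s (fun x => u x * v x) x y = u x • fracGrad s v x y + v y • fracGrad s u x y := by
  simp only [fracGrad, smul_smul, ← add_smul]
  congr 1
  ring

theorem ae_fst_snd {P : Pt n → Prop} (h : ∀ᵐ x, P x) : ∀ᵐ z : Pt n × Pt n, P z.1 ∧ P z.2 := by
  rw [Measure.volume_eq_prod]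
  have h1 : ∀ᵐ p : Pt n × Pt n ∂(volume.prod volume), P p.1 :=
    Measure.quasiMeasurePreserving_fst.ae h
  have h2 : ∀ᵐ p : Pt n × Pt n ∂(volume.prod volume), P p.2 :=
    Measure.quasiMeasurePreserving_snd.ae h
  filter_upwards [h1, h2] with p h1 h2 using ⟨h1, h2⟩

/-- Integrability statements weighted by `H^s` functions become unweighted ones on each ball. -/
theorem exists_memH_eq_one (n : ℕ) (s : ℝ) (k : ℕ) :
    ∃ f : Pt n → ℂ, MemH s f ∧ ∀ x, ‖x‖ ≤ k → f x = 1 := by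
  let b : ContDiffBump (0 : Pt n) := ⟨k + 1, k + 2, by positivity, by linarith⟩
  obtain ⟨φ, hφ⟩ := exists_schwartz_ofReal b.contDiff b.hasCompactSupport
  refine ⟨φ, memH_schwartz φ, fun x hx => ?_⟩
  rw [hφ, b.one_of_mem_closedBall (mem_closedBall_zero_iff.2 (hx.trans (by simp [b]))),
    Complex.ofReal_one]

theorem integral_sub_add_sub_add {α : Type*} [MeasurableSpace α] {μ : Measure α}
    {f₁ f₂ f₃ f₄ f₅ : α → ℂ} (h₁ : Integrable f₁ μ) (h₂ : Integrable f₂ μ) (h₃ : Integrable f₃ μ)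
    (h₄ : Integrable f₄ μ) (h₅ : Integrable f₅ μ) :
    ∫ z, (f₁ z - f₂ z + f₃ z - f₄ z + f₅ z) ∂μ
      = (∫ z, f₁ z ∂μ) - (∫ z, f₂ z ∂μ) + (∫ z, f₃ z ∂μ) - (∫ z, f₄ z ∂μ) + ∫ z, f₅ z ∂μ := by
  have h₁₂ : Integrable (fun z => f₁ z - f₂ z) μ := h₁.sub h₂
  have h₁₃ : Integrable (fun z => f₁ z - f₂ z + f₃ z) μ := h₁₂.add h₃
  have h₁₄ : Integrable (fun z => f₁ z - f₂ z + f₃ z - f₄ z) μ := h₁₃.sub h₄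
  rw [integral_add h₁₄ h₅, integral_sub h₁₃ h₄, integral_add h₁₂ h₃, integral_sub h₁ h₂]

section Convergence

variable {Ω : Set (Pt n)} {γ : Pt n → ℝ} {A : Pt n → Pt n → Vec n} {q : Pt n → ℝ}
  {u v : Pt n → ℂ}

theorem IsConductivity.aestronglyMeasurable_sqrtC (hγ : IsConductivity s Ω γ) :
    AEStronglyMeasurable (sqrtC γ) :=
  Complex.continuous_ofReal.comp_aestronglyMeasurable hγ.aestronglyMeasurable_sqrt

theorem IsConductivity.exists_bounds_sqrtC (hγ : IsConductivity s Ω γ) :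
    ∃ B : ℝ, ∀ᵐ x, ‖sqrtC γ x‖ ≤ B ∧ ‖(sqrtC γ x)⁻¹‖ ≤ B := by
  obtain ⟨a, b, ha, h⟩ := hγ.exists_bounds
  refine ⟨max b a⁻¹, ?_⟩
  filter_upwards [h] with x hx
  rw [norm_inv, sqrtC, Complex.norm_real, Real.norm_of_nonneg (Real.sqrt_nonneg _)]
  exact ⟨hx.2.trans (le_max_left _ _), (inv_anti₀ ha hx.1).trans (le_max_right _ _)⟩

theorem IsConductivity.memH_mul (hs0 : 0 < s) (hs1 : s < 1) (hsn : 2 * s < n)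
    (hγ : IsConductivity s Ω γ) (hu : MemH s u) : MemH s fun x => sqrtC γ x * u x :=
  (hγ.isMultiplier_sqrt hs0 hs1 hsn).1 u hu

theorem div_sqrtC_eq (γ : Pt n → ℝ) (u : Pt n → ℂ) :
    (fun x => u x / sqrtC γ x) = fun x => (((Real.sqrt (γ x))⁻¹ : ℝ) : ℂ) * u x := by
  ext x
  rw [sqrtC, div_eq_inv_mul, Complex.ofReal_inv]

theorem IsConductivity.memH_div (hs0 : 0 < s) (hs1 : s < 1) (hsn : 2 * s < n)
    (hγ : IsConductivity s Ω γ) (hu : MemH s u) : MemH s fun x => u x / sqrtC γ x := by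
  rw [div_sqrtC_eq]
  exact (hγ.isMultiplier_inv_sqrt hs0 hs1 hsn).1 u hu

/-- The Leibniz rule evaluates one factor at `x` and the other at `y`, so `u(x) A` needs the
marginal `J₂ A` and `v(y) A` needs `J₁ A`. -/
theorem MemP.integrable_dot_fracGrad (hs0 : 0 < s) (hs1 : s < 1) (hsn : 2 * s < n)
    (hP : MemP s Ω A q) (hu : MemH s u) (hv : MemH s v) :
    Integrable (fun z : Pt n × Pt n => dot (A z.1 z.2) (fracGrad s (fun x => u x * v x) z.1 z.2))
      volume := by
  have h1 := integrable_dot (hP.memLp_smul_fst hs0 hs1 hsn hu) (hv.memLp_fracGrad hs0 hs1)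
  have h2 := integrable_dot (hP.memLp_smul_snd hs0 hs1 hsn hv) (hu.memLp_fracGrad hs0 hs1)
  refine (h1.add h2).congr (Eventually.of_forall fun z => ?_)
  simp only [Pi.add_apply, fracGrad_mul, dot_add_right, dot_smul_right, dot_smul_left]

theorem dot_symPart_fracGrad (φ : Pt n → ℂ) (x y : Pt n) :
    dot (parPart (symPart A) x y) (fracGrad s φ x y)
      = 2⁻¹ * (dot (A x y) (fracGrad s φ x y) + dot (A y x) (fracGrad s φ y x)) := by
  rw [dot_parPart_fracGrad, symPart, dot_smul_left, dot_add_left, fracGrad_swap s φ x y]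

/-- The gradient is symmetric under `x ↔ y` and parallel to `x - y`, so neither the antisymmetric
nor the orthogonal part of `A` contributes to the integral. -/
theorem fracDiv_symPart {φ : Pt n → ℂ}
    (h : Integrable (fun z : Pt n × Pt n => dot (A z.1 z.2) (fracGrad s φ z.1 z.2)) volume) :
    PairConv (parPart (symPart A)) (fracGrad s φ) ∧
      fracDiv s (parPart (symPart A)) φ = ∫ z : Pt n × Pt n, dot (A z.1 z.2) (fracGrad s φ z.1 z.2) := by
  have hsw : Integrable (fun z : Pt n × Pt n => dot (A z.2 z.1) (fracGrad s φ z.2 z.1)) volume :=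
    Integrable.swap h
  have hsi : ∫ z : Pt n × Pt n, dot (A z.2 z.1) (fracGrad s φ z.2 z.1)
      = ∫ z : Pt n × Pt n, dot (A z.1 z.2) (fracGrad s φ z.1 z.2) :=
    integral_prod_swap (μ := volume) (ν := volume)
      (fun z : Pt n × Pt n => dot (A z.1 z.2) (fracGrad s φ z.1 z.2))
  constructor
  · rw [PairConv]
    simp_rw [dot_symPart_fracGrad]
    exact (h.add hsw).const_mul _
  · rw [fracDiv, pair]
    simp_rw [dot_symPart_fracGrad]
    rw [integral_const_mul, integral_add h hsw, hsi]
    ring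

/-- One of `u`, `v` is attached to each vector: `u ∇^s γ^{1/2} · v A` and `uA · vA` are products of
`L²` fields, and the remaining coefficients are bounded. -/
theorem integrable_qInner_mul (hs0 : 0 < s) (hs1 : s < 1) (hsn : 2 * s < n)
    (hγ : IsConductivity s Ω γ) (hP : MemP s Ω A q) (hu : MemH s u) (hv : MemH s v) :
    Integrable (fun z : Pt n × Pt n => qInner s γ A z.1 z.2 * (u z.1 * v z.1)) volume := by
  obtain ⟨B, hB⟩ := hγ.exists_bounds_sqrtC
  have hg := hγ.aestronglyMeasurable_sqrtC
  have hgi : AEStronglyMeasurable fun x => (sqrtC γ x)⁻¹ :=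
    hg.aemeasurable.inv.aestronglyMeasurable
  have h1 := integrable_dot (hγ.memLp_smul_fracGrad hs0 hs1 hsn hu)
    (hP.memLp_smul_fst hs0 hs1 hsn hv)
  have h2 := integrable_dot (hP.memLp_smul_fst hs0 hs1 hsn hu) (hP.memLp_smul_fst hs0 hs1 hsn hv)
  have hf1 : AEStronglyMeasurable (fun z : Pt n × Pt n => -(sqrtC γ z.1)⁻¹) volume :=
    (hgi.comp_fst (ν := volume)).neg
  have hf2 : AEStronglyMeasurable
      (fun z : Pt n × Pt n => sqrtC γ z.2 * (sqrtC γ z.1)⁻¹ - 1) volume :=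
    ((hg.comp_snd (μ := volume)).mul (hgi.comp_fst (ν := volume))).sub aestronglyMeasurable_const
  have t1 := h1.bdd_mul (c := B) hf1 (by
    filter_upwards [ae_fst_snd hB] with z hz
    rw [norm_neg]
    exact hz.1.2)
  have t2 := h2.bdd_mul (c := B * B + 1) hf2 (by
    filter_upwards [ae_fst_snd hB] with z hz
    refine (norm_sub_le _ _).trans ?_
    rw [norm_mul, norm_one]
    have := (norm_nonneg _).trans hz.2.1
    gcongr
    · exact hz.2.1
    · exact hz.1.2)
  refine (t1.add t2).congr (Eventually.of_forall fun z => ?_)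
  simp only [Pi.add_apply, qInner, dot_smul_left, dot_smul_right]
  ring

theorem qPrimeConv_mul (hs0 : 0 < s) (hs1 : s < 1) (hsn : 2 * s < n)
    (hγ : IsConductivity s Ω γ) (hP : MemP s Ω A q) (hu : MemH s u) (hv : MemH s v) :
    QPrimeConv s Ω γ A q (fun x => u x * v x) := by
  have hu' := hγ.memH_div hs0 hs1 hsn hu
  have hv' := hγ.memH_div hs0 hs1 hsn hv
  -- The division is absorbed into one factor, so a product of two `H^s` functions remains.
  have e : (fun x => u x * v x / sqrtC γ x) = fun x => u x / sqrtC γ x * v x := by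
    ext x; ring
  obtain ⟨B, hB⟩ := hγ.exists_bounds_sqrtC
  have hint := fun {u v : Pt n → ℂ} (hu : MemH s u) (hv : MemH s v) =>
    integrable_qInner_mul hs0 hs1 hsn hγ hP hu hv
  refine ⟨?_, (fracDiv_symPart (hP.integrable_dot_fracGrad hs0 hs1 hsn hu hv)).1, ?_, ?_, ?_, ?_⟩
  · refine (hP.integrableOn_mul hs0 hs1 hsn hu' hv').congr_fun_ae (ae_restrict_of_ae ?_)
    obtain ⟨a, b, ha, h⟩ := hγ.bounds
    filter_upwards [h] with x hx
    have hγ0 : 0 ≤ γ x := ha.le.trans hx.1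
    have h2 : (sqrtC γ x) * (sqrtC γ x) = (γ x : ℂ) := by
      rw [sqrtC, ← Complex.ofReal_mul, Real.mul_self_sqrt hγ0]
    rw [div_mul_div_comm, h2]
    push_cast
    ring
  · rw [e, PairConv]
    have h := hP.integrable_dot_fracGrad hs0 hs1 hsn hu' hv
    refine (h.bdd_mul (c := B) (hγ.aestronglyMeasurable_sqrtC.comp_snd (μ := volume)) ?_).congr
      (Eventually.of_forall fun z => (dot_smul_left _ _ _).symm)
    filter_upwards [ae_fst_snd hB] with z hz using hz.2.1
  · rw [e, PairConv]
    -- Leibniz leaves `∇^s γ^{1/2}` weighted at `x` in one term and at `y` in the other; the second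
    -- is reduced to the first by symmetry of the gradient.
    have h1 := integrable_dot (hγ.memLp_smul_fracGrad hs0 hs1 hsn hu') (hv.memLp_fracGrad hs0 hs1)
    have hs := memLp_swap (V := fun x y => v x • fracGrad s (sqrtC γ) x y)
      (hγ.memLp_smul_fracGrad hs0 hs1 hsn hv)
    have h2 := integrable_dot hs (hu'.memLp_fracGrad hs0 hs1)
    refine (h1.add h2).congr (Eventually.of_forall fun z => ?_)
    simp only [Pi.add_apply, fracGrad_mul, dot_add_right, dot_smul_right, dot_smul_left]
    rw [fracGrad_swap s (sqrtC γ) z.1 z.2]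
  -- The weight is taken to be `1` on a large ball, so Fubini gives integrability in `y` for almost
  -- every `x` in it; countably many balls cover the space.
  · have hk : ∀ k : ℕ, ∀ᵐ x : Pt n, ‖x‖ ≤ k → Integrable (fun y => qInner s γ A x y) volume := by
      intro k
      obtain ⟨f, hf, hf1⟩ := exists_memH_eq_one n s k
      have hi : Integrable (fun z : Pt n × Pt n => qInner s γ A z.1 z.2 * (f z.1 * f z.1))
        (volume.prod volume) := hint hf hf
      filter_upwards [hi.prod_right_ae] with x hx hxk
      simpa [hf1 x hxk] using hx
    filter_upwards [ae_all_iff.2 hk] with x hx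
    obtain ⟨k, hk⟩ := exists_nat_ge ‖x‖
    exact hx k hk
  · have hi : Integrable (fun z : Pt n × Pt n => qInner s γ A z.1 z.2 * (u z.1 * v z.1))
      (volume.prod volume) := hint hu hv
    simpa only [integral_mul_const] using hi.integral_prod_left

/-! ### The identity -/

/-- The relations `w = γ^{1/2}u` and `φ = γ^{1/2}v` are required only almost everywhere, so either
member of each pair may be the given one. -/
theorem condOp_add_eq (hs0 : 0 < s) (hs1 : s < 1) (hsn : 2 * s < n)
    (hγ : IsConductivity s Ω γ) (hP : MemP s Ω A q) {w φ : Pt n → ℂ}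
    (hw : MemH s w) (hφ : MemH s φ) (hwu : ∀ᵐ x, w x = sqrtC γ x * u x)
    (hφv : ∀ᵐ x, φ x = sqrtC γ x * v x) :
    condOp s γ A u v + funPot Ω q (fun x => u x * v x)
      = magLap s A w φ + qPrime s Ω γ A q (fun x => w x * φ x) := by
  have hconv := qPrimeConv_mul hs0 hs1 hsn hγ hP hw hφ
  have hA := hP.integrable_dot_fracGrad hs0 hs1 hsn hw hφ
  have hI : Integrable (fun z : Pt n × Pt n => qInner s γ A z.1 z.2 * (w z.1 * φ z.1))
    (volume.prod volume) := integrable_qInner_mul hs0 hs1 hsn hγ hP hw hφ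
  have hM := integrable_dot (hP.memLp_magGrad hs0 hs1 hsn hw) (hP.memLp_magGrad hs0 hs1 hsn hφ)
  have hγpos : ∀ᵐ x, 0 < γ x := by
    obtain ⟨a, b, ha, h⟩ := hγ.bounds
    filter_upwards [h] with x hx using ha.trans_le hx.1
  have hpot : funPot Ω (fun x => q x / γ x) (fun x => w x * φ x)
      = funPot Ω q (fun x => u x * v x) := by
    refine integral_congr_ae (ae_restrict_of_ae ?_)
    filter_upwards [hγpos, hwu, hφv] with x hx h1 h2
    have h3 : (sqrtC γ x) * (sqrtC γ x) = (γ x : ℂ) := by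
      rw [sqrtC, ← Complex.ofReal_mul, Real.mul_self_sqrt hx.le]
    have h4 : (γ x : ℂ) ≠ 0 := by exact_mod_cast hx.ne'
    rw [h1, h2, show sqrtC γ x * u x * (sqrtC γ x * v x)
      = sqrtC γ x * sqrtC γ x * (u x * v x) by ring, h3]
    push_cast
    field_simp
  -- A rational identity in the values of `u`, `v`, `γ^{1/2}` at the two points and in the products
  -- of `A` and `alpha`; no symmetrization is needed before integrating.
  have hpt : ∀ᵐ z : Pt n × Pt n,
      dot ((Real.sqrt (γ z.1 * γ z.2) : ℂ) • magGrad s A u z.1 z.2) (magGrad s A v z.1 z.2)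
      = dot (magGrad s A w z.1 z.2) (magGrad s A φ z.1 z.2)
        - dot (A z.1 z.2) (fracGrad s (fun x => w x * φ x) z.1 z.2)
        + dot (sqrtC γ z.2 • A z.1 z.2) (fracGrad s (fun x => w x * φ x / sqrtC γ x) z.1 z.2)
        - dot (fracGrad s (sqrtC γ) z.1 z.2)
            (fracGrad s (fun x => w x * φ x / sqrtC γ x) z.1 z.2)
        + qInner s γ A z.1 z.2 * (w z.1 * φ z.1) := by
    filter_upwards [ae_fst_snd hγpos, ae_fst_snd hwu, ae_fst_snd hφv] with z h1 h2 h3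
    have e1 : ((Real.sqrt (γ z.1 * γ z.2) : ℝ) : ℂ) = sqrtC γ z.1 * sqrtC γ z.2 := by
      rw [Real.sqrt_mul h1.1.le, Complex.ofReal_mul, sqrtC, sqrtC]
    have n1 : sqrtC γ z.1 ≠ 0 := by
      rw [sqrtC]; exact_mod_cast (Real.sqrt_pos.2 h1.1).ne'
    have n2 : sqrtC γ z.2 ≠ 0 := by
      rw [sqrtC]; exact_mod_cast (Real.sqrt_pos.2 h1.2).ne'
    rw [e1]
    simp only [magGrad, fracGrad, qInner, dot_add_left, dot_add_right, dot_smul_left,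
      dot_smul_right, h2.1, h2.2, h3.1, h3.2, dot_comm (alpha s z.1 z.2) (A z.1 z.2)]
    field_simp
    ring
  have hsum : condOp s γ A u v = magLap s A w φ - fracDiv s (parPart (symPart A)) (fun x => w x * φ x)
      + fracDiv s (fun x y => sqrtC γ y • A x y) (fun x => w x * φ x / sqrtC γ x)
      - fracLap s (sqrtC γ) (fun x => w x * φ x / sqrtC γ x)
      + ∫ x, (∫ y, qInner s γ A x y) * (w x * φ x) := by
    have hIe : ∫ x, (∫ y, qInner s γ A x y) * (w x * φ x)
        = ∫ z : Pt n × Pt n, qInner s γ A z.1 z.2 * (w z.1 * φ z.1) := by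
      rw [Measure.volume_eq_prod, integral_prod _ hI]
      simp only [integral_mul_const]
    rw [(fracDiv_symPart hA).2, hIe, condOp, magDiv, pair, integral_congr_ae hpt]
    exact integral_sub_add_sub_add hM hA hconv.divAγ hconv.lap hI
  rw [hsum, qPrime, hpot]
  ring

end Convergence

end

section

variable {n : ℕ} {s : ℝ}

/-! ### Exterior values and the equivalence -/

section Equivalence

variable {Ω : Set (Pt n)} {γ : Pt n → ℝ} {A : Pt n → Pt n → Vec n} {q : Pt n → ℝ}
  {u g : Pt n → ℂ}

theorem IsConductivity.ae_sqrtC_ne_zero (hγ : IsConductivity s Ω γ) : ∀ᵐ x, sqrtC γ x ≠ 0 := by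
  filter_upwards [hγ.ae_pos] with x hx
  rw [sqrtC]
  exact_mod_cast hx.ne'

theorem IsConductivity.memHTilde_mul (hs0 : 0 < s) (hs1 : s < 1) (hsn : 2 * s < n)
    (hΩ : IsOpen Ω) (hγ : IsConductivity s Ω γ) (hu : MemHTilde s Ω u) :
    MemHTilde s Ω fun x => sqrtC γ x * u x :=
  (hγ.isMultiplier_sqrt hs0 hs1 hsn).memHTilde hs0 hs1 hΩ hu

theorem IsConductivity.memHTilde_div (hs0 : 0 < s) (hs1 : s < 1) (hsn : 2 * s < n)
    (hΩ : IsOpen Ω) (hγ : IsConductivity s Ω γ) (hu : MemHTilde s Ω u) :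
    MemHTilde s Ω fun x => u x / sqrtC γ x := by
  rw [div_sqrtC_eq]
  exact (hγ.isMultiplier_inv_sqrt hs0 hs1 hsn).memHTilde hs0 hs1 hΩ hu

theorem IsConductivity.memHTilde_mul_sub_iff (hs0 : 0 < s) (hs1 : s < 1) (hsn : 2 * s < n)
    (hΩ : IsOpen Ω) (hγ : IsConductivity s Ω γ) {G : Pt n → ℂ} :
    MemHTilde s Ω (fun x => u x - G x) ↔
      MemHTilde s Ω (fun x => sqrtC γ x * u x - sqrtC γ x * G x) := by
  constructor
  · intro h
    simpa only [mul_sub] using hγ.memHTilde_mul hs0 hs1 hsn hΩ h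
  · intro h
    refine (hγ.memHTilde_div hs0 hs1 hsn hΩ h).congr hs0 hs1 ?_
    filter_upwards [hγ.ae_sqrtC_ne_zero] with x hx
    rw [← mul_sub, mul_div_cancel_left₀ _ hx]

theorem IsConductivity.hasExteriorValue_iff (hs0 : 0 < s) (hs1 : s < 1) (hsn : 2 * s < n)
    (hΩ : IsOpen Ω) (hγ : IsConductivity s Ω γ) :
    HasExteriorValue s Ω u g ↔
      HasExteriorValue s Ω (fun x => sqrtC γ x * u x) (fun x => sqrtC γ x * g x) := by
  constructor
  · rintro ⟨G, hG, hGg, h⟩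
    refine ⟨fun x => sqrtC γ x * G x, hγ.memH_mul hs0 hs1 hsn hG, ?_,
      (hγ.memHTilde_mul_sub_iff hs0 hs1 hsn hΩ).1 h⟩
    filter_upwards [hGg] with x hx
    rw [hx]
  · rintro ⟨F, hF, hFg, h⟩
    refine ⟨fun x => F x / sqrtC γ x, hγ.memH_div hs0 hs1 hsn hF, ?_,
      (hγ.memHTilde_mul_sub_iff hs0 hs1 hsn hΩ).2 (h.congr hs0 hs1 ?_)⟩
    · filter_upwards [hFg, ae_restrict_of_ae hγ.ae_sqrtC_ne_zero] with x hx hx0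
      rw [hx, mul_div_cancel_left₀ _ hx0]
    · filter_upwards [hγ.ae_sqrtC_ne_zero] with x hx
      rw [mul_div_cancel₀ _ hx]

theorem IsConductivity.memH_mul_iff (hs0 : 0 < s) (hs1 : s < 1) (hsn : 2 * s < n)
    (hγ : IsConductivity s Ω γ) : MemH s u ↔ MemH s fun x => sqrtC γ x * u x := by
  refine ⟨hγ.memH_mul hs0 hs1 hsn, fun h => (hγ.memH_div hs0 hs1 hsn h).congr hs0 hs1 ?_⟩
  filter_upwards [hγ.ae_sqrtC_ne_zero] with x hx
  rw [mul_div_cancel_left₀ _ hx]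

/-- Stability of `V` under `γ^{1/2}` and `γ^{-1/2}` makes `φ = γ^{1/2}v` range over all tests up to
null sets. Keeping `V` abstract covers both test classes. -/
theorem solvesFMCE_iff (hs0 : 0 < s) (hs1 : s < 1) (hsn : 2 * s < n) (hΩ : IsOpen Ω)
    (hγ : IsConductivity s Ω γ) (hP : MemP s Ω A q) {V : Set (Pt n → ℂ)}
    (hV : ∀ v ∈ V, MemH s v) (hmul : ∀ v ∈ V, (fun x => sqrtC γ x * v x) ∈ V)
    (hdiv : ∀ v ∈ V, (fun x => v x / sqrtC γ x) ∈ V) :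
    SolvesFMCE s Ω V γ A (funPot Ω q) g u ↔
      SolvesFMSE s Ω V A (qPrime s Ω γ A q) (fun x => sqrtC γ x * g x)
        (fun x => sqrtC γ x * u x) := by
  constructor
  · rintro ⟨hu, hext, h⟩
    refine ⟨hγ.memH_mul hs0 hs1 hsn hu, (hγ.hasExteriorValue_iff hs0 hs1 hsn hΩ).1 hext, fun φ hφ => ?_⟩
    rw [← condOp_add_eq (u := u) (v := fun x => φ x / sqrtC γ x) hs0 hs1 hsn hγ hP
      (hγ.memH_mul hs0 hs1 hsn hu) (hV φ hφ) (Eventually.of_forall fun x => rfl) ?_]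
    · exact h _ (hdiv φ hφ)
    · filter_upwards [hγ.ae_sqrtC_ne_zero] with x hx
      rw [mul_div_cancel₀ _ hx]
  · rintro ⟨hwu, hext, h⟩
    refine ⟨(hγ.memH_mul_iff hs0 hs1 hsn).2 hwu, (hγ.hasExteriorValue_iff hs0 hs1 hsn hΩ).2 hext,
      fun v hv => ?_⟩
    rw [condOp_add_eq hs0 hs1 hsn hγ hP hwu (hV _ (hmul v hv))
      (Eventually.of_forall fun x => rfl) (Eventually.of_forall fun x => rfl)]
    exact h _ (hmul v hv)

end Equivalence

end

end FMCE

end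

/-! ### The Liouville reduction. -/

theorem mainTheorem8 (n : ℕ) (s : ℝ) (hs0 : 0 < s) (hs1 : s < 1) (hsn : 2 * s < n)
    (Ω : Set (FMCE.Pt n)) (hΩ : IsOpen Ω)
    (γ : FMCE.Pt n → ℝ) (hγ : FMCE.IsConductivity s Ω γ)
    (A : FMCE.Pt n → FMCE.Pt n → FMCE.Vec n) (q : FMCE.Pt n → ℝ) (hP : FMCE.MemP s Ω A q) :
    -- multiplication by `γ^{1/2}` and by `γ^{-1/2}` preserves `H^s(ℝⁿ)`
    (∀ u : FMCE.Pt n → ℂ, FMCE.MemH s u →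
      FMCE.MemH s (fun x => FMCE.sqrtC γ x * u x) ∧
      FMCE.MemH s (fun x => u x / FMCE.sqrtC γ x)) ∧
    -- the magnetic gradients are in `L²`, and the products `q u`, `q' u` make sense in `H^s`
    (∀ u : FMCE.Pt n → ℂ, FMCE.MemH s u →
      MemLp (fun z : FMCE.Pt n × FMCE.Pt n => FMCE.magGrad s A u z.1 z.2) 2 volume) ∧
    (∀ u v : FMCE.Pt n → ℂ, FMCE.MemH s u → FMCE.MemH s v →
      IntegrableOn (fun x => (q x : ℂ) * (u x * v x)) Ω volume ∧
      FMCE.QPrimeConv s Ω γ A q (fun x => u x * v x)) ∧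
    -- the equivalence of the two exterior value problems
    (∀ u g : FMCE.Pt n → ℂ, FMCE.MemH s u → FMCE.MemHOn s (FMCE.ext Ω) g →
      FMCE.MemHOn s (FMCE.ext Ω) (fun x => FMCE.sqrtC γ x * g x) ∧
      -- tested against `H̃^s(Ω)`
      (FMCE.SolvesFMCE s Ω {v | FMCE.MemHTilde s Ω v} γ A (FMCE.funPot Ω q) g u ↔
        FMCE.SolvesFMSE s Ω {v | FMCE.MemHTilde s Ω v} A (FMCE.qPrime s Ω γ A q)
          (fun x => FMCE.sqrtC γ x * g x) (fun x => FMCE.sqrtC γ x * u x)) ∧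
      -- tested against `H^s(ℝⁿ)`
      (FMCE.SolvesFMCE s Ω {v | FMCE.MemH s v} γ A (FMCE.funPot Ω q) g u ↔
        FMCE.SolvesFMSE s Ω {v | FMCE.MemH s v} A (FMCE.qPrime s Ω γ A q)
          (fun x => FMCE.sqrtC γ x * g x) (fun x => FMCE.sqrtC γ x * u x)) ∧
      -- the exterior conditions agree for each given extension `G` of the exterior value
      (∀ G : FMCE.Pt n → ℂ, FMCE.MemH s G →
        (FMCE.MemHTilde s Ω (fun x => u x - G x) ↔
          FMCE.MemHTilde s Ω (fun x => FMCE.sqrtC γ x * u x - FMCE.sqrtC γ x * G x)))) ∧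
    -- the formula `C^s_{γ,A}(γ^{-1/2} w) + q γ^{-1/2} w = γ^{1/2} ((-Δ)^s_A + q') w` in `H^{-s}`
    (∀ w v : FMCE.Pt n → ℂ, FMCE.MemH s w → FMCE.MemH s v →
      FMCE.condOp s γ A (fun x => w x / FMCE.sqrtC γ x) v
          + FMCE.funPot Ω q (fun x => w x / FMCE.sqrtC γ x * v x) =
        FMCE.magLap s A w (fun x => FMCE.sqrtC γ x * v x)
          + FMCE.qPrime s Ω γ A q (fun x => w x * (FMCE.sqrtC γ x * v x))) := by
  refine ⟨fun u hu => ⟨hγ.memH_mul hs0 hs1 hsn hu, hγ.memH_div hs0 hs1 hsn hu⟩,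
    fun u hu => hP.memLp_magGrad hs0 hs1 hsn hu,
    fun u v hu hv => ⟨hP.integrableOn_mul hs0 hs1 hsn hu hv,
      FMCE.qPrimeConv_mul hs0 hs1 hsn hγ hP hu hv⟩,
    fun u g _ hg => ⟨?_, ?_, ?_, fun G _ => hγ.memHTilde_mul_sub_iff hs0 hs1 hsn hΩ⟩,
    fun w v hw hv => ?_⟩
  · obtain ⟨G, hG, hGg⟩ := hg
    refine ⟨fun x => FMCE.sqrtC γ x * G x, hγ.memH_mul hs0 hs1 hsn hG, ?_⟩
    filter_upwards [hGg] with x hx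
    rw [hx]
  · exact FMCE.solvesFMCE_iff hs0 hs1 hsn hΩ hγ hP (fun v hv => hv.1)
      (fun v hv => hγ.memHTilde_mul hs0 hs1 hsn hΩ hv)
      (fun v hv => hγ.memHTilde_div hs0 hs1 hsn hΩ hv)
  · exact FMCE.solvesFMCE_iff hs0 hs1 hsn hΩ hγ hP (fun v hv => hv)
      (fun v hv => hγ.memH_mul hs0 hs1 hsn hv) (fun v hv => hγ.memH_div hs0 hs1 hsn hv)
  · refine FMCE.condOp_add_eq hs0 hs1 hsn hγ hP hw (hγ.memH_mul hs0 hs1 hsn hv) ?_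
      (Eventually.of_forall fun x => rfl)
    filter_upwards [hγ.ae_sqrtC_ne_zero] with x hx
    rw [mul_div_cancel₀ _ hx]
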